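/- **Setting (mixed linear regression).** Fix integers $m,n_v\ge 1$ and reals $\sigma,\nu,\alpha_t,\alpha_r$. For a parameter $\xi\to\infty$ let $p=p(\xi)$, $n_t=n_t(\xi)$, $n_r=n_r(\xi)\ge1$, $n_s=n_s(\xi)\ge1$ be integers and $\mathbf w_0=\mathbf w_0(\xi)$, $\boldsymbol\omega_0=\boldsymbol\omega_0(\xi)\in\mathbb R^p$. A task has generating parameters $\mathbf w\sim\mathcal N(\mathbf w_0,\frac{\nu^2}{p}I_p)$, and its data points are $(\mathbf x,y)$ with $y=\mathbf x^T\mathbf w+z$, $\mathbf x\sim\mathcal N(0,I_p)$, $z\sim\mathcal N(0,\sigma^2)$. There are $m$ meta-training tasks $i=1,\dots,m$, each with a training set $(X^{t(i)},\mathbf y^{t(i)})$ of $n_t$ points and a validation set $(X^{v(i)},\mathbf y^{v(i)})$ of $n_v$ points, and one meta-testing task with a target set $(X^r,\mathbf y^r)$ of $n_r$ points and a test set $(X^s,\mathbf y^s)$ of $n_s$ points (rows of the matrices are the inputs). All the generating parameters, inputs and noises are independent. **Algorithm (one-step MAML).** Let $\boldsymbol\theta^{(i)}(\boldsymbol\omega)$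 be the result of one gradient step with learning rate $\alpha_t$, started at $\boldsymbol\omega$, on the training loss $\frac{1}{2n_t}|\mathbf y^{t(i)}-X^{t(i)}\boldsymbol\theta|^2$, and let $$\mathcal L^{meta}(\boldsymbol\omega)=\frac{1}{2n_vm}\sum_{i=1}^m\left|\mathbf y^{v(i)}-X^{v(i)}\boldsymbol\theta^{(i)}(\boldsymbol\omega)\right|^2 .$$ Let $\boldsymbol\omega^\star$ be the minimizer of $\mathcal L^{meta}$ that is reached by gradient descent from the initial point $\boldsymbol\omega_0$, run to convergence with any sufficiently small step size. Let $\boldsymbol\theta^\star$ be the result of one gradient step with learning rate $\alpha_r$, started at $\boldsymbol\omega^\star$, on the target loss $\frac{1}{2n_r}|\mathbf y^r-X^r\boldsymbol\theta|^2$. The average test loss is $$\overline{\mathcal L}^{test}=\mathbb E\,\frac1{2n_s}\left|\mathbf y^s-X^s\boldsymbol\theta^\star\right|^2,$$ the expectation being over all the data. **Theorem.** Let $p>n_vm$ (overparameterized case), let $p(\xi)$ and $n_t(\xi)$ be of exact order $\xi$ (bounded above and below by positive multiples of $\xi$) as $\xi\to\infty$, and let $|\boldsymbol\omega_0-\mathbf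 w_0|=O(\xi^{-1/4})$. Put $$h^t=(1-\alpha_t)^2+\alpha_t^2\frac{p+1}{n_t},\qquad h^r=(1-\alpha_r)^2+\alpha_r^2\frac{p+1}{n_r}.$$ Then, for all sufficiently large $\xi$, the test loss is integrable, and as $\xi\to\infty$ $$\overline{\mathcal L}^{test}=\frac{\sigma^2}{2}\left(1+\frac{\alpha_r^2p}{n_r}\right)+h^r\left[\frac{\nu^2}{2}\left(1+\frac{n_vm}{p}\right)+\frac12\left(1-\frac{n_vm}{p}\right)|\boldsymbol\omega_0-\mathbf w_0|^2+\frac{\sigma^2n_vm}{2p}\,\frac{1+\frac{\alpha_t^2p}{n_t}}{h^t}\right]+O\!\left(h^r\,\xi^{-3/2}\right).$$ In particular the error is $O(\xi^{-3/2})$ whenever $h^r$ stays bounded (for instance if $n_r$ is of order at least $\xi$, or if $\alpha_r=0$). -/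

import Mathlib

open MeasureTheory ProbabilityTheory Filter Topology Asymptotics

noncomputable section

namespace MAML

/-- The parameter and input space `ℝ^p` with the Euclidean norm. -/
abbrev Vec (p : ℕ) : Type := EuclideanSpace ℝ (Fin p)

/-- `n` data points. As a dataset the pairs are (input `x`, label `y`); as raw data, before the
labels are formed, they are (input `x`, label noise `z`). -/
abbrev Points (n p : ℕ) : Type := Fin n → Vec p × ℝ

/-! ### The algorithm -/

/-- Squared loss of the linear model with parameter `θ` at one data point `(x, y)`. -/
def pointLoss {p : ℕ} (d : Vec p × ℝ) (θ : Vec p) : ℝ :=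
  (d.2 - inner ℝ d.1 θ) ^ 2 / 2

/-- Average loss over a dataset of `n` points. -/
def dataLoss {n p : ℕ} (D : Points n p) (θ : Vec p) : ℝ :=
  (∑ j, pointLoss (D j) θ) / n

/-- Inner loop: one step of gradient descent, with learning rate `α`, from `ω` on the dataset. -/
def adapt {n p : ℕ} (α : ℝ) (D : Points n p) (ω : Vec p) : Vec p :=
  ω - (α / n) • ∑ j, gradient (pointLoss (D j)) ω

/-- Meta-training loss: average over the `m` tasks of the validation loss of the parameters that
are adapted on the training set of the task. -/
def metaLoss {m nt nv p : ℕ} (α : ℝ) (Dt : Fin m → Points nt p) (Dv : Fin m → Points nv p)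
    (ω : Vec p) : ℝ :=
  (∑ i, dataLoss (Dv i) (adapt α (Dt i) ω)) / m

/-- `ω` is a global minimizer of `L`, and it is the one reached by gradient descent on `L` from the
initial point `ω₀` run to convergence, with any sufficiently small step size. -/
def IsOuterLoopSolution {p : ℕ} (L : Vec p → ℝ) (ω₀ ω : Vec p) : Prop :=
  (∀ u, L ω ≤ L u) ∧
    ∀ᶠ η : ℝ in 𝓝[>] 0,
      Tendsto (fun k : ℕ ↦ (fun u ↦ u - η • gradient L u)^[k] ω₀) atTop (𝓝 ω)

theorem IsOuterLoopSolution.unique {p : ℕ} {L : Vec p → ℝ} {ω₀ ω ω' : Vec p}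
    (h : IsOuterLoopSolution L ω₀ ω) (h' : IsOuterLoopSolution L ω₀ ω') : ω = ω' := by
  obtain ⟨η, h₁, h₂⟩ := (h.2.and h'.2).exists
  exact tendsto_nhds_unique h₁ h₂

/-- Outer loop: the (unique) optimum reached from `ω₀`. -/
def outerLoop {p : ℕ} (L : Vec p → ℝ) (ω₀ : Vec p) : Vec p :=
  Classical.epsilon (IsOuterLoopSolution L ω₀)

/-! ### Mixed linear regression -/

/-- Labels `y = xᵀ w + z` from the raw data `(x, z)` and the generating parameters `w`. -/
def label {n p : ℕ} (w : Vec p) (D : Points n p) : Points n p :=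
  fun j ↦ ((D j).1, inner ℝ (D j).1 w + (D j).2)

/-- The random quantities of one task: generating parameters, raw data of the set used for
adaptation (`a` points) and raw data of the set used for evaluation (`b` points). -/
abbrev Task (a b p : ℕ) : Type := Vec p × Points a p × Points b p

/-- Adaptation set (training or target data) of a task. -/
def Task.adaptSet {a b p : ℕ} (T : Task a b p) : Points a p := label T.1 T.2.1

/-- Evaluation set (validation or test data) of a task. -/
def Task.evalSet {a b p : ℕ} (T : Task a b p) : Points b p := label T.1 T.2.2

/-- Law of the raw data: independent `x ~ N(0, I_p)` and `z ~ N(0, σ²)`. -/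
def pointsLaw (n p : ℕ) (σ : ℝ) : Measure (Points n p) :=
  Measure.pi fun _ ↦ (stdGaussian (Vec p)).prod (gaussianReal 0 (σ ^ 2).toNNReal)

/-- Law of a task: `w ~ N(w₀, (ν² / p) I_p)`, independent of the raw data. -/
def taskLaw (a b p : ℕ) (σ ν : ℝ) (w₀ : Vec p) : Measure (Task a b p) :=
  (multivariateGaussian w₀ ((ν ^ 2 / p) • (1 : Matrix (Fin p) (Fin p) ℝ))).prod
    ((pointsLaw a p σ).prod (pointsLaw b p σ))

/-- Joint law of the `m` meta-training tasks and of the meta-testing task, all independent. -/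
def law (m nt nv nr ns p : ℕ) (σ ν : ℝ) (w₀ : Vec p) :
    Measure ((Fin m → Task nt nv p) × Task nr ns p) :=
  (Measure.pi fun _ ↦ taskLaw nt nv p σ ν w₀).prod (taskLaw nr ns p σ ν w₀)

/-- Test loss: meta-train from `ω₀` with inner learning rate `αt`, adapt the result on the target
data of the new task with learning rate `αr`, evaluate on its test data. -/
def testLoss {m nt nv nr ns p : ℕ} (αt αr : ℝ) (ω₀ : Vec p)
    (S : (Fin m → Task nt nv p) × Task nr ns p) : ℝ :=
  dataLoss S.2.evalSet
    (adapt αr S.2.adaptSet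
      (outerLoop (metaLoss αt (fun i ↦ (S.1 i).adaptSet) fun i ↦ (S.1 i).evalSet) ω₀))

/-- Test loss averaged over the entire data distribution. -/
def avgTestLoss (m nt nv nr ns p : ℕ) (σ ν αt αr : ℝ) (w₀ ω₀ : Vec p) : ℝ :=
  ∫ S, testLoss αt αr ω₀ S ∂(law m nt nv nr ns p σ ν w₀)

/-! ### The closed form -/

/-- `h = (1 - α)² + α² (p + 1) / n`; this is `h^t` for `(α_t, n_t)` and `h^r` for `(α_r, n_r)`. -/
def hCoef (α : ℝ) (p n : ℕ) : ℝ :=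
  (1 - α) ^ 2 + α ^ 2 * ((p + 1) / n)

/-- The closed form for the average test loss; `d` is the distance of `ω₀` from `w₀`. -/
def closedForm (m nt nv nr p : ℕ) (σ ν αt αr d : ℝ) : ℝ :=
  σ ^ 2 / 2 * (1 + αr ^ 2 * p / nr) +
    hCoef αr p nr *
      (ν ^ 2 / 2 * (1 + nv * m / p) + 1 / 2 * (1 - nv * m / p) * d ^ 2 +
        σ ^ 2 * nv * m / (2 * p) * ((1 + αt ^ 2 * p / nt) / hCoef αt p nt))

end MAML

end

set_option synthInstance.maxSize 4000

open MeasureTheory ProbabilityTheory Filter Topology Asymptotics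

noncomputable section

namespace MAML

section

/-! ### Functions of polynomial growth -/

section PolyGrowth

/-! Fix the inputs. The validation residuals of the adapted parameters are affine in `ω`, so the
meta-loss is a least-squares problem with `N = nv * m` rows `b_j = (I - (αt / nt) XᵀX) x_j`. If the
rows are linearly independent, gradient descent moves only inside their span and converges to the
solution nearest to `ω₀` (`outerLoop_eq`). Averaging over the test task turns the test loss into an
affine function of `‖ω⋆ - w₀‖²` (`integral_testTask`), so only the mean of that squared distance is
needed.

Let `u = ω₀ - w₀`, let `G` be the Gram matrix of the rows, `P` the projection onto their span, and
`e` the residuals at `w₀`. Then `‖ω⋆ - w₀‖² = ‖u‖² - ‖P u‖² + eᵀ G⁻¹ e`. Averaging over parameters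
and label noise replaces the last term by `tr (G⁻¹ Σ)`, with `Σ` the covariance of `e` given the
inputs. Both matrices are nearly scalar: `G ≈ p hᵗ I` and `Σ ≈ residualVar I`, with relative
fluctuations of order `p^(-1/2)`. With `β = residualVar / (p hᵗ)` one has `tr (G⁻¹ Σ) = N β + tr
(G⁻¹ (Σ - β G))`. The first term is exact and yields the `N / p` contributions of `ν²` and `σ²`. The
second is `O(p^(-3/2))`. The term `‖P u‖²` has mean `O(‖u‖² / p)`, which is already of the size of
the error, as is the term `(N / p) ‖u‖²` of the closed form.

Bounding these expectations requires control of `G⁻¹` in mean and not only in probability: the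
inverse of the least eigenvalue of `G` must have second moment `O(p⁻²)`
(`exists_lintegral_gramInv_row_le`). An entry of the inverse of a Gaussian square matrix has a
moment of order `1/2`, because the determinant is affine in each Gaussian entry. A product over
eight independent blocks upgrades this to a second moment of the bound, and averaging over about `p`
groups of blocks gives the right scale. For `αt ≠ 0` three such bounds are chained
(`sum_sq_le_of_chain`); for `αt = 0` the rows are plain Gaussian vectors.

The fluctuations of `G` and `Σ` come from exact chi-square moments and the explicit law of `‖(I - (α
/ n) XᵀX) e‖²` (`integral_comp_norm_sq_adaptOp`). -/

/-- Continuous functions of at most polynomial growth. -/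
@[fun_prop]
def PolyGrowth {E F : Type*} [NormedAddCommGroup E] [NormedAddCommGroup F] (f : E → F) : Prop :=
  Continuous f ∧ ∃ C : ℝ, ∃ k : ℕ, ∀ x, ‖f x‖ ≤ C * (1 + ‖x‖) ^ k

variable {E F F' : Type*} [NormedAddCommGroup E] [NormedAddCommGroup F] [NormedAddCommGroup F']

theorem PolyGrowth.continuous {f : E → F} (hf : PolyGrowth f) : Continuous f := hf.1

theorem PolyGrowth.exists_bound {f : E → F} (hf : PolyGrowth f) :
    ∃ C : ℝ, ∃ k : ℕ, 0 ≤ C ∧ ∀ x, ‖f x‖ ≤ C * (1 + ‖x‖) ^ k := by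
  obtain ⟨C, k, h⟩ := hf.2
  refine ⟨|C|, k, abs_nonneg C, fun x ↦ (h x).trans ?_⟩
  gcongr
  exact le_abs_self C

theorem PolyGrowth.of_norm_le {f : E → F} {g : E → F'} (hf : Continuous f) (hg : PolyGrowth g)
    (D : ℝ) (hD : 0 ≤ D) (h : ∀ x, ‖f x‖ ≤ D * (1 + ‖g x‖)) : PolyGrowth f := by
  obtain ⟨C, k, hC, hb⟩ := hg.exists_bound
  refine ⟨hf, D * (1 + C), k, fun x ↦ (h x).trans ?_⟩
  have h1 : (1 : ℝ) ≤ (1 + ‖x‖) ^ k := one_le_pow₀ (by linarith [norm_nonneg x])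
  have h2 := hb x
  rw [mul_assoc]
  gcongr
  linarith

@[fun_prop]
theorem PolyGrowth.id : PolyGrowth (fun x : E ↦ x) :=
  ⟨continuous_id, 1, 1, fun x ↦ by simp⟩

@[fun_prop]
theorem PolyGrowth.const (c : F) : PolyGrowth (fun _ : E ↦ c) :=
  ⟨continuous_const, ‖c‖, 0, fun x ↦ by simp⟩

@[fun_prop]
theorem PolyGrowth.comp (f : F → F') (g : E → F) (hf : PolyGrowth f) (hg : PolyGrowth g) :
    PolyGrowth (fun x ↦ f (g x)) := by
  obtain ⟨C, k, hC, hb⟩ := hf.exists_bound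
  obtain ⟨D, l, hD, hd⟩ := hg.exists_bound
  refine ⟨hf.continuous.comp hg.continuous, C * (1 + D) ^ k, l * k, fun x ↦ (hb _).trans ?_⟩
  have h1 : (1 : ℝ) ≤ (1 + ‖x‖) ^ l := one_le_pow₀ (by linarith [norm_nonneg x])
  have h2 := hd x
  rw [mul_assoc, pow_mul, ← mul_pow]
  gcongr
  linarith

@[fun_prop]
theorem PolyGrowth.fst {f : E → F × F'} (hf : PolyGrowth f) : PolyGrowth (fun x ↦ (f x).1) :=
  .of_norm_le (continuous_fst.comp hf.continuous) hf 1 zero_le_one fun x ↦ by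
    have := norm_fst_le (f x)
    linarith

@[fun_prop]
theorem PolyGrowth.snd {f : E → F × F'} (hf : PolyGrowth f) : PolyGrowth (fun x ↦ (f x).2) :=
  .of_norm_le (continuous_snd.comp hf.continuous) hf 1 zero_le_one fun x ↦ by
    have := norm_snd_le (f x)
    linarith

@[fun_prop]
theorem PolyGrowth.prodMk {f : E → F} {g : E → F'} (hf : PolyGrowth f) (hg : PolyGrowth g) :
    PolyGrowth (fun x ↦ (f x, g x)) := by
  obtain ⟨C, k, hC, hb⟩ := hf.exists_bound
  obtain ⟨D, l, hD, hd⟩ := hg.exists_bound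
  refine ⟨hf.continuous.prodMk hg.continuous, C + D, k + l, fun x ↦ ?_⟩
  have h0 : (1 : ℝ) ≤ 1 + ‖x‖ := by linarith [norm_nonneg x]
  have h1 : (1 + ‖x‖) ^ k ≤ (1 + ‖x‖) ^ (k + l) := pow_le_pow_right₀ h0 (by omega)
  have h2 : (1 + ‖x‖) ^ l ≤ (1 + ‖x‖) ^ (k + l) := pow_le_pow_right₀ h0 (by omega)
  have h3 : C * (1 + ‖x‖) ^ k ≤ C * (1 + ‖x‖) ^ (k + l) := by gcongr
  have h4 : D * (1 + ‖x‖) ^ l ≤ D * (1 + ‖x‖) ^ (k + l) := by gcongr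
  have h5 : 0 ≤ C * (1 + ‖x‖) ^ (k + l) := by positivity
  have h6 : 0 ≤ D * (1 + ‖x‖) ^ (k + l) := by positivity
  rw [Prod.norm_def, add_mul]
  exact max_le (by linarith [hb x]) (by linarith [hd x])

@[fun_prop]
theorem PolyGrowth.apply {ι : Type*} [Fintype ι] (i : ι) :
    PolyGrowth (fun f : ι → F ↦ f i) :=
  .of_norm_le (continuous_apply i) .id 1 zero_le_one fun x ↦ by
    have := norm_le_pi_norm x i
    linarith

@[fun_prop]
theorem PolyGrowth.add {f g : E → F} (hf : PolyGrowth f) (hg : PolyGrowth g) :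
    PolyGrowth (fun x ↦ f x + g x) :=
  .of_norm_le (hf.continuous.add hg.continuous) (hf.prodMk hg) 2 zero_le_two fun x ↦ by
    have h1 := norm_add_le (f x) (g x)
    have h2 := norm_fst_le (f x, g x)
    have h3 := norm_snd_le (f x, g x)
    simp only at h2 h3
    linarith

@[fun_prop]
theorem PolyGrowth.neg {f : E → F} (hf : PolyGrowth f) : PolyGrowth (fun x ↦ -f x) :=
  .of_norm_le hf.continuous.neg hf 1 zero_le_one fun x ↦ by simp

@[fun_prop]
theorem PolyGrowth.sub {f g : E → F} (hf : PolyGrowth f) (hg : PolyGrowth g) :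
    PolyGrowth (fun x ↦ f x - g x) := by
  simpa only [sub_eq_add_neg] using hf.add hg.neg

@[fun_prop]
theorem PolyGrowth.sum {ι : Type*} (s : Finset ι) {f : ι → E → F} (hf : ∀ i, PolyGrowth (f i)) :
    PolyGrowth (fun x ↦ ∑ i ∈ s, f i x) := by
  classical
  induction s using Finset.induction_on with
  | empty => simpa using PolyGrowth.const (E := E) (0 : F)
  | insert a s ha ih =>
    simp only [Finset.sum_insert ha]
    exact (hf a).add ih

@[fun_prop]
theorem PolyGrowth.smul [NormedSpace ℝ F] {f : E → ℝ} {g : E → F} (hf : PolyGrowth f)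
    (hg : PolyGrowth g) : PolyGrowth (fun x ↦ f x • g x) := by
  obtain ⟨C, k, hC, hb⟩ := hf.exists_bound
  obtain ⟨D, l, hD, hd⟩ := hg.exists_bound
  refine ⟨hf.continuous.smul hg.continuous, C * D, k + l, fun x ↦ ?_⟩
  rw [norm_smul, pow_add, mul_mul_mul_comm]
  gcongr
  · exact hb x
  · exact hd x

@[fun_prop]
theorem PolyGrowth.mul {f g : E → ℝ} (hf : PolyGrowth f) (hg : PolyGrowth g) :
    PolyGrowth (fun x ↦ f x * g x) := hf.smul hg

@[fun_prop]
theorem PolyGrowth.div_const {f : E → ℝ} (hf : PolyGrowth f) (c : ℝ) :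
    PolyGrowth (fun x ↦ f x / c) := by
  simpa only [div_eq_mul_inv] using hf.mul (.const _)

@[fun_prop]
theorem PolyGrowth.pow {f : E → ℝ} (hf : PolyGrowth f) (k : ℕ) :
    PolyGrowth (fun x ↦ f x ^ k) := by
  induction k with
  | zero => simpa using PolyGrowth.const (E := E) (1 : ℝ)
  | succ k ih => simpa only [pow_succ] using ih.mul hf

@[fun_prop]
theorem PolyGrowth.norm {f : E → F} (hf : PolyGrowth f) : PolyGrowth (fun x ↦ ‖f x‖) :=
  .of_norm_le hf.continuous.norm hf 1 zero_le_one fun x ↦ by simp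

@[fun_prop]
theorem PolyGrowth.inner [InnerProductSpace ℝ F] {f g : E → F} (hf : PolyGrowth f)
    (hg : PolyGrowth g) : PolyGrowth (fun x ↦ inner ℝ (f x) (g x)) := by
  refine .of_norm_le (hf.continuous.inner hg.continuous) (hf.norm.mul hg.norm) 1 zero_le_one
    fun x ↦ ?_
  have h1 := norm_inner_le_norm (𝕜 := ℝ) (f x) (g x)
  have h2 := le_abs_self (‖f x‖ * ‖g x‖)
  rw [← Real.norm_eq_abs] at h2
  linarith

/-- Probability measures all of whose moments are finite. -/
class HasMoments [MeasurableSpace E] (μ : Measure E) : Prop extends IsProbabilityMeasure μ where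
  integrable_pow : ∀ k : ℕ, Integrable (fun x ↦ (1 + ‖x‖) ^ k) μ

variable [MeasurableSpace E] [MeasurableSpace F]

/-- Almost every integrand below is polynomial in the Gaussian data, so integrability side goals
reduce to `PolyGrowth`, which `fun_prop` decides. Only quantities involving the inverse Gram matrix
need a separate argument. -/
theorem PolyGrowth.integrable [OpensMeasurableSpace E] {μ : Measure E} [HasMoments μ]
    {f : E → ℝ} (hf : PolyGrowth f) : Integrable f μ := by
  obtain ⟨C, k, hC, hb⟩ := hf.exists_bound
  refine ((HasMoments.integrable_pow (μ := μ) k).const_mul C).mono'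
    hf.continuous.aestronglyMeasurable (ae_of_all _ hb)

instance HasMoments.prod [OpensMeasurableSpace E] [OpensMeasurableSpace F]
    [SecondCountableTopology E] [SecondCountableTopology F] (μ : Measure E)
    (ν : Measure F) [HasMoments μ] [HasMoments ν] : HasMoments (μ.prod ν) where
  integrable_pow k := by
    refine (((HasMoments.integrable_pow (μ := μ) k).comp_fst ν).add
      ((HasMoments.integrable_pow (μ := ν) k).comp_snd μ)).mono'
      (by fun_prop) (ae_of_all _ fun x ↦ ?_)
    have h1 : 0 ≤ (1 + ‖x.1‖) ^ k := by positivity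
    have h2 : 0 ≤ (1 + ‖x.2‖) ^ k := by positivity
    rw [Real.norm_of_nonneg (by positivity), Prod.norm_def]
    simp only [Pi.add_apply]
    rcases le_total ‖x.1‖ ‖x.2‖ with h | h
    · rw [max_eq_right h]; linarith
    · rw [max_eq_left h]; linarith

instance HasMoments.pi [OpensMeasurableSpace E] [SecondCountableTopology E] {ι : Type*} [Fintype ι]
    (μ : ι → Measure E)
    [∀ i, HasMoments (μ i)] : HasMoments (Measure.pi μ) where
  integrable_pow k := by
    have h : Integrable (fun x : ι → E ↦ 1 + ∑ i, (1 + ‖x i‖) ^ k) (Measure.pi μ) :=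
      (integrable_const _).add (integrable_finsetSum _ fun i _ ↦
        integrable_comp_eval (μ := μ) (i := i) (f := fun y ↦ (1 + ‖y‖) ^ k)
          (HasMoments.integrable_pow (μ := μ i) k))
    refine h.mono' (by fun_prop) (ae_of_all _ fun x ↦ ?_)
    rw [Real.norm_of_nonneg (by positivity)]
    rcases isEmpty_or_nonempty ι with hι | hι
    · simp [Pi.norm_def]
    · obtain ⟨i, -, hi⟩ := Finset.exists_mem_eq_sup Finset.univ Finset.univ_nonempty
        fun b ↦ ‖x b‖₊
      have h1 : ‖x‖ = ‖x i‖ := by rw [Pi.norm_def, hi]; rfl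
      have h2 := Finset.single_le_sum (f := fun i ↦ (1 + ‖x i‖) ^ k)
        (fun i _ ↦ by positivity) (Finset.mem_univ i)
      rw [h1]
      linarith

instance HasMoments.of_isGaussian {E : Type*} [NormedAddCommGroup E] [NormedSpace ℝ E]
    [MeasurableSpace E] [BorelSpace E] [SecondCountableTopology E] [CompleteSpace E] (μ : Measure E) [IsGaussian μ] :
    HasMoments μ where
  integrable_pow k := by
    have h : MemLp (fun x : E ↦ 1 + ‖x‖) k μ := by
      refine MemLp.add (memLp_const 1) (MemLp.norm ?_)
      exact IsGaussian.memLp_id μ k (by simp)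
    refine h.integrable_norm_pow'.congr (ae_of_all _ fun x ↦ ?_)
    simp only
    rw [Real.norm_of_nonneg (by positivity)]

end PolyGrowth

instance (n p : ℕ) (σ : ℝ) : HasMoments (pointsLaw n p σ) := by
  unfold pointsLaw
  infer_instance

instance (a b p : ℕ) (σ ν : ℝ) (w₀ : Vec p) : HasMoments (taskLaw a b p σ ν w₀) :=
  HasMoments.prod _ _

end

section

/-! ### Moments of Gaussian measures -/

/-- By evenness the integral is a Gamma integral, evaluated at the half-integer `k + 1/2`. For `k =
0` the truncated subtraction gives `0‼ = 1`, as it should. -/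
theorem integral_even_pow_gaussianReal (k : ℕ) :
    ∫ x, x ^ (2 * k) ∂gaussianReal 0 1 = (2 * k - 1).doubleFactorial := by
  have h0 : (√(2 * Real.pi) : ℝ) ≠ 0 := by positivity
  have h1 : ∀ x : ℝ, gaussianPDFReal 0 1 x • x ^ (2 * k) =
      (√(2 * Real.pi))⁻¹ *
        ((fun y : ℝ ↦ y ^ ((2 * k : ℕ) : ℝ) * Real.exp (-(1 / 2) * y ^ (2 : ℝ))) |x|) := by
    intro x
    simp only [gaussianPDFReal_def, smul_eq_mul, NNReal.coe_one, mul_one, sub_zero,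
      Real.rpow_natCast, pow_mul, sq_abs, Real.rpow_two]
    rw [mul_assoc, mul_comm (Real.exp _)]
    congr 3
    ring
  rw [integral_gaussianReal_eq_integral_smul one_ne_zero]
  simp_rw [h1]
  rw [integral_const_mul, integral_comp_abs
      (f := fun y : ℝ ↦ y ^ ((2 * k : ℕ) : ℝ) * Real.exp (-(1 / 2) * y ^ (2 : ℝ))),
    integral_rpow_mul_exp_neg_mul_rpow (by norm_num)
    (lt_of_lt_of_le neg_one_lt_zero (Nat.cast_nonneg _)) (by norm_num)]
  have h2 : (((2 * k : ℕ) : ℝ) + 1) / 2 = k + 1 / 2 := by push_cast; ring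
  have h3 : -(((2 * k : ℕ) : ℝ) + 1) / 2 = -(k + 1 / 2) := by push_cast; ring
  rw [h2, h3, Real.Gamma_nat_add_half, one_div, Real.inv_rpow zero_le_two,
    ← Real.rpow_neg zero_le_two, neg_neg, Real.rpow_add zero_lt_two, Real.rpow_natCast,
    show (2 : ℝ) ^ (2⁻¹ : ℝ) = √2 by rw [Real.sqrt_eq_rpow, one_div],
    Real.sqrt_mul zero_le_two]
  have h4 : √Real.pi ≠ 0 := by positivity
  have h5 : √(2 : ℝ) ≠ 0 := by positivity
  field_simp

theorem integral_sq_gaussianReal : ∫ x, x ^ 2 ∂gaussianReal 0 1 = 1 := by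
  simpa using integral_even_pow_gaussianReal 1

theorem integral_pow_four_gaussianReal : ∫ x, x ^ 4 ∂gaussianReal 0 1 = 3 := by
  simpa [Nat.doubleFactorial] using integral_even_pow_gaussianReal 2

theorem integral_pow_six_gaussianReal : ∫ x, x ^ 6 ∂gaussianReal 0 1 = 15 := by
  simpa [Nat.doubleFactorial] using integral_even_pow_gaussianReal 3

theorem integral_pow_eight_gaussianReal : ∫ x, x ^ 8 ∂gaussianReal 0 1 = 105 := by
  simpa [Nat.doubleFactorial] using integral_even_pow_gaussianReal 4

/-- Moments of the chi-square distribution. -/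
theorem chiSquare_moments (n : ℕ) :
    (∫ g : Fin n → ℝ, (∑ i, g i ^ 2) ∂(Measure.pi fun _ ↦ gaussianReal 0 1) = n) ∧
    (∫ g : Fin n → ℝ, (∑ i, g i ^ 2) ^ 2 ∂(Measure.pi fun _ ↦ gaussianReal 0 1) =
      n * (n + 2)) ∧
    (∫ g : Fin n → ℝ, (∑ i, g i ^ 2) ^ 3 ∂(Measure.pi fun _ ↦ gaussianReal 0 1) =
      n * (n + 2) * (n + 4)) ∧
    (∫ g : Fin n → ℝ, (∑ i, g i ^ 2) ^ 4 ∂(Measure.pi fun _ ↦ gaussianReal 0 1) =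
      n * (n + 2) * (n + 4) * (n + 6)) := by
  induction n with
  | zero => simp
  | succ n ih =>
    obtain ⟨h1, h2, h3, h4⟩ := ih
    have hmp := (measurePreserving_piFinSuccAbove
      (fun _ : Fin (n + 1) ↦ gaussianReal 0 1) 0).symm
    -- Split off one coordinate, expand binomially and factor by independence. The moments up to `k
    -- = 4` are needed because `(1 - (α / n) s) ^ 4`, with `s` chi-square, occurs in the fourth
    -- moment of `adaptOp`.
    have key (k : ℕ) : ∫ g : Fin (n + 1) → ℝ, (∑ i, g i ^ 2) ^ k
        ∂(Measure.pi fun _ ↦ gaussianReal 0 1) =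
        ∑ j ∈ Finset.range (k + 1), (∫ x, x ^ (2 * j) ∂gaussianReal 0 1) *
          (∫ g : Fin n → ℝ, (∑ i, g i ^ 2) ^ (k - j) ∂(Measure.pi fun _ ↦ gaussianReal 0 1)) *
          (k.choose j) := by
      rw [← hmp.integral_comp']
      have : ∀ x : ℝ × (Fin n → ℝ), (∑ i, ((MeasurableEquiv.piFinSuccAbove
          (fun _ : Fin (n + 1) ↦ ℝ) 0).symm x) i ^ 2) ^ k =
          ∑ j ∈ Finset.range (k + 1), x.1 ^ (2 * j) * (∑ i, x.2 i ^ 2) ^ (k - j) *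
            (k.choose j) := by
        intro x
        rw [Fin.sum_univ_succ, add_pow]
        simp [MeasurableEquiv.piFinSuccAbove, pow_mul]
      simp_rw [this]
      rw [integral_finsetSum]
      · refine Finset.sum_congr rfl fun j _ ↦ ?_
        rw [integral_mul_const, integral_prod_mul (fun y : ℝ ↦ y ^ (2 * j))
          (fun g : Fin n → ℝ ↦ (∑ i, g i ^ 2) ^ (k - j))]
      · intro j _
        exact PolyGrowth.integrable (by fun_prop)
    have k1 := key 1
    have k2 := key 2
    have k3 := key 3
    have k4 := key 4
    simp [Finset.sum_range_succ, Nat.choose, h1, h2, h3, h4, integral_sq_gaussianReal,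
      integral_pow_four_gaussianReal, integral_pow_six_gaussianReal,
      integral_pow_eight_gaussianReal] at k1 k2 k3 k4
    refine ⟨?_, ?_, ?_, ?_⟩
    · rw [k1]; push_cast; ring
    · rw [k2]; push_cast; ring
    · rw [k3]; push_cast; ring
    · rw [k4]; push_cast; ring

section StdGaussian

variable {E F : Type*} [NormedAddCommGroup E] [InnerProductSpace ℝ E] [FiniteDimensional ℝ E]
  [MeasurableSpace E] [BorelSpace E] [NormedAddCommGroup F] [InnerProductSpace ℝ F]
  [FiniteDimensional ℝ F] [MeasurableSpace F] [BorelSpace F]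

/-- A linear image of independent standard Gaussian vectors is standard Gaussian as soon as
the transpose of the linear map is isometric. -/
theorem measurePreserving_sum_stdGaussian {τ : Type*} [Fintype τ] (T : τ → E → F) (S : τ → F → E)
    (hT : ∀ r, Continuous (T r)) (hTS : ∀ r x t, inner ℝ (T r x) t = inner ℝ x (S r t))
    (hS : ∀ t, ∑ r, ‖S r t‖ ^ 2 = ‖t‖ ^ 2) :
    MeasurePreserving (fun x : τ → E ↦ ∑ r, T r (x r)) (Measure.pi fun _ ↦ stdGaussian E)
      (stdGaussian F) := by
  have hm : Measurable (fun x : τ → E ↦ ∑ r, T r (x r)) := by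
    have := fun r ↦ (hT r).measurable
    fun_prop
  refine ⟨hm, ?_⟩
  have := Measure.isProbabilityMeasure_map (μ := Measure.pi fun _ : τ ↦ stdGaussian E)
    hm.aemeasurable
  refine Measure.ext_of_charFun ?_
  ext t
  rw [charFun_apply, integral_map hm.aemeasurable
    (Continuous.aestronglyMeasurable (by fun_prop)), charFun_stdGaussian]
  simp_rw [sum_inner, hTS, Complex.ofReal_sum, Finset.sum_mul, Complex.exp_sum]
  rw [integral_fintype_prod_eq_prod
    (f := fun r x ↦ Complex.exp (((inner ℝ x (S r t) : ℝ) : ℂ) * Complex.I))]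
  simp_rw [← charFun_apply, charFun_stdGaussian, ← Complex.exp_sum]
  congr 1
  rw [← Finset.sum_div, Finset.sum_neg_distrib]
  congr 2
  rw [← Complex.ofReal_pow, ← hS t]
  push_cast
  rfl

/-- Version of `measurePreserving_sum_stdGaussian` for two vectors. -/
theorem measurePreserving_add_stdGaussian (a b : E → E)
    (ha : Continuous a) (hb : Continuous b) (ha' : ∀ x t, inner ℝ (a x) t = inner ℝ x (a t))
    (hb' : ∀ x t, inner ℝ (b x) t = inner ℝ x (b t))
    (hab : ∀ t, ‖a t‖ ^ 2 + ‖b t‖ ^ 2 = ‖t‖ ^ 2) :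
    MeasurePreserving (fun x : E × E ↦ a x.1 + b x.2) ((stdGaussian E).prod (stdGaussian E))
      (stdGaussian E) := by
  have hm : Measurable (fun x : E × E ↦ a x.1 + b x.2) := by fun_prop
  refine ⟨hm, ?_⟩
  have := Measure.isProbabilityMeasure_map (μ := (stdGaussian E).prod (stdGaussian E))
    hm.aemeasurable
  refine Measure.ext_of_charFun ?_
  ext t
  rw [charFun_apply, integral_map hm.aemeasurable
    (Continuous.aestronglyMeasurable (by fun_prop)), charFun_stdGaussian]
  simp_rw [inner_add_left, ha', hb', Complex.ofReal_add, add_mul, Complex.exp_add]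
  rw [integral_prod_mul (f := fun x ↦ Complex.exp (((inner ℝ x (a t) : ℝ) : ℂ) * Complex.I))
    (g := fun x ↦ Complex.exp (((inner ℝ x (b t) : ℝ) : ℂ) * Complex.I))]
  simp_rw [← charFun_apply, charFun_stdGaussian, ← Complex.exp_add]
  congr 1
  rw [← add_div, ← neg_add]
  congr 2
  rw [← Complex.ofReal_pow, ← Complex.ofReal_pow, ← Complex.ofReal_pow, ← hab t]
  push_cast
  rfl

theorem measurePreserving_inner_stdGaussian (u : E) (hu : ‖u‖ = 1) :
    MeasurePreserving (fun x ↦ inner ℝ x u) (stdGaussian E) (gaussianReal 0 1) := by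
  have hm : Measurable (fun x : E ↦ (inner ℝ x u : ℝ)) := by fun_prop
  refine ⟨hm, ?_⟩
  have := Measure.isProbabilityMeasure_map (μ := stdGaussian E) hm.aemeasurable
  refine Measure.ext_of_charFun ?_
  ext t
  rw [charFun_apply_real, integral_map hm.aemeasurable
    (Continuous.aestronglyMeasurable (by fun_prop)), charFun_gaussianReal]
  have : ∀ x : E, Complex.exp (t * ((inner ℝ x u : ℝ) : ℂ) * Complex.I) =
      Complex.exp (((inner ℝ x (t • u) : ℝ) : ℂ) * Complex.I) := by
    intro x
    rw [inner_smul_right]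
    push_cast
    rfl
  simp_rw [this]
  rw [← charFun_apply, charFun_stdGaussian, norm_smul, hu]
  congr 1
  simp only [mul_one, Complex.ofReal_zero, mul_zero, zero_mul, NNReal.coe_one, Complex.ofReal_one,
    one_mul, zero_sub, Real.norm_eq_abs, neg_div]
  rw [← Complex.ofReal_pow, sq_abs, Complex.ofReal_pow]

theorem integral_inner_pow_stdGaussian (u : E) (k : ℕ) :
    ∫ x, inner ℝ x u ^ k ∂stdGaussian E = ‖u‖ ^ k * ∫ y, y ^ k ∂gaussianReal 0 1 := by
  rcases eq_or_ne u 0 with rfl | hu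
  · rcases Nat.eq_zero_or_pos k with rfl | hk
    · simp
    · simp [hk.ne']
  · have hu' : ‖u‖ ≠ 0 := norm_ne_zero_iff.2 hu
    have h1 : ‖‖u‖⁻¹ • u‖ = 1 := by rw [norm_smul, norm_inv, norm_norm, inv_mul_cancel₀ hu']
    rw [← (measurePreserving_inner_stdGaussian _ h1).map_eq, integral_map (by fun_prop)
      (by fun_prop), ← integral_const_mul]
    refine integral_congr_ae (ae_of_all _ fun x ↦ ?_)
    simp only
    rw [← mul_pow, inner_smul_right, mul_inv_cancel_left₀ hu']

theorem integral_inner_stdGaussian (u : E) : ∫ x, inner ℝ x u ∂stdGaussian E = 0 := by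
  simpa using integral_inner_pow_stdGaussian u 1

theorem integral_inner_sq_stdGaussian (u : E) :
    ∫ x, inner ℝ x u ^ 2 ∂stdGaussian E = ‖u‖ ^ 2 := by
  rw [integral_inner_pow_stdGaussian, integral_sq_gaussianReal, mul_one]

theorem integral_inner_pow_four_stdGaussian (u : E) :
    ∫ x, inner ℝ x u ^ 4 ∂stdGaussian E = 3 * ‖u‖ ^ 4 := by
  rw [integral_inner_pow_stdGaussian, integral_pow_four_gaussianReal, mul_comm]

theorem integral_inner_mul_inner_stdGaussian (u v : E) :
    ∫ x, inner ℝ x u * inner ℝ x v ∂stdGaussian E = inner ℝ u v := by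
  have h : ∀ x : E, (inner ℝ x u * inner ℝ x v : ℝ) =
      4⁻¹ * (inner ℝ x (u + v) ^ 2 - inner ℝ x (u - v) ^ 2) := by
    intro x
    rw [inner_add_right, inner_sub_right]
    ring
  simp_rw [h]
  rw [integral_const_mul, integral_sub (PolyGrowth.integrable (by fun_prop))
    (PolyGrowth.integrable (by fun_prop)), integral_inner_sq_stdGaussian,
    integral_inner_sq_stdGaussian, norm_add_sq_real, norm_sub_sq_real]
  ring

end StdGaussian

theorem integral_norm_pow_stdGaussian (p k : ℕ) :
    ∫ x, (‖x‖ ^ 2) ^ k ∂stdGaussian (Vec p) =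
      ∫ g : Fin p → ℝ, (∑ i, g i ^ 2) ^ k ∂(Measure.pi fun _ ↦ gaussianReal 0 1) := by
  rw [← map_pi_eq_stdGaussian, integral_map (by fun_prop) (by fun_prop)]
  simp [EuclideanSpace.real_norm_sq_eq]

theorem integral_norm_sq_stdGaussian (p : ℕ) :
    ∫ x, ‖x‖ ^ 2 ∂stdGaussian (Vec p) = p := by
  simpa [(chiSquare_moments p).1] using integral_norm_pow_stdGaussian p 1

theorem integral_norm_pow_four_stdGaussian (p : ℕ) :
    ∫ x, ‖x‖ ^ 4 ∂stdGaussian (Vec p) = p * (p + 2) := by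
  have := integral_norm_pow_stdGaussian p 2
  simp_rw [← pow_mul] at this
  rw [this]
  simpa using (chiSquare_moments p).2.1

end

section

/-! ### The adaptation operator -/

/-- `n` independent standard Gaussian vectors of `ℝ^p`. -/
abbrev inputLaw (n p : ℕ) : Measure (Fin n → Vec p) := Measure.pi fun _ ↦ stdGaussian (Vec p)

/-- The operator `I - (α / n) Xᵀ X`, where the rows of `X` are the inputs. -/
def adaptOp {n p : ℕ} (α : ℝ) (X : Fin n → Vec p) (v : Vec p) : Vec p :=
  v - (α / n) • ∑ r, (inner ℝ (X r) v : ℝ) • X r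

variable {n p : ℕ}

@[fun_prop]
theorem PolyGrowth.adaptOp {E : Type*} [NormedAddCommGroup E] (α : ℝ) {X : E → Fin n → Vec p}
    {v : E → Vec p} (hX : ∀ r, PolyGrowth (fun x ↦ X x r)) (hv : PolyGrowth v) :
    PolyGrowth (fun x ↦ adaptOp α (X x) (v x)) := by
  unfold MAML.adaptOp
  fun_prop

theorem adaptOp_smul (α c : ℝ) (X : Fin n → Vec p) (v : Vec p) :
    adaptOp α X (c • v) = c • adaptOp α X v := by
  simp only [adaptOp, inner_smul_right, mul_smul, ← Finset.smul_sum, smul_sub]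
  rw [smul_comm]

theorem adaptOp_add (α : ℝ) (X : Fin n → Vec p) (v w : Vec p) :
    adaptOp α X (v + w) = adaptOp α X v + adaptOp α X w := by
  simp only [adaptOp, inner_add_right, add_smul, Finset.sum_add_distrib, smul_add]
  abel

theorem inner_adaptOp_left (α : ℝ) (X : Fin n → Vec p) (v w : Vec p) :
    inner ℝ (adaptOp α X v) w = inner ℝ v (adaptOp α X w) := by
  simp only [adaptOp, inner_sub_left, inner_sub_right, inner_smul_left, inner_smul_right, sum_inner,
    inner_sum, RCLike.conj_to_real]
  congr 2
  refine Finset.sum_congr rfl fun r _ ↦ ?_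
  rw [real_inner_comm v (X r)]
  ring

/-- A combination of independent standard Gaussian vectors is a standard one scaled by the length of
`g`. The case `g = 0` is separate because the weights are normalized by that length. -/
theorem integral_linearCombination (g : Fin n → ℝ) (f : Vec p → ℝ) (hf : Continuous f) :
    ∫ X : Fin n → Vec p, f (∑ r, g r • X r) ∂inputLaw n p =
      ∫ x, f (√(∑ r, g r ^ 2) • x) ∂stdGaussian (Vec p) := by
  set s := ∑ r, g r ^ 2 with hs
  have hs0 : 0 ≤ s := Finset.sum_nonneg fun r _ ↦ sq_nonneg _
  rcases hs0.eq_or_lt with h0 | h0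
  · have : ∀ r, g r = 0 := by
      intro r
      have := (Finset.sum_eq_zero_iff_of_nonneg (fun r _ ↦ sq_nonneg (g r))).1 (hs ▸ h0.symm) r
        (Finset.mem_univ r)
      exact pow_eq_zero_iff two_ne_zero |>.1 this
    simp [this, ← h0]
  · have hsq : √s ≠ 0 := (Real.sqrt_pos.2 h0).ne'
    have := measurePreserving_sum_stdGaussian (E := Vec p) (F := Vec p) (τ := Fin n)
      (fun r x ↦ (g r / √s) • x) (fun r x ↦ (g r / √s) • x) (fun r ↦ by fun_prop)
      (fun r x t ↦ by rw [inner_smul_left, inner_smul_right]; rfl) (fun t ↦ by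
        simp_rw [norm_smul, mul_pow, ← Finset.sum_mul, Real.norm_eq_abs, sq_abs, div_pow,
          ← Finset.sum_div, Real.sq_sqrt hs0, ← hs]
        rw [div_self h0.ne', one_mul])
    rw [← this.map_eq, integral_map this.measurable.aemeasurable (by fun_prop)]
    congr 1
    ext X
    rw [Finset.smul_sum]
    congr 1
    refine Finset.sum_congr rfl fun r _ ↦ ?_
    rw [smul_smul, mul_div_cancel₀ _ hsq]

/-- The rows may be resampled on the orthogonal complement of any subspace. -/
theorem measurePreserving_split {τ : Type*} [Fintype τ] (V : Submodule ℝ (Vec p)) :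
    MeasurePreserving
      (fun x : (τ → Vec p) × (τ → Vec p) ↦
        fun r ↦ V.starProjection (x.1 r) + Vᗮ.starProjection (x.2 r))
      ((Measure.pi fun _ : τ ↦ stdGaussian (Vec p)).prod
        (Measure.pi fun _ : τ ↦ stdGaussian (Vec p)))
      (Measure.pi fun _ : τ ↦ stdGaussian (Vec p)) := by
  have h1 := measurePreserving_add_stdGaussian (E := Vec p) V.starProjection Vᗮ.starProjection
    (by fun_prop) (by fun_prop) (fun x t ↦ V.inner_starProjection_left_eq_right x t)
    (fun x t ↦ Vᗮ.inner_starProjection_left_eq_right x t)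
    (fun t ↦ (Submodule.norm_sq_eq_add_norm_sq_starProjection t V).symm)
  have h2 := measurePreserving_pi (fun _ : τ ↦ (stdGaussian (Vec p)).prod (stdGaussian (Vec p)))
    (fun _ : τ ↦ stdGaussian (Vec p)) (fun _ ↦ h1)
  exact h2.comp (measurePreserving_arrowProdEquivProdArrow (Vec p) (Vec p) τ
    (fun _ ↦ stdGaussian (Vec p)) (fun _ ↦ stdGaussian (Vec p))).symm

theorem norm_sq_orthogonalPart {e : Vec p} (he : ‖e‖ = 1) (z : Vec p) :
    ‖z - (inner ℝ z e : ℝ) • e‖ ^ 2 = ‖z‖ ^ 2 - inner ℝ z e ^ 2 := by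
  rw [norm_sub_sq_real, inner_smul_right, norm_smul, he, Real.norm_eq_abs, mul_one, sq_abs]
  ring

theorem integral_norm_sq_orthogonalPart {e : Vec p} (he : ‖e‖ = 1) :
    ∫ x, ‖x - (inner ℝ x e : ℝ) • e‖ ^ 2 ∂stdGaussian (Vec p) = p - 1 := by
  simp_rw [norm_sq_orthogonalPart he]
  rw [integral_sub (PolyGrowth.integrable (by fun_prop)) (PolyGrowth.integrable (by fun_prop)),
    integral_norm_sq_stdGaussian, integral_inner_sq_stdGaussian, he, one_pow]

theorem integral_norm_pow_four_orthogonalPart_le {e : Vec p} (he : ‖e‖ = 1) :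
    ∫ x, (‖x - (inner ℝ x e : ℝ) • e‖ ^ 2) ^ 2 ∂stdGaussian (Vec p) ≤ p * (p + 2) := by
  rw [← integral_norm_pow_four_stdGaussian]
  refine integral_mono (PolyGrowth.integrable (by fun_prop)) (PolyGrowth.integrable (by fun_prop))
    fun x ↦ ?_
  have h := norm_sq_orthogonalPart he x
  have h1 : ‖x - (inner ℝ x e : ℝ) • e‖ ^ 2 ≤ ‖x‖ ^ 2 := by
    rw [h]; linarith [sq_nonneg (inner ℝ x e : ℝ)]
  calc (‖x - (inner ℝ x e : ℝ) • e‖ ^ 2) ^ 2 ≤ (‖x‖ ^ 2) ^ 2 := by gcongr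
    _ = ‖x‖ ^ 4 := by ring

/-- The law of `‖(I - (α / n) Xᵀ X) e‖²` for a unit vector `e`, in terms of a Gaussian vector of
`ℝ^n` and an independent one of `ℝ^p`. -/
theorem integral_comp_norm_sq_adaptOp (α : ℝ) {e : Vec p} (he : ‖e‖ = 1) (f : ℝ → ℝ)
    (hf : PolyGrowth f) :
    ∫ X, f (‖adaptOp α X e‖ ^ 2) ∂inputLaw n p =
      ∫ g : Fin n → ℝ, ∫ x, f ((1 - α / n * ∑ r, g r ^ 2) ^ 2 +
        (α / n) ^ 2 * (∑ r, g r ^ 2) * ‖x - (inner ℝ x e : ℝ) • e‖ ^ 2)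
        ∂stdGaussian (Vec p) ∂(Measure.pi fun _ ↦ gaussianReal 0 1) := by
  set V : Submodule ℝ (Vec p) := ℝ ∙ e
  have hVp : ∀ x, V.starProjection x = (inner ℝ x e : ℝ) • e := fun x ↦ by
    rw [real_inner_comm]
    exact Submodule.starProjection_unit_singleton ℝ he x
  have hVp' : ∀ x, Vᗮ.starProjection x = x - (inner ℝ x e : ℝ) • e := fun x ↦ by
    rw [Submodule.starProjection_orthogonal_val, hVp]
  -- The coordinates along `e` come from `X` and the orthogonal parts from the independent copy
  -- `X'`. The image of `e` then splits into a multiple of `e` and a vector orthogonal to `e`, and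
  -- the squared norms add.
  have hpt : ∀ X X' : Fin n → Vec p,
      ‖adaptOp α (fun r ↦ V.starProjection (X r) + Vᗮ.starProjection (X' r)) e‖ ^ 2 =
      (1 - α / n * ∑ r, (inner ℝ (X r) e : ℝ) ^ 2) ^ 2 +
        (α / n) ^ 2 * ‖(∑ r, (inner ℝ (X r) e : ℝ) • X' r) -
          (inner ℝ (∑ r, (inner ℝ (X r) e : ℝ) • X' r) e : ℝ) • e‖ ^ 2 := by
    intro X X'
    set z := ∑ r, (inner ℝ (X r) e : ℝ) • X' r with hz
    have hee : (inner ℝ e e : ℝ) = 1 := by rw [real_inner_self_eq_norm_sq, he, one_pow]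
    have h1 : adaptOp α (fun r ↦ V.starProjection (X r) + Vᗮ.starProjection (X' r)) e =
        (1 - α / n * ∑ r, (inner ℝ (X r) e : ℝ) ^ 2) • e -
          (α / n) • (z - (inner ℝ z e : ℝ) • e) := by
      have h2 : ∀ r, (inner ℝ (V.starProjection (X r) + Vᗮ.starProjection (X' r)) e : ℝ) =
          inner ℝ (X r) e := by
        intro r
        rw [hVp, hVp', inner_add_left, inner_sub_left, inner_smul_left, inner_smul_left, hee]
        simp
      simp only [adaptOp, h2]
      simp only [hVp, hVp', smul_add, smul_sub, Finset.sum_add_distrib, Finset.sum_sub_distrib,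
        hz, sum_inner, inner_smul_left, Finset.sum_smul, smul_smul, sub_smul, one_smul,
        Finset.smul_sum, Finset.mul_sum, RCLike.conj_to_real, pow_two]
      abel
    rw [h1, norm_sub_sq_real, norm_smul, norm_smul, he, mul_one, inner_smul_left, inner_smul_right,
      inner_sub_right, inner_smul_right, hee, real_inner_comm z e]
    simp only [mul_pow, Real.norm_eq_abs, sq_abs, mul_one, sub_self, mul_zero, sub_zero]
  have hmp := measurePreserving_split (τ := Fin n) V
  rw [show inputLaw n p = _ from hmp.map_eq.symm, integral_map hmp.measurable.aemeasurable
    (PolyGrowth.continuous (by fun_prop)).aestronglyMeasurable]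
  simp_rw [hpt]
  rw [integral_prod _ (PolyGrowth.integrable (by fun_prop))]
  -- With the weights `⟪X r, e⟫` frozen, the combination of the `X' r` is one Gaussian vector, and
  -- the integral depends on `X` only through these weights.
  have hstep : ∀ X : Fin n → Vec p, ∫ X' : Fin n → Vec p,
      f ((1 - α / n * ∑ r, (inner ℝ (X r) e : ℝ) ^ 2) ^ 2 +
        (α / n) ^ 2 * ‖(∑ r, (inner ℝ (X r) e : ℝ) • X' r) -
          (inner ℝ (∑ r, (inner ℝ (X r) e : ℝ) • X' r) e : ℝ) • e‖ ^ 2) ∂inputLaw n p =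
      (fun g : Fin n → ℝ ↦ ∫ x, f ((1 - α / n * ∑ r, g r ^ 2) ^ 2 +
        (α / n) ^ 2 * (∑ r, g r ^ 2) * ‖x - (inner ℝ x e : ℝ) • e‖ ^ 2)
        ∂stdGaussian (Vec p)) (fun r ↦ inner ℝ (X r) e) := by
    intro X
    rw [integral_linearCombination (fun r ↦ (inner ℝ (X r) e : ℝ)) (fun z ↦
      f ((1 - α / n * ∑ r, (inner ℝ (X r) e : ℝ) ^ 2) ^ 2 +
        (α / n) ^ 2 * ‖z - (inner ℝ z e : ℝ) • e‖ ^ 2)) (PolyGrowth.continuous (by fun_prop))]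
    simp only
    congr 1
    ext x
    rw [inner_smul_left, RCLike.conj_to_real, mul_smul, ← smul_sub, norm_smul, mul_pow,
      Real.norm_eq_abs, sq_abs, Real.sq_sqrt (Finset.sum_nonneg fun r _ ↦ sq_nonneg _), mul_assoc]
  simp_rw [hstep]
  have hmp2 : MeasurePreserving (fun (X : Fin n → Vec p) r ↦ (inner ℝ (X r) e : ℝ))
      (inputLaw n p) (Measure.pi fun _ ↦ gaussianReal 0 1) :=
    measurePreserving_pi (fun _ : Fin n ↦ stdGaussian (Vec p)) (fun _ ↦ gaussianReal 0 1)
      (fun _ ↦ measurePreserving_inner_stdGaussian e he)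
  rw [← hmp2.map_eq, integral_map hmp2.measurable.aemeasurable]
  refine AEStronglyMeasurable.integral_prod_right' (μ := Measure.map _ _)
    (f := fun z : (Fin n → ℝ) × Vec p ↦ f ((1 - α / n * ∑ r, z.1 r ^ 2) ^ 2 +
        (α / n) ^ 2 * (∑ r, z.1 r ^ 2) * ‖z.2 - (inner ℝ z.2 e : ℝ) • e‖ ^ 2)) ?_
  exact (PolyGrowth.continuous (by fun_prop)).aestronglyMeasurable

/-- `E ‖(I - (α / n) Xᵀ X) v‖² = h ‖v‖²`. -/
theorem integral_norm_sq_adaptOp (α : ℝ) (hn : 0 < n) (v : Vec p) :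
    ∫ X, ‖adaptOp α X v‖ ^ 2 ∂inputLaw n p = hCoef α p n * ‖v‖ ^ 2 := by
  rcases eq_or_ne v 0 with rfl | hv
  · simp [adaptOp]
  have hv' : ‖v‖ ≠ 0 := norm_ne_zero_iff.2 hv
  set e := ‖v‖⁻¹ • v with he_def
  have he : ‖e‖ = 1 := by rw [he_def, norm_smul, norm_inv, norm_norm, inv_mul_cancel₀ hv']
  have hve : v = ‖v‖ • e := by rw [he_def, smul_inv_smul₀ hv']
  have h1 : ∀ X : Fin n → Vec p, ‖adaptOp α X v‖ ^ 2 = ‖v‖ ^ 2 * ‖adaptOp α X e‖ ^ 2 := by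
    intro X
    conv_lhs => rw [hve, adaptOp_smul, norm_smul, norm_norm, mul_pow]
  simp_rw [h1]
  rw [integral_const_mul, integral_comp_norm_sq_adaptOp α he (fun t ↦ t) (by fun_prop), mul_comm]
  congr 1
  have hin : ∀ g : Fin n → ℝ, ∫ x, ((1 - α / n * ∑ r, g r ^ 2) ^ 2 +
        (α / n) ^ 2 * (∑ r, g r ^ 2) * ‖x - (inner ℝ x e : ℝ) • e‖ ^ 2) ∂stdGaussian (Vec p) =
      1 + ((α / n) ^ 2 * (p - 1) - 2 * (α / n)) * (∑ r, g r ^ 2) +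
        (α / n) ^ 2 * (∑ r, g r ^ 2) ^ 2 := by
    intro g
    rw [integral_add (integrable_const _) (PolyGrowth.integrable (by fun_prop)),
      integral_const_mul, integral_norm_sq_orthogonalPart he]
    simp
    ring
  simp_rw [hin]
  rw [integral_add (PolyGrowth.integrable (by fun_prop)) (PolyGrowth.integrable (by fun_prop)),
    integral_add (integrable_const _) (PolyGrowth.integrable (by fun_prop)),
    integral_const_mul, integral_const_mul, (chiSquare_moments n).1, (chiSquare_moments n).2.1,
    hCoef]
  have : (n : ℝ) ≠ 0 := by positivity
  simp
  field_simp
  ring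

/-- `E ‖(I - (α / n) Xᵀ X) v‖⁴ ≤ (h² + O(1 / n)) ‖v‖⁴`. -/
theorem integral_norm_pow_four_adaptOp_le (α K : ℝ) : ∃ C : ℝ, 0 ≤ C ∧ ∀ n p : ℕ, 0 < n →
    (p : ℝ) ≤ K * n → ∀ v : Vec p,
    ∫ X, (‖adaptOp α X v‖ ^ 2) ^ 2 ∂inputLaw n p ≤ (hCoef α p n ^ 2 + C / n) * ‖v‖ ^ 4 := by
  -- `R (1/n, p/n) / n` is exactly the difference between the upper bound for the fourth moment,
  -- computed from chi-square moments, and `hCoef ^ 2`. Compactness of `[0, 1] × [0, K]` then gives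
  -- a constant independent of `n` and `p`.
  let R : ℝ × ℝ → ℝ := fun z ↦ 12 * α ^ 2 - 24 * α ^ 3 - 32 * α ^ 3 * z.1 + 12 * α ^ 4 +
    44 * α ^ 4 * z.1 + 48 * α ^ 4 * z.1 ^ 2 - 4 * α ^ 2 * (1 - α) ^ 2 +
    2 * α ^ 2 * (z.2 - z.1) * (-4 * α + 6 * α ^ 2 + 8 * α ^ 2 * z.1) +
    α ^ 4 * (2 * z.2 ^ 2 + 4 * z.1 * z.2 - z.1)
  have hR : Continuous R := by fun_prop
  obtain ⟨C, hC⟩ := (isCompact_Icc (a := (0 : ℝ)) (b := 1)).prod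
    (isCompact_Icc (a := (0 : ℝ)) (b := K)) |>.exists_bound_of_continuousOn hR.continuousOn
  refine ⟨|C|, abs_nonneg C, fun n p hn hp v ↦ ?_⟩
  have hn0 : (0 : ℝ) < n := by exact_mod_cast hn
  have hn1 : (1 : ℝ) ≤ n := by exact_mod_cast hn
  rcases eq_or_ne v 0 with rfl | hv
  · simp [adaptOp]
  have hv' : ‖v‖ ≠ 0 := norm_ne_zero_iff.2 hv
  set e := ‖v‖⁻¹ • v with he_def
  have he : ‖e‖ = 1 := by rw [he_def, norm_smul, norm_inv, norm_norm, inv_mul_cancel₀ hv']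
  have hve : v = ‖v‖ • e := by rw [he_def, smul_inv_smul₀ hv']
  have h1 : ∀ X : Fin n → Vec p,
      (‖adaptOp α X v‖ ^ 2) ^ 2 = ‖v‖ ^ 4 * (‖adaptOp α X e‖ ^ 2) ^ 2 := by
    intro X
    conv_lhs => rw [hve, adaptOp_smul, norm_smul, norm_norm, mul_pow, mul_pow, ← pow_mul]
  simp_rw [h1]
  rw [integral_const_mul, integral_comp_norm_sq_adaptOp α he (fun t ↦ t ^ 2) (by fun_prop),
    mul_comm]
  gcongr
  -- Expand the square and average over `x`; only the fourth moment of the orthogonal part is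
  -- estimated, by that of the whole vector, everything else being exact.
  have hin : ∀ g : Fin n → ℝ, ∫ x, ((1 - α / n * ∑ r, g r ^ 2) ^ 2 +
        (α / n) ^ 2 * (∑ r, g r ^ 2) * ‖x - (inner ℝ x e : ℝ) • e‖ ^ 2) ^ 2
          ∂stdGaussian (Vec p) ≤
      (1 - α / n * ∑ r, g r ^ 2) ^ 4 +
      2 * (1 - α / n * ∑ r, g r ^ 2) ^ 2 * ((α / n) ^ 2 * (∑ r, g r ^ 2)) * (p - 1) +
      ((α / n) ^ 2 * (∑ r, g r ^ 2)) ^ 2 * (p * (p + 2)) := by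
    intro g
    have h2 : ∀ x : Vec p, ((1 - α / n * ∑ r, g r ^ 2) ^ 2 +
        (α / n) ^ 2 * (∑ r, g r ^ 2) * ‖x - (inner ℝ x e : ℝ) • e‖ ^ 2) ^ 2 =
        (1 - α / n * ∑ r, g r ^ 2) ^ 4 +
        2 * (1 - α / n * ∑ r, g r ^ 2) ^ 2 * ((α / n) ^ 2 * (∑ r, g r ^ 2)) *
          ‖x - (inner ℝ x e : ℝ) • e‖ ^ 2 +
        ((α / n) ^ 2 * (∑ r, g r ^ 2)) ^ 2 * (‖x - (inner ℝ x e : ℝ) • e‖ ^ 2) ^ 2 := by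
      intro x
      ring
    simp_rw [h2]
    rw [integral_add (PolyGrowth.integrable (by fun_prop)) (PolyGrowth.integrable (by fun_prop)),
      integral_add (integrable_const _) (PolyGrowth.integrable (by fun_prop)),
      integral_const_mul, integral_const_mul, integral_norm_sq_orthogonalPart he]
    simp only [integral_const, probReal_univ, smul_eq_mul, one_mul]
    gcongr
    exact integral_norm_pow_four_orthogonalPart_le he
  have hin2 : ∀ g : Fin n → ℝ, (1 - α / n * ∑ r, g r ^ 2) ^ 4 +
      2 * (1 - α / n * ∑ r, g r ^ 2) ^ 2 * ((α / n) ^ 2 * (∑ r, g r ^ 2)) * (p - 1) +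
      ((α / n) ^ 2 * (∑ r, g r ^ 2)) ^ 2 * (p * (p + 2)) =
      1 + (-4 * (α / n) + 2 * (α / n) ^ 2 * (p - 1)) * (∑ r, g r ^ 2) +
      (6 * (α / n) ^ 2 - 4 * (α / n) ^ 3 * (p - 1) + (α / n) ^ 4 * (p * (p + 2))) *
        (∑ r, g r ^ 2) ^ 2 +
      (-4 * (α / n) ^ 3 + 2 * (α / n) ^ 4 * (p - 1)) * (∑ r, g r ^ 2) ^ 3 +
      (α / n) ^ 4 * (∑ r, g r ^ 2) ^ 4 := by
    intro g
    ring
  simp_rw [hin2] at hin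
  refine (integral_mono_of_nonneg (ae_of_all _ fun g ↦ integral_nonneg fun x ↦ sq_nonneg _)
    (PolyGrowth.integrable (by fun_prop)) (ae_of_all _ hin)).trans ?_
  rw [integral_add (PolyGrowth.integrable (by fun_prop)) (PolyGrowth.integrable (by fun_prop)),
    integral_add (PolyGrowth.integrable (by fun_prop)) (PolyGrowth.integrable (by fun_prop)),
    integral_add (PolyGrowth.integrable (by fun_prop)) (PolyGrowth.integrable (by fun_prop)),
    integral_add (integrable_const _) (PolyGrowth.integrable (by fun_prop)),
    integral_const_mul, integral_const_mul, integral_const_mul, integral_const_mul,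
    (chiSquare_moments n).1, (chiSquare_moments n).2.1,
    (chiSquare_moments n).2.2.1, (chiSquare_moments n).2.2.2, hCoef]
  have hRle : R (1 / n, p / n) ≤ |C| := by
    refine (le_abs_self _).trans ((hC (1 / n, p / n) ⟨⟨by positivity, ?_⟩, by positivity, ?_⟩).trans
      (le_abs_self C))
    · rw [div_le_one hn0]; exact hn1
    · rw [div_le_iff₀ hn0]; exact hp
  have hfin : R (1 / n, p / n) / n ≤ |C| / n := by gcongr
  refine le_trans (le_of_eq ?_) (add_le_add le_rfl hfin)
  simp only [integral_const, probReal_univ, smul_eq_mul, one_mul, R]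
  field_simp
  ring

/-- For a unit vector the coordinates `⟪X r, v⟫` are independent standard Gaussian variables, and
the general case follows by scaling. -/
theorem integral_sum_inner_sq_pow (v : Vec p) (k : ℕ) :
    ∫ X, (∑ r, (inner ℝ (X r) v : ℝ) ^ 2) ^ k ∂inputLaw n p =
      (‖v‖ ^ 2) ^ k * ∫ g : Fin n → ℝ, (∑ r, g r ^ 2) ^ k
        ∂(Measure.pi fun _ ↦ gaussianReal 0 1) := by
  rcases eq_or_ne v 0 with rfl | hv
  · rcases Nat.eq_zero_or_pos k with rfl | hk
    · simp
    · simp [hk.ne']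
  have hv' : ‖v‖ ≠ 0 := norm_ne_zero_iff.2 hv
  set e := ‖v‖⁻¹ • v with he_def
  have he : ‖e‖ = 1 := by rw [he_def, norm_smul, norm_inv, norm_norm, inv_mul_cancel₀ hv']
  have hve : v = ‖v‖ • e := by rw [he_def, smul_inv_smul₀ hv']
  have hmp : MeasurePreserving (fun (X : Fin n → Vec p) r ↦ (inner ℝ (X r) e : ℝ))
      (inputLaw n p) (Measure.pi fun _ ↦ gaussianReal 0 1) :=
    measurePreserving_pi (fun _ : Fin n ↦ stdGaussian (Vec p)) (fun _ ↦ gaussianReal 0 1)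
      (fun _ ↦ measurePreserving_inner_stdGaussian e he)
  rw [← hmp.map_eq, integral_map hmp.measurable.aemeasurable
    (PolyGrowth.continuous (by fun_prop)).aestronglyMeasurable, ← integral_const_mul]
  congr 1
  ext X
  conv_lhs => rw [hve]
  simp_rw [inner_smul_right, mul_pow, ← Finset.mul_sum, mul_pow]

end

section

/-! ### Fluctuations of the Gram matrix of the meta-training problem -/

theorem hCoef_nonneg (α : ℝ) (p n : ℕ) : 0 ≤ hCoef α p n := by
  unfold hCoef
  positivity

theorem hCoef_le {α K : ℝ} {p n : ℕ} (hn : 0 < n) (hp : (p : ℝ) ≤ K * n) :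
    hCoef α p n ≤ (1 - α) ^ 2 + α ^ 2 * (K + 1) := by
  have hn0 : (0 : ℝ) < n := by exact_mod_cast hn
  have hn1 : (1 : ℝ) ≤ n := by exact_mod_cast hn
  unfold hCoef
  gcongr
  rw [div_le_iff₀ hn0]
  linarith

/-- Inputs of the training and validation sets of the `m` tasks. -/
abbrev Inputs (m nt nv p : ℕ) : Type := Fin m → (Fin nt → Vec p) × (Fin nv → Vec p)

/-- Law of the inputs of one task. -/
abbrev taskInputLaw (nt nv p : ℕ) : Measure ((Fin nt → Vec p) × (Fin nv → Vec p)) :=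
  (inputLaw nt p).prod (inputLaw nv p)

/-- Law of the inputs of all tasks. -/
abbrev inputsLaw (m nt nv p : ℕ) : Measure (Inputs m nt nv p) :=
  Measure.pi fun _ ↦ taskInputLaw nt nv p

instance (m nt nv p : ℕ) : HasMoments (inputsLaw m nt nv p) := HasMoments.pi _

/-- The rows of the linear system solved by the outer loop. -/
def row {m nt nv p : ℕ} (α : ℝ) (I : Inputs m nt nv p) (j : Fin m × Fin nv) : Vec p :=
  adaptOp α (I j.1).1 ((I j.1).2 j.2)

@[fun_prop]
theorem PolyGrowth.row {m nt nv p : ℕ} {E : Type*} [NormedAddCommGroup E] (α : ℝ)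
    {I : E → Inputs m nt nv p} (hI : PolyGrowth I) (j : Fin m × Fin nv) :
    PolyGrowth (fun x ↦ row α (I x) j) := by
  unfold MAML.row
  fun_prop

variable {m n nv p : ℕ}

theorem measurePreserving_unitCombination (g : Fin n → ℝ) (hg : ∑ r, g r ^ 2 = 1) :
    MeasurePreserving (fun x : Fin n → Vec p ↦ ∑ r, g r • x r) (inputLaw n p)
      (stdGaussian (Vec p)) :=
  measurePreserving_sum_stdGaussian (fun r x ↦ g r • x) (fun r x ↦ g r • x)
    (fun r ↦ by fun_prop) (fun r x t ↦ by rw [inner_smul_left, inner_smul_right]; rfl) (fun t ↦ by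
      simp_rw [norm_smul, mul_pow, ← Finset.sum_mul, Real.norm_eq_abs, sq_abs, hg, one_mul])

/-- A combination of the validation inputs with unit weight vector is again one standard Gaussian
vector independent of the training inputs. This serves both single inputs and the vectors `(x_a ±
x_b) / √2` used in polarization. -/
theorem integral_comp_unitCombination (g : Fin nv → ℝ) (hg : ∑ r, g r ^ 2 = 1)
    (f : (Fin n → Vec p) × Vec p → ℝ) (hf : PolyGrowth f) :
    ∫ T : (Fin n → Vec p) × (Fin nv → Vec p), f (T.1, ∑ r, g r • T.2 r) ∂taskInputLaw n nv p =
      ∫ T, f T ∂(inputLaw n p).prod (stdGaussian (Vec p)) := by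
  have hmp := (MeasurePreserving.id (inputLaw n p)).prod
    (measurePreserving_unitCombination (p := p) g hg)
  rw [← hmp.map_eq, integral_map hmp.measurable.aemeasurable
    hf.continuous.aestronglyMeasurable]
  rfl

theorem sum_single_sq (a : Fin nv) :
    ∑ r, (Pi.single a (1 : ℝ) : Fin nv → ℝ) r ^ 2 = 1 := by
  simp [Pi.single_apply, ite_pow]

theorem integral_comp_eval_input (a : Fin nv)
    (f : (Fin n → Vec p) × Vec p → ℝ) (hf : PolyGrowth f) :
    ∫ T : (Fin n → Vec p) × (Fin nv → Vec p), f (T.1, T.2 a) ∂taskInputLaw n nv p =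
      ∫ T, f T ∂(inputLaw n p).prod (stdGaussian (Vec p)) := by
  rw [← integral_comp_unitCombination (Pi.single a 1) (sum_single_sq a) f hf]
  simp [Pi.single_apply]

/-- For a random symmetric bilinear form `q`, the fluctuations of all the entries `q (x_a, x_b)`
are controlled by those of `q (x, x)`. -/
theorem integral_entry_sq_le (q : (Fin n → Vec p) → Vec p → Vec p → ℝ)
    (hq : PolyGrowth (fun z : (Fin n → Vec p) × Vec p × Vec p ↦ q z.1 z.2.1 z.2.2))
    (hpol : ∀ X x y, q X x y = 2⁻¹ * (q X ((√2)⁻¹ • x + (√2)⁻¹ • y) ((√2)⁻¹ • x + (√2)⁻¹ • y) -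
      q X ((√2)⁻¹ • x + (-(√2)⁻¹) • y) ((√2)⁻¹ • x + (-(√2)⁻¹) • y)))
    (c D : ℝ) (hD : ∫ T : (Fin n → Vec p) × Vec p, (q T.1 T.2 T.2 - c) ^ 2
      ∂(inputLaw n p).prod (stdGaussian (Vec p)) ≤ D) (a b : Fin nv) :
    ∫ T : (Fin n → Vec p) × (Fin nv → Vec p), (q T.1 (T.2 a) (T.2 b) - if a = b then c else 0) ^ 2
      ∂taskInputLaw n nv p ≤ D := by
  have hq' : PolyGrowth (fun T : (Fin n → Vec p) × Vec p ↦ (q T.1 T.2 T.2 - c) ^ 2) := by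
    have : PolyGrowth (fun T : (Fin n → Vec p) × Vec p ↦ q T.1 T.2 T.2) :=
      hq.comp _ (fun T : (Fin n → Vec p) × Vec p ↦ (T.1, T.2, T.2)) (by fun_prop)
    fun_prop
  rcases eq_or_ne a b with rfl | hab
  · simp only [if_true]
    rw [integral_comp_eval_input a (fun T ↦ (q T.1 T.2 T.2 - c) ^ 2) hq']
    exact hD
  · simp only [hab, if_false, sub_zero]
    -- For `s = ±1`, the two vectors `(x_a ± x_b) / √2` that occur in the polarization identity are
    -- unit combinations.
    have hcomb : ∀ s : ℝ, s ^ 2 = 1 → ∃ g : Fin nv → ℝ, ∑ r, g r ^ 2 = 1 ∧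
        ∀ x : Fin nv → Vec p, ∑ r, g r • x r = (√2)⁻¹ • x a + (s * (√2)⁻¹) • x b := by
      intro s hs
      refine ⟨fun r ↦ if r = a then (√2)⁻¹ else if r = b then s * (√2)⁻¹ else 0, ?_, fun x ↦ ?_⟩
      · have : ∀ r : Fin nv, (if r = a then (√2)⁻¹ else if r = b then s * (√2)⁻¹ else 0) ^ 2 =
            (if r = a then (2 : ℝ)⁻¹ else 0) + if r = b then (2 : ℝ)⁻¹ else 0 := by
          intro r
          by_cases h1 : r = a
          · subst h1; simp [hab]
          · by_cases h2 : r = b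
            · subst h2; simp [h1, mul_pow, hs]
            · simp [h1, h2]
        simp_rw [this, Finset.sum_add_distrib]
        simp
        norm_num
      · have : ∀ r : Fin nv, (if r = a then (√2)⁻¹ else if r = b then s * (√2)⁻¹ else 0) • x r =
            (if r = a then (√2)⁻¹ • x r else 0) + if r = b then (s * (√2)⁻¹) • x r else 0 := by
          intro r
          by_cases h1 : r = a
          · subst h1; simp [hab]
          · by_cases h2 : r = b
            · subst h2; simp [h1]
            · simp [h1, h2]
        simp_rw [this, Finset.sum_add_distrib]
        simp
    obtain ⟨g, hg, hgx⟩ := hcomb 1 (by norm_num)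
    obtain ⟨g', hg', hgx'⟩ := hcomb (-1) (by norm_num)
    simp only [one_mul, neg_mul] at hgx hgx'
    have h1 := integral_comp_unitCombination g hg (fun T ↦ (q T.1 T.2 T.2 - c) ^ 2) hq'
    have h2 := integral_comp_unitCombination g' hg' (fun T ↦ (q T.1 T.2 T.2 - c) ^ 2) hq'
    have hi : ∀ g : Fin nv → ℝ, Integrable (fun T : (Fin n → Vec p) × (Fin nv → Vec p) ↦
        (q T.1 (∑ r, g r • T.2 r) (∑ r, g r • T.2 r) - c) ^ 2) (taskInputLaw n nv p) := by
      intro g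
      refine PolyGrowth.integrable ?_
      exact hq'.comp _ (fun T : (Fin n → Vec p) × (Fin nv → Vec p) ↦
        (T.1, ∑ r, g r • T.2 r)) (by fun_prop)
    calc ∫ T : (Fin n → Vec p) × (Fin nv → Vec p), q T.1 (T.2 a) (T.2 b) ^ 2
          ∂taskInputLaw n nv p
        ≤ ∫ T : (Fin n → Vec p) × (Fin nv → Vec p),
          2⁻¹ * ((q T.1 (∑ r, g r • T.2 r) (∑ r, g r • T.2 r) - c) ^ 2 +
            (q T.1 (∑ r, g' r • T.2 r) (∑ r, g' r • T.2 r) - c) ^ 2) ∂taskInputLaw n nv p := by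
          refine integral_mono ?_ (((hi g).add (hi g')).const_mul _) fun T ↦ ?_
          · refine PolyGrowth.integrable ?_
            have : PolyGrowth (fun T : (Fin n → Vec p) × (Fin nv → Vec p) ↦
                q T.1 (T.2 a) (T.2 b)) := hq.comp _
              (fun T : (Fin n → Vec p) × (Fin nv → Vec p) ↦ (T.1, T.2 a, T.2 b)) (by fun_prop)
            fun_prop
          · simp only
            rw [hpol, hgx, hgx']
            -- Polarization is a difference of two diagonal values, so subtracting `c` from both
            -- changes nothing; it remains to use `(x - y)² ≤ 2 (x² + y²)`.
            nlinarith [sq_nonneg (q T.1 ((√2)⁻¹ • T.2 a + (√2)⁻¹ • T.2 b)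
              ((√2)⁻¹ • T.2 a + (√2)⁻¹ • T.2 b) - c + (q T.1 ((√2)⁻¹ • T.2 a + -(√2)⁻¹ • T.2 b)
              ((√2)⁻¹ • T.2 a + -(√2)⁻¹ • T.2 b) - c))]
      _ ≤ D := by
          rw [integral_const_mul, integral_add (hi g) (hi g'), h1, h2]
          linarith

/-- Fluctuations of `‖(I - (α / n) Xᵀ X) x‖²`. -/
theorem integral_norm_sq_adaptOp_sub_sq_le (α K : ℝ) : ∃ C : ℝ, 0 ≤ C ∧ ∀ n p : ℕ, 0 < n → 0 < p →
    (p : ℝ) ≤ K * n →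
    ∫ T : (Fin n → Vec p) × Vec p, (‖adaptOp α T.1 T.2‖ ^ 2 - p * hCoef α p n) ^ 2
      ∂(inputLaw n p).prod (stdGaussian (Vec p)) ≤ C * p := by
  obtain ⟨C, hC0, hC⟩ := integral_norm_pow_four_adaptOp_le α K
  refine ⟨2 * ((1 - α) ^ 2 + α ^ 2 * (K + 1)) ^ 2 + 3 * C * |K|, by positivity,
    fun n p hn hp0 hp ↦ ?_⟩
  set h := hCoef α p n with hh
  have hn0 : (0 : ℝ) < n := by exact_mod_cast hn
  have hp1 : (1 : ℝ) ≤ p := by exact_mod_cast hp0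
  have e1 : ∫ T : (Fin n → Vec p) × Vec p, (‖adaptOp α T.1 T.2‖ ^ 2) ^ 2
      ∂(inputLaw n p).prod (stdGaussian (Vec p)) ≤ (h ^ 2 + C / n) * (p * (p + 2)) := by
    rw [integral_prod_symm _ (PolyGrowth.integrable (by fun_prop)),
      ← integral_norm_pow_four_stdGaussian, ← integral_const_mul]
    refine integral_mono_of_nonneg (ae_of_all _ fun x ↦ integral_nonneg fun X ↦ by positivity)
      (PolyGrowth.integrable (by fun_prop)) (ae_of_all _ fun x ↦ hC n p hn hp x)
  have e2 : ∫ T : (Fin n → Vec p) × Vec p, ‖adaptOp α T.1 T.2‖ ^ 2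
      ∂(inputLaw n p).prod (stdGaussian (Vec p)) = h * p := by
    rw [integral_prod_symm _ (PolyGrowth.integrable (by fun_prop))]
    simp_rw [integral_norm_sq_adaptOp α hn]
    rw [integral_const_mul, integral_norm_sq_stdGaussian]
  have e3 : ∀ T : (Fin n → Vec p) × Vec p, (‖adaptOp α T.1 T.2‖ ^ 2 - p * h) ^ 2 =
      (‖adaptOp α T.1 T.2‖ ^ 2) ^ 2 - 2 * (p * h) * ‖adaptOp α T.1 T.2‖ ^ 2 + (p * h) ^ 2 := by
    intro T; ring
  simp_rw [e3]
  rw [integral_add (PolyGrowth.integrable (by fun_prop)) (integrable_const _),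
    integral_sub (PolyGrowth.integrable (by fun_prop)) (PolyGrowth.integrable (by fun_prop)),
    integral_const_mul, e2]
  simp only [integral_const, probReal_univ, smul_eq_mul, one_mul]
  have h1 : h ^ 2 ≤ ((1 - α) ^ 2 + α ^ 2 * (K + 1)) ^ 2 :=
    pow_le_pow_left₀ (hCoef_nonneg _ _ _) (hCoef_le hn hp) 2
  -- In `(h² + C / n) p (p + 2) - p² h²` the terms of order `p²` without the factor `1 / n` cancel,
  -- leaving `2 p h²` and this one.
  have h2 : C / n * (p * (p + 2)) ≤ 3 * C * |K| * p := by
    rw [div_mul_eq_mul_div, div_le_iff₀ hn0]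
    have h3 : (p : ℝ) ≤ |K| * n := hp.trans (by gcongr; exact le_abs_self K)
    calc C * ((p : ℝ) * (p + 2)) ≤ C * (p * (3 * p)) := by gcongr; linarith
      _ ≤ C * (p * (3 * (|K| * n))) := by gcongr
      _ = 3 * C * |K| * p * n := by ring
  nlinarith

/-- Fluctuations of `‖X x‖²`. -/
theorem integral_sum_inner_sq_sub_sq_le (K : ℝ) : ∃ C : ℝ, 0 ≤ C ∧ ∀ n p : ℕ, 0 < n → 0 < p →
    (p : ℝ) ≤ K * n →
    ∫ T : (Fin n → Vec p) × Vec p, (∑ r, (inner ℝ (T.1 r) T.2 : ℝ) ^ 2 - n * p) ^ 2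
      ∂(inputLaw n p).prod (stdGaussian (Vec p)) ≤ C * n ^ 3 := by
  refine ⟨2 * |K| ^ 2 + 6 * |K|, by positivity, fun n p hn hp0 hp ↦ ?_⟩
  have hn1 : (1 : ℝ) ≤ n := by exact_mod_cast hn
  have hp1 : (1 : ℝ) ≤ p := by exact_mod_cast hp0
  have e1 : ∫ T : (Fin n → Vec p) × Vec p, (∑ r, (inner ℝ (T.1 r) T.2 : ℝ) ^ 2) ^ 2
      ∂(inputLaw n p).prod (stdGaussian (Vec p)) = (n * (n + 2)) * (p * (p + 2)) := by
    rw [integral_prod_symm _ (PolyGrowth.integrable (by fun_prop))]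
    simp_rw [integral_sum_inner_sq_pow, (chiSquare_moments n).2.1, ← pow_mul]
    rw [integral_mul_const, integral_norm_pow_four_stdGaussian]
    ring
  have e2 : ∫ T : (Fin n → Vec p) × Vec p, ∑ r, (inner ℝ (T.1 r) T.2 : ℝ) ^ 2
      ∂(inputLaw n p).prod (stdGaussian (Vec p)) = n * p := by
    rw [integral_prod_symm _ (PolyGrowth.integrable (by fun_prop))]
    have := fun v : Vec p ↦ integral_sum_inner_sq_pow (n := n) v 1
    simp only [pow_one, (chiSquare_moments n).1] at this
    simp_rw [this]
    rw [integral_mul_const, integral_norm_sq_stdGaussian, mul_comm]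
  have e3 : ∀ T : (Fin n → Vec p) × Vec p, (∑ r, (inner ℝ (T.1 r) T.2 : ℝ) ^ 2 - n * p) ^ 2 =
      (∑ r, (inner ℝ (T.1 r) T.2 : ℝ) ^ 2) ^ 2 -
        2 * (n * p) * ∑ r, (inner ℝ (T.1 r) T.2 : ℝ) ^ 2 + (n * p : ℝ) ^ 2 := by
    intro T; ring
  simp_rw [e3]
  rw [integral_add (PolyGrowth.integrable (by fun_prop)) (integrable_const _),
    integral_sub (PolyGrowth.integrable (by fun_prop)) (PolyGrowth.integrable (by fun_prop)),
    integral_const_mul, e1, e2]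
  simp only [integral_const, probReal_univ, smul_eq_mul, one_mul]
  have h3 : (p : ℝ) ≤ |K| * n := hp.trans (by gcongr; exact le_abs_self K)
  have h4 : (p : ℝ) ^ 2 ≤ |K| ^ 2 * n ^ 2 := by rw [← mul_pow]; gcongr
  calc (n : ℝ) * (n + 2) * (p * (p + 2)) - 2 * (n * p) * (n * p) + (n * p) ^ 2
      = 2 * n * p ^ 2 + (2 * n ^ 2 + 4 * n) * p := by ring
    _ ≤ 2 * n * (|K| ^ 2 * n ^ 2) + (2 * n ^ 2 + 4 * n * n) * (|K| * n) := by
        gcongr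
        nlinarith
    _ = (2 * |K| ^ 2 + 6 * |K|) * n ^ 3 := by ring

/-- Fluctuations of the entries of the Gram matrix. -/
theorem integral_gram_sub_sq_le (α K : ℝ) : ∃ C : ℝ, 0 ≤ C ∧ ∀ m n nv p : ℕ, 0 < n → 0 < p →
    (p : ℝ) ≤ K * n → ∀ j k : Fin m × Fin nv,
    ∫ I, (inner ℝ (row α I j) (row α I k) - if j = k then p * hCoef α p n else 0) ^ 2
      ∂inputsLaw m n nv p ≤ C * p := by
  obtain ⟨C, hC0, hC⟩ := integral_norm_sq_adaptOp_sub_sq_le α K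
  -- The summand `C` covers rows of one task. The other covers rows of different tasks, where the
  -- second moment of the inner product is exactly `hCoef ^ 2 * p`.
  refine ⟨C + ((1 - α) ^ 2 + α ^ 2 * (K + 1)) ^ 2, by positivity, fun m n nv p hn hp0 hp j k ↦ ?_⟩
  obtain ⟨i, a⟩ := j
  obtain ⟨i', b⟩ := k
  rcases eq_or_ne i i' with rfl | hi
  · have h1 := integral_entry_sq_le (n := n) (p := p) (nv := nv)
      (fun X x y ↦ inner ℝ (adaptOp α X x) (adaptOp α X y)) (by fun_prop) ?_
      (p * hCoef α p n) (C * p) ?_ a b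
    · have hmp := measurePreserving_eval (fun _ : Fin m ↦ taskInputLaw n nv p) i
      rw [← hmp.map_eq, integral_map hmp.measurable.aemeasurable
        (PolyGrowth.continuous (by fun_prop)).aestronglyMeasurable] at h1
      have h0 : 0 ≤ ((1 - α) ^ 2 + α ^ 2 * (K + 1)) ^ 2 * (p : ℝ) := by positivity
      simp only [Function.eval] at h1
      simp only [row, Prod.mk.injEq, true_and]
      linarith
    · intro X x y
      have h2 : (√2 : ℝ)⁻¹ * (√2)⁻¹ = 2⁻¹ := by
        rw [← mul_inv, Real.mul_self_sqrt zero_le_two]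
      simp only [adaptOp_add, adaptOp_smul, inner_add_left, inner_add_right, inner_smul_left,
        inner_smul_right, RCLike.conj_to_real]
      rw [real_inner_comm (adaptOp α X x) (adaptOp α X y)]
      linear_combination (-2 * inner ℝ (adaptOp α X x) (adaptOp α X y) : ℝ) * h2
    · simpa only [real_inner_self_eq_norm_sq] using hC n p hn hp0 hp
  · have hne : ((i, a) : Fin m × Fin nv) ≠ (i', b) := fun h ↦ hi (Prod.mk.inj h).1
    simp only [hne, if_false, sub_zero, row]
    have hind : IndepFun (fun I : Inputs m n nv p ↦ I i) (fun I ↦ I i') (inputsLaw m n nv p) :=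
      (iIndepFun_pi (μ := fun _ : Fin m ↦ taskInputLaw n nv p) (X := fun _ ↦ id)
        (fun _ ↦ aemeasurable_id)).indepFun hi
    have hmap := (indepFun_iff_map_prod_eq_prod_map_map (measurable_pi_apply i).aemeasurable
      (measurable_pi_apply i').aemeasurable).1 hind
    have hm1 := (measurePreserving_eval (fun _ : Fin m ↦ taskInputLaw n nv p) i).map_eq
    have hm2 := (measurePreserving_eval (fun _ : Fin m ↦ taskInputLaw n nv p) i').map_eq
    have e0 : ∫ I : Inputs m n nv p, (inner ℝ (adaptOp α (I i).1 ((I i).2 a))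
        (adaptOp α (I i').1 ((I i').2 b)) : ℝ) ^ 2 ∂inputsLaw m n nv p =
        ∫ z, (fun z : ((Fin n → Vec p) × (Fin nv → Vec p)) × ((Fin n → Vec p) × (Fin nv → Vec p)) ↦
        (inner ℝ (adaptOp α z.1.1 (z.1.2 a)) (adaptOp α z.2.1 (z.2.2 b)) : ℝ) ^ 2) z
          ∂(taskInputLaw n nv p).prod (taskInputLaw n nv p) := by
      have hmap' : Measure.map (fun I : Inputs m n nv p ↦ (I i, I i')) (inputsLaw m n nv p) =
          (taskInputLaw n nv p).prod (taskInputLaw n nv p) := by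
        rw [hmap]
        exact congrArg₂ _ hm1 hm2
      rw [← hmap', integral_map (by fun_prop)
        (PolyGrowth.continuous (by fun_prop)).aestronglyMeasurable]
    rw [e0, integral_prod _ (PolyGrowth.integrable (by fun_prop))]
    -- Condition on the row `v` of the other task. Since `adaptOp` is symmetric it can be moved onto
    -- `v`, after which the Gaussian input integrates to a squared norm.
    have e1 : ∀ v : Vec p, ∫ T : (Fin n → Vec p) × (Fin nv → Vec p),
        (inner ℝ v (adaptOp α T.1 (T.2 b)) : ℝ) ^ 2 ∂taskInputLaw n nv p =
        hCoef α p n * ‖v‖ ^ 2 := by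
      intro v
      rw [integral_comp_eval_input b (fun T ↦ (inner ℝ v (adaptOp α T.1 T.2) : ℝ) ^ 2)
        (by fun_prop), integral_prod _ (PolyGrowth.integrable (by fun_prop))]
      have : ∀ X : Fin n → Vec p, ∫ x, (inner ℝ v (adaptOp α X x) : ℝ) ^ 2 ∂stdGaussian (Vec p) =
          ‖adaptOp α X v‖ ^ 2 := by
        intro X
        simp_rw [← inner_adaptOp_left, real_inner_comm _ (adaptOp α X v)]
        exact integral_inner_sq_stdGaussian _
      simp_rw [this]
      exact integral_norm_sq_adaptOp α hn v
    simp_rw [e1]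
    rw [integral_const_mul, integral_comp_eval_input a (fun T ↦ ‖adaptOp α T.1 T.2‖ ^ 2)
        (by fun_prop), integral_prod_symm _ (PolyGrowth.integrable (by fun_prop))]
    simp_rw [integral_norm_sq_adaptOp α hn]
    rw [integral_const_mul, integral_norm_sq_stdGaussian, ← mul_assoc, ← pow_two]
    gcongr
    have h1 : hCoef α p n ^ 2 ≤ ((1 - α) ^ 2 + α ^ 2 * (K + 1)) ^ 2 :=
      pow_le_pow_left₀ (hCoef_nonneg _ _ _) (hCoef_le hn hp) 2
    linarith

/-- Fluctuations of the entries of `Xᵛ Xᵗᵀ Xᵗ Xᵛᵀ`. -/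
theorem integral_trainGram_sub_sq_le (K : ℝ) : ∃ C : ℝ, 0 ≤ C ∧ ∀ m n nv p : ℕ, 0 < n → 0 < p →
    (p : ℝ) ≤ K * n → ∀ (i : Fin m) (a b : Fin nv),
    ∫ I : Inputs m n nv p, (∑ r, (inner ℝ ((I i).1 r) ((I i).2 a) : ℝ) *
      inner ℝ ((I i).1 r) ((I i).2 b) - if a = b then (n * p : ℝ) else 0) ^ 2
      ∂inputsLaw m n nv p ≤ C * n ^ 3 := by
  obtain ⟨C, hC0, hC⟩ := integral_sum_inner_sq_sub_sq_le K
  refine ⟨C, hC0, fun m n nv p hn hp0 hp i a b ↦ ?_⟩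
  have h1 := integral_entry_sq_le (n := n) (p := p) (nv := nv)
    (fun X x y ↦ ∑ r, (inner ℝ (X r) x : ℝ) * inner ℝ (X r) y) (by fun_prop) ?_
    (n * p : ℝ) (C * n ^ 3) ?_ a b
  · have hmp := measurePreserving_eval (fun _ : Fin m ↦ taskInputLaw n nv p) i
    rw [← hmp.map_eq, integral_map hmp.measurable.aemeasurable
      (PolyGrowth.continuous (by fun_prop)).aestronglyMeasurable] at h1
    exact h1
  · intro X x y
    rw [← Finset.sum_sub_distrib, Finset.mul_sum]
    refine Finset.sum_congr rfl fun r _ ↦ ?_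
    have h2 : (√2 : ℝ)⁻¹ * (√2)⁻¹ = 2⁻¹ := by
      rw [← mul_inv, Real.mul_self_sqrt zero_le_two]
    simp only [inner_add_right, inner_smul_right]
    linear_combination (-2 * inner ℝ (X r) x * inner ℝ (X r) y : ℝ) * h2
  · simpa only [pow_two] using hC n p hn hp0 hp

/-- Fourth moments of the rows. -/
theorem integral_inner_row_pow_four_le (α K : ℝ) : ∃ C : ℝ, 0 ≤ C ∧ ∀ m n nv p : ℕ, 0 < n →
    (p : ℝ) ≤ K * n → ∀ (j : Fin m × Fin nv) (u : Vec p),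
    ∫ I, (inner ℝ (row α I j) u : ℝ) ^ 4 ∂inputsLaw m n nv p ≤ C * ‖u‖ ^ 4 := by
  obtain ⟨C, hC0, hC⟩ := integral_norm_pow_four_adaptOp_le α K
  refine ⟨3 * (((1 - α) ^ 2 + α ^ 2 * (K + 1)) ^ 2 + C), by positivity,
    fun m n nv p hn hp j u ↦ ?_⟩
  have hn1 : (1 : ℝ) ≤ n := by exact_mod_cast hn
  have hmp := measurePreserving_eval (fun _ : Fin m ↦ taskInputLaw n nv p) j.1
  have e0 : ∫ I, (inner ℝ (row α I j) u : ℝ) ^ 4 ∂inputsLaw m n nv p =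
      ∫ T : (Fin n → Vec p) × (Fin nv → Vec p), (inner ℝ (adaptOp α T.1 (T.2 j.2)) u : ℝ) ^ 4
        ∂taskInputLaw n nv p := by
    rw [← hmp.map_eq, integral_map hmp.measurable.aemeasurable
      (PolyGrowth.continuous (by fun_prop)).aestronglyMeasurable]
    rfl
  rw [e0, integral_comp_eval_input j.2 (fun T ↦ (inner ℝ (adaptOp α T.1 T.2) u : ℝ) ^ 4)
    (by fun_prop), integral_prod _ (PolyGrowth.integrable (by fun_prop))]
  have : ∀ X : Fin n → Vec p, ∫ x, (inner ℝ (adaptOp α X x) u : ℝ) ^ 4 ∂stdGaussian (Vec p) =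
      3 * (‖adaptOp α X u‖ ^ 2) ^ 2 := by
    intro X
    simp_rw [inner_adaptOp_left]
    rw [integral_inner_pow_four_stdGaussian, ← pow_mul]
  simp_rw [this]
  rw [integral_const_mul, mul_assoc]
  gcongr
  refine (hC n p hn hp u).trans ?_
  gcongr
  · exact hCoef_nonneg _ _ _
  · exact hCoef_le hn hp
  · exact div_le_self hC0 hn1

end

section

/-! ### Inverse moments of Gaussian matrices -/

section SquareMatrix

/-- Tonelli in a single coordinate: a bound on the one-dimensional integral that is uniform in the
other coordinates survives averaging over them. -/
theorem lintegral_pi_le_of_update {δ : Type*} [Fintype δ] [DecidableEq δ] (μ : δ → Measure ℝ)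
    [∀ i, IsProbabilityMeasure (μ i)] {f : (δ → ℝ) → ENNReal} (hf : Measurable f) (i : δ)
    {C : ENNReal} (h : ∀ x, ∫⁻ y, f (Function.update x i y) ∂μ i ≤ C) :
    ∫⁻ x, f x ∂Measure.pi μ ≤ C := by
  rw [lintegral_eq_lmarginal_univ 0, lmarginal_erase' f hf (Finset.mem_univ i)]
  refine (lmarginal_mono (g := fun _ ↦ C) (fun x ↦ h x) 0).trans ?_
  simp [lmarginal]

/-- The density is at most `1 / √(2π) ≤ 1`. Passing to Lebesgue measure gains translation
invariance, hence bounds uniform in the mean. -/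
theorem gaussianReal_le_volume : gaussianReal 0 1 ≤ volume := by
  rw [gaussianReal_of_var_ne_zero _ one_ne_zero]
  calc volume.withDensity (gaussianPDF 0 1) ≤ volume.withDensity 1 := by
        refine withDensity_mono (ae_of_all _ fun x ↦ ?_)
        rw [gaussianPDF_def, Pi.one_apply, ENNReal.ofReal_le_one, gaussianPDFReal_def]
        refine mul_le_one₀ ?_ (Real.exp_nonneg _) ?_
        · refine inv_le_one_of_one_le₀ (Real.one_le_sqrt.2 ?_)
          have := Real.pi_gt_three
          simp only [NNReal.coe_one, mul_one]
          linarith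
        · rw [Real.exp_le_one_iff]
          refine div_nonpos_of_nonpos_of_nonneg ?_ (by simp)
          linarith [sq_nonneg (x - 0)]
    _ = volume := withDensity_one

/-- A Gaussian variable has inverse moments of order `1 / 2`, uniformly in its mean. -/
theorem exists_lintegral_sqrt_inv_le : ∃ C : ENNReal, C ≠ ⊤ ∧ ∀ a b : ℝ,
    ∫⁻ y, ENNReal.ofReal √(|a| / |y * a + b|) ∂gaussianReal 0 1 ≤ C := by
  -- Integrable majorant of the singularity; away from it `√(1 / |t|) ≤ 1`. After division by `a`,
  -- the variable `t` below is `y + b / a`, a translate of the Gaussian variable.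
  let F : ℝ → ℝ := (Set.Ioc (0 : ℝ) 1).indicator fun y ↦ y ^ (-(1 / 2) : ℝ)
  have hF : Integrable F := by
    rw [integrable_indicator_iff measurableSet_Ioc,
      ← intervalIntegrable_iff_integrableOn_Ioc_of_le zero_le_one]
    exact intervalIntegral.intervalIntegrable_rpow' (by norm_num)
  have hF0 : ∀ y, 0 ≤ F y := fun y ↦ Set.indicator_nonneg (fun y hy ↦ Real.rpow_nonneg hy.1.le _) y
  have hF2 : Integrable (fun y ↦ F y + F (-y)) := hF.add hF.comp_neg
  have hFm : Measurable F := by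
    refine Measurable.indicator ?_ measurableSet_Ioc
    fun_prop
  have hbound : ∀ t : ℝ, √(1 / |t|) ≤ 1 + (F t + F (-t)) := by
    intro t
    have h1 := hF0 t
    have h2 := hF0 (-t)
    have hpos : ∀ s : ℝ, 0 < s → s ≤ 1 → √(1 / s) = F s := by
      intro s hs hs1
      simp only [F, Set.indicator_of_mem (show s ∈ Set.Ioc (0 : ℝ) 1 from ⟨hs, hs1⟩)]
      rw [Real.rpow_neg hs.le, ← Real.sqrt_eq_rpow, one_div, Real.sqrt_inv]
    rcases le_or_gt |t| 1 with h | h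
    · rcases lt_trichotomy t 0 with ht | rfl | ht
      · rw [abs_of_neg ht] at h ⊢
        rw [hpos (-t) (by linarith) h]
        linarith
      · simp only [abs_zero, div_zero, Real.sqrt_zero]
        linarith
      · rw [abs_of_pos ht] at h ⊢
        rw [hpos t ht h]
        linarith
    · have : √(1 / |t|) ≤ 1 := by
        rw [Real.sqrt_le_one, div_le_one (by linarith)]
        exact h.le
      linarith
  refine ⟨1 + ∫⁻ y, ENNReal.ofReal (F y + F (-y)), ?_, fun a b ↦ ?_⟩
  · exact ENNReal.add_ne_top.2 ⟨ENNReal.one_ne_top, hF2.lintegral_lt_top.ne⟩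
  · rcases eq_or_ne a 0 with rfl | ha
    · simp
    · calc ∫⁻ y, ENNReal.ofReal √(|a| / |y * a + b|) ∂gaussianReal 0 1
          ≤ ∫⁻ y, (1 + ENNReal.ofReal (F (y + b / a) + F (-(y + b / a)))) ∂gaussianReal 0 1 := by
            refine lintegral_mono fun y ↦ ?_
            rw [← ENNReal.ofReal_one, ← ENNReal.ofReal_add zero_le_one (add_nonneg (hF0 _) (hF0 _))]
            refine ENNReal.ofReal_le_ofReal (le_trans (le_of_eq ?_) (hbound (y + b / a)))
            congr 1
            have : y * a + b = a * (y + b / a) := by field_simp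
            rw [this, abs_mul, ← div_div, div_self (abs_ne_zero.2 ha)]
        _ = 1 + ∫⁻ y, ENNReal.ofReal (F (y + b / a) + F (-(y + b / a))) ∂gaussianReal 0 1 := by
            rw [lintegral_add_left measurable_const]
            simp
        _ ≤ 1 + ∫⁻ y, ENNReal.ofReal (F (y + b / a) + F (-(y + b / a))) := by
            gcongr
            exact gaussianReal_le_volume
        _ = 1 + ∫⁻ y, ENNReal.ofReal (F y + F (-y)) := by
            rw [lintegral_add_right_eq_self (fun y ↦ ENNReal.ofReal (F y + F (-y)))]

/-- The law of the entries of a Gaussian matrix. -/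
abbrev matrixLaw (ι : Type*) [Fintype ι] : Measure (ι × ι → ℝ) :=
  Measure.pi fun _ ↦ gaussianReal 0 1

/-- The matrix with given entries. -/
def toMatrix {ι : Type*} (h : ι × ι → ℝ) : Matrix ι ι ℝ := Matrix.of fun i j ↦ h (i, j)

@[fun_prop]
theorem continuous_toMatrix {ι : Type*} : Continuous (toMatrix (ι := ι)) := by
  unfold toMatrix
  fun_prop

variable {ι : Type*} [Fintype ι] [DecidableEq ι]

/-- Induction on the size of the minor. As a function of its corner entry the determinant is affine,
with slope the next smaller minor; when that slope is nonzero a single value of the entry is bad,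
and a Gaussian variable avoids it almost surely. -/
theorem det_submatrix_ne_zero_ae (k : ℕ) (f : Fin k → ι) (hf : Function.Injective f) :
    ∀ᵐ h ∂matrixLaw ι, ((toMatrix h).submatrix f f).det ≠ 0 := by
  induction k with
  | zero => simp
  | succ k ih =>
    set f' : Fin k → ι := fun i ↦ f i.succ with hf'
    have hf'i : Function.Injective f' := fun i j hij ↦ Fin.succ_injective _ (hf hij)
    have h1 := ih f' hf'i
    have hc : Continuous (fun h : ι × ι → ℝ ↦ ((toMatrix h).submatrix f f).det) := by fun_prop
    have hc' : Continuous (fun h : ι × ι → ℝ ↦ ((toMatrix h).submatrix f' f').det) := by fun_prop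
    set A : Set (ι × ι → ℝ) := {h | ((toMatrix h).submatrix f f).det = 0 ∧
      ((toMatrix h).submatrix f' f').det ≠ 0} with hA
    have hAm : MeasurableSet A :=
      (hc.measurable (measurableSet_singleton 0)).inter
        (hc'.measurable (measurableSet_singleton 0)).compl
    have hexp : ∀ (h : ι × ι → ℝ) (y : ℝ),
        ((toMatrix (Function.update h (f 0, f 0) y)).submatrix f' f').det =
          ((toMatrix h).submatrix f' f').det ∧
        ((toMatrix (Function.update h (f 0, f 0) y)).submatrix f f).det =
          y * ((toMatrix h).submatrix f' f').det +
          ∑ j : Fin k, (-1) ^ ((j.succ : Fin (k + 1)) : ℕ) * h (f 0, f j.succ) *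
            (((toMatrix h).submatrix f f).submatrix Fin.succ j.succ.succAbove).det := by
      intro h y
      have hsub : ∀ g : Fin k → Fin (k + 1),
          ((toMatrix (Function.update h (f 0, f 0) y)).submatrix f f).submatrix Fin.succ g =
          ((toMatrix h).submatrix f f).submatrix Fin.succ g := by
        intro g
        ext i j
        simp only [Matrix.submatrix_apply, toMatrix, Matrix.of_apply]
        rw [Function.update_of_ne]
        intro hh
        exact Fin.succ_ne_zero _ (hf (Prod.mk.inj hh).1)
      refine ⟨congrArg Matrix.det (hsub Fin.succ), ?_⟩
      rw [Matrix.det_succ_row_zero, Fin.sum_univ_succ]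
      congr 1
      · rw [hsub]
        simp [toMatrix, hf', Matrix.submatrix_submatrix, Function.comp_def]
      · refine Finset.sum_congr rfl fun j _ ↦ ?_
        rw [hsub]
        simp only [Matrix.submatrix_apply, toMatrix, Matrix.of_apply]
        rw [Function.update_of_ne]
        intro hh
        exact Fin.succ_ne_zero _ (hf (Prod.mk.inj hh).2)
    have hnull : matrixLaw ι A = 0 := by
      rw [← lintegral_indicator_one hAm]
      refine le_antisymm (lintegral_pi_le_of_update _ (measurable_one.indicator hAm) (f 0, f 0)
        fun h ↦ ?_) zero_le
      rcases eq_or_ne ((toMatrix h).submatrix f' f').det 0 with h0 | h0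
      · refine le_of_eq ?_
        rw [lintegral_eq_zero_iff' (by
          refine Measurable.aemeasurable ?_
          exact (measurable_one.indicator hAm).comp (measurable_update h))]
        refine ae_of_all _ fun y ↦ ?_
        simp only [Pi.zero_apply, Set.indicator_apply_eq_zero, hA, Set.mem_ofPred_eq, (hexp h y).1,
          h0]
        simp
      · set b := ∑ j : Fin k, (-1) ^ ((j.succ : Fin (k + 1)) : ℕ) * h (f 0, f j.succ) *
            (((toMatrix h).submatrix f f).submatrix Fin.succ j.succ.succAbove).det with hb
        calc ∫⁻ y, A.indicator 1 (Function.update h (f 0, f 0) y) ∂gaussianReal 0 1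
            ≤ ∫⁻ y, ({-b / ((toMatrix h).submatrix f' f').det} : Set ℝ).indicator 1 y
                ∂gaussianReal 0 1 := by
              refine lintegral_mono fun y ↦ ?_
              by_cases hy : Function.update h (f 0, f 0) y ∈ A
              · have h2 := hy.1
                rw [(hexp h y).2] at h2
                have h3 : y = -b / ((toMatrix h).submatrix f' f').det := by
                  rw [eq_div_iff h0]
                  linarith
                rw [Set.indicator_of_mem hy, Set.indicator_of_mem (show y ∈ _ from h3)]
                rfl
              · rw [Set.indicator_of_notMem hy]
                exact zero_le
          _ = 0 := by
              rw [lintegral_indicator_one (measurableSet_singleton _)]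
              have := nullSingletonClass_gaussianReal (μ := 0) (v := 1) one_ne_zero
              exact measure_singleton _
    have h2 : ∀ᵐ h ∂matrixLaw ι, h ∉ A := measure_eq_zero_iff_ae_notMem.1 hnull
    filter_upwards [h1, h2] with h hh1 hh2 hdet
    exact hh2 ⟨hdet, hh1⟩

theorem det_ne_zero_ae : ∀ᵐ h ∂matrixLaw ι, (toMatrix h).det ≠ 0 := by
  filter_upwards [det_submatrix_ne_zero_ae (ι := ι) _ (Fintype.equivFin ι).symm
    (Fintype.equivFin ι).symm.injective] with h hh
  rwa [Matrix.det_submatrix_equiv_self] at hh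

/-- A measure of the size of the inverse matrix. -/
def invSize (h : ι × ι → ℝ) : ℝ := ∑ i, ∑ j, √|(toMatrix h)⁻¹ i j|

theorem invSize_nonneg (h : ι × ι → ℝ) : 0 ≤ invSize h :=
  Finset.sum_nonneg fun _ _ ↦ Finset.sum_nonneg fun _ _ ↦ Real.sqrt_nonneg _

theorem inv_toMatrix_apply (h : ι × ι → ℝ) (i j : ι) :
    (toMatrix h)⁻¹ i j = (toMatrix h).adjugate i j / (toMatrix h).det := by
  rw [Matrix.inv_def, Matrix.smul_apply, Ring.inverse_eq_inv', smul_eq_mul, div_eq_mul_inv,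
    mul_comm]

theorem measurable_inv_apply (i j : ι) :
    Measurable (fun h : ι × ι → ℝ ↦ √|(toMatrix h)⁻¹ i j|) := by
  have h1 : Continuous (fun h : ι × ι → ℝ ↦ (toMatrix h).adjugate i j) := by fun_prop
  have h2 : Continuous (fun h : ι × ι → ℝ ↦ (toMatrix h).det) := by fun_prop
  simp_rw [inv_toMatrix_apply]
  exact ((h1.measurable.div h2.measurable).abs).sqrt

theorem measurable_invSize : Measurable (invSize (ι := ι)) :=
  Finset.measurable_sum _ fun i _ ↦ Finset.measurable_sum _ fun j _ ↦ measurable_inv_apply i j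

/-- The entry `(i, j)` of the inverse is a cofactor divided by the determinant. As a function of the
matrix entry `(j, i)` the determinant is affine with slope this same cofactor, which does not
involve that entry. This is the form `|a| / |y a + b|` of `exists_lintegral_sqrt_inv_le`, and it
explains the square roots in `invSize`. -/
theorem exists_lintegral_invSize_le (ι : Type*) [Fintype ι] [DecidableEq ι] :
    ∃ C : ENNReal, C ≠ ⊤ ∧ ∫⁻ h, ENNReal.ofReal (invSize h) ∂matrixLaw ι ≤ C := by
  obtain ⟨C, hC, hCab⟩ := exists_lintegral_sqrt_inv_le
  refine ⟨∑ _ : ι, ∑ _ : ι, C, ?_, ?_⟩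
  · simp only [Finset.sum_const, nsmul_eq_mul]
    finiteness
  have : ∀ h : ι × ι → ℝ, ENNReal.ofReal (invSize h) =
      ∑ i, ∑ j, ENNReal.ofReal √|(toMatrix h)⁻¹ i j| := by
    intro h
    rw [invSize, ENNReal.ofReal_sum_of_nonneg fun i _ ↦ Finset.sum_nonneg fun _ _ ↦
      Real.sqrt_nonneg _]
    exact Finset.sum_congr rfl fun i _ ↦ ENNReal.ofReal_sum_of_nonneg fun j _ ↦ Real.sqrt_nonneg _
  simp_rw [this]
  rw [lintegral_finsetSum _ fun i _ ↦ Finset.measurable_sum _ fun j _ ↦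
    (measurable_inv_apply i j).ennreal_ofReal]
  refine Finset.sum_le_sum fun i _ ↦ ?_
  rw [lintegral_finsetSum _ fun j _ ↦ (measurable_inv_apply i j).ennreal_ofReal]
  refine Finset.sum_le_sum fun j _ ↦ ?_
  refine lintegral_pi_le_of_update _ (measurable_inv_apply i j).ennreal_ofReal (j, i) fun h ↦ ?_
  set v : ι → ℝ := fun l ↦ if l = i then 0 else h (j, l) with hv
  have hmat : ∀ y, toMatrix (Function.update h (j, i) y) =
      (toMatrix h).updateRow j (y • Pi.single i 1 + v) := by
    intro y
    ext k l
    by_cases hk : k = j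
    · subst hk
      by_cases hl : l = i
      · subst hl
        simp [toMatrix, hv]
      · simp only [toMatrix, Matrix.of_apply, Matrix.updateRow_self, hv, Pi.add_apply,
          Pi.smul_apply, hl, if_false, ne_eq, not_false_eq_true, Pi.single_eq_of_ne, smul_zero,
          zero_add]
        rw [Function.update_of_ne]
        exact fun hh ↦ hl (Prod.mk.inj hh).2
    · rw [Matrix.updateRow_ne hk]
      simp only [toMatrix, Matrix.of_apply]
      rw [Function.update_of_ne]
      exact fun hh ↦ hk (Prod.mk.inj hh).1
  have hadj : ∀ y, (toMatrix (Function.update h (j, i) y)).adjugate i j =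
      (toMatrix h).adjugate i j := by
    intro y
    rw [Matrix.adjugate_apply, Matrix.adjugate_apply, hmat, Matrix.updateRow_idem]
  have hdet : ∀ y, (toMatrix (Function.update h (j, i) y)).det =
      y * (toMatrix h).adjugate i j + ((toMatrix h).updateRow j v).det := by
    intro y
    rw [hmat, Matrix.det_updateRow_add, Matrix.det_updateRow_smul, Matrix.adjugate_apply]
  simp_rw [inv_toMatrix_apply, hadj, hdet, abs_div]
  exact hCab _ _

/-- The operator norm of the inverse is at most the sum of the absolute values of its entries, which
is at most the square of the sum of their square roots. -/
theorem sum_sq_le_invSize (h : ι × ι → ℝ) (hdet : (toMatrix h).det ≠ 0) (c : ι → ℝ) :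
    ∑ i, c i ^ 2 ≤ invSize h ^ 4 * ∑ i, (∑ j, h (i, j) * c j) ^ 2 := by
  set d : ι → ℝ := fun i ↦ ∑ j, h (i, j) * c j with hd
  set s := √(∑ i, d i ^ 2) with hs
  have hs0 : 0 ≤ ∑ i, d i ^ 2 := Finset.sum_nonneg fun _ _ ↦ sq_nonneg _
  have hc : c = (toMatrix h)⁻¹.mulVec d := by
    have : d = (toMatrix h).mulVec c := rfl
    rw [this, Matrix.mulVec_mulVec, Matrix.nonsing_inv_mul _ (isUnit_iff_ne_zero.2 hdet),
      Matrix.one_mulVec]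
  have hdj : ∀ j, |d j| ≤ s := fun j ↦ Real.abs_le_sqrt
    (Finset.single_le_sum (f := fun i ↦ d i ^ 2) (fun i _ ↦ sq_nonneg _) (Finset.mem_univ j))
  have hci : ∀ i, |c i| ≤ (∑ j, |(toMatrix h)⁻¹ i j|) * s := by
    intro i
    conv_lhs => rw [hc]
    rw [Matrix.mulVec, dotProduct, Finset.sum_mul]
    refine (Finset.abs_sum_le_sum_abs _ _).trans (Finset.sum_le_sum fun j _ ↦ ?_)
    rw [abs_mul]
    gcongr
    exact hdj j
  have hsum : ∑ i, ∑ j, |(toMatrix h)⁻¹ i j| ≤ invSize h ^ 2 := by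
    rw [invSize, ← Fintype.sum_prod_type', ← Fintype.sum_prod_type']
    have := Finset.sum_sq_le_sq_sum_of_nonneg (s := Finset.univ)
      (f := fun x : ι × ι ↦ √|(toMatrix h)⁻¹ x.1 x.2|) (fun x _ ↦ Real.sqrt_nonneg _)
    simpa only [Real.sq_sqrt (abs_nonneg _)] using this
  calc ∑ i, c i ^ 2 = ∑ i, |c i| ^ 2 := by simp
    _ ≤ (∑ i, |c i|) ^ 2 := Finset.sum_sq_le_sq_sum_of_nonneg fun i _ ↦ abs_nonneg _
    _ ≤ (invSize h ^ 2 * s) ^ 2 := by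
        gcongr
        calc ∑ i, |c i| ≤ ∑ i, (∑ j, |(toMatrix h)⁻¹ i j|) * s :=
              Finset.sum_le_sum fun i _ ↦ hci i
          _ = (∑ i, ∑ j, |(toMatrix h)⁻¹ i j|) * s := by rw [Finset.sum_mul]
          _ ≤ invSize h ^ 2 * s := by gcongr
    _ = invSize h ^ 4 * ∑ i, d i ^ 2 := by
        rw [mul_pow, ← pow_mul, hs, Real.sq_sqrt hs0]

end SquareMatrix

end

/-! ### Inverse bounds for linear systems that contain many Gaussian square blocks -/

section

section InverseBound

variable {ι : Type*} [Fintype ι] [DecidableEq ι]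

/-- The law of eight independent Gaussian matrices. -/
abbrev blockLaw (ι : Type*) [Fintype ι] : Measure (Fin 8 → ι × ι → ℝ) :=
  Measure.pi fun _ ↦ matrixLaw ι

theorem lintegral_prod_invSize :
    ∫⁻ H : Fin 8 → ι × ι → ℝ, ENNReal.ofReal (∏ a, invSize (H a)) ∂blockLaw ι =
      (∫⁻ h, ENNReal.ofReal (invSize h) ∂matrixLaw ι) ^ 8 := by
  simp_rw [ENNReal.ofReal_prod_of_nonneg fun a _ ↦ invSize_nonneg _]
  have hm : Measurable (fun h : ι × ι → ℝ ↦ ENNReal.ofReal (invSize h)) :=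
    measurable_invSize.ennreal_ofReal
  have hind : iIndepFun (fun (a : Fin 8) (H : Fin 8 → ι × ι → ℝ) ↦ ENNReal.ofReal (invSize (H a)))
      (blockLaw ι) :=
    iIndepFun_pi (μ := fun _ : Fin 8 ↦ matrixLaw ι)
      (X := fun _ h ↦ ENNReal.ofReal (invSize h)) fun _ ↦ hm.aemeasurable
  rw [lintegral_prod_eq_prod_lintegral_of_indepFun Finset.univ _ hind
    fun a ↦ hm.comp (measurable_pi_apply a)]
  have : ∀ a : Fin 8, ∫⁻ H : Fin 8 → ι × ι → ℝ, ENNReal.ofReal (invSize (H a)) ∂blockLaw ι =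
      ∫⁻ h, ENNReal.ofReal (invSize h) ∂matrixLaw ι := by
    intro a
    have hmp := measurePreserving_eval (fun _ : Fin 8 ↦ matrixLaw ι) a
    rw [← hmp.lintegral_comp hm]
  simp [this]

/-- Eight nonsingular square blocks bound the solution of a linear system. -/
theorem sum_sq_le_sqrt_prod_invSize (H : Fin 8 → ι × ι → ℝ) (hH : ∀ a, (toMatrix (H a)).det ≠ 0)
    (c : ι → ℝ) :
    ∑ i, c i ^ 2 ≤ √(∏ a, invSize (H a)) * ∑ a, ∑ l, (∑ j, H a (l, j) * c j) ^ 2 := by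
  set Q := ∑ a, ∑ l, (∑ j, H a (l, j) * c j) ^ 2 with hQ
  have hQ0 : ∀ a, 0 ≤ ∑ l, (∑ j, H a (l, j) * c j) ^ 2 :=
    fun a ↦ Finset.sum_nonneg fun _ _ ↦ sq_nonneg _
  have hQ0' : 0 ≤ Q := Finset.sum_nonneg fun a _ ↦ hQ0 a
  have hP : 0 ≤ ∏ a, invSize (H a) := Finset.prod_nonneg fun a _ ↦ invSize_nonneg _
  have h1 : ∀ a, ∑ i, c i ^ 2 ≤ invSize (H a) ^ 4 * Q := fun a ↦
    (sum_sq_le_invSize (H a) (hH a) c).trans (mul_le_mul_of_nonneg_left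
      (Finset.single_le_sum (f := fun a ↦ ∑ l, (∑ j, H a (l, j) * c j) ^ 2)
        (fun a _ ↦ hQ0 a) (Finset.mem_univ a)) (pow_nonneg (invSize_nonneg _) 4))
  -- Why eight blocks: each gives a factor `invSize ^ 4`, and the eighth root of the product of
  -- eight such factors is `√(∏ invSize)`. The square of this is a product of independent variables,
  -- each needed only to the first power, so it has finite mean.
  have h2 : (∑ i, c i ^ 2) ^ 8 ≤ (√(∏ a, invSize (H a)) * Q) ^ 8 := by
    calc (∑ i, c i ^ 2) ^ 8 = ∏ _a : Fin 8, ∑ i, c i ^ 2 := by simp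
      _ ≤ ∏ a, invSize (H a) ^ 4 * Q := Finset.prod_le_prod
          (fun a _ ↦ Finset.sum_nonneg fun _ _ ↦ sq_nonneg _) fun a _ ↦ h1 a
      _ = (∏ a, invSize (H a)) ^ 4 * Q ^ 8 := by
          rw [Finset.prod_mul_distrib, Finset.prod_pow]; simp
      _ = (√(∏ a, invSize (H a)) * Q) ^ 8 := by
          have h3 : √(∏ a, invSize (H a)) ^ 8 = (√(∏ a, invSize (H a)) ^ 2) ^ 4 := by
            rw [← pow_mul]
          rw [mul_pow, h3, Real.sq_sqrt hP]
  exact le_of_pow_le_pow_left₀ (by norm_num) (by positivity) h2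

/-- If a random linear system contains `B` groups of eight Gaussian square blocks, its inverse
has second moments of order `B⁻²`. -/
theorem exists_inverse_bound (ι : Type*) [Fintype ι] [DecidableEq ι] :
    ∃ C : NNReal, ∀ {Ω : Type} [MeasurableSpace Ω] (P : Measure Ω) (B : ℕ), 0 < B →
      ∀ M : Fin B → Ω → Fin 8 → ι × ι → ℝ, (∀ b, MeasurePreserving (M b) P (blockLaw ι)) →
      ∃ R : Ω → ℝ, Measurable R ∧ (∀ ω, 0 ≤ R ω) ∧
        ∫⁻ ω, ENNReal.ofReal (R ω ^ 2) ∂P ≤ ENNReal.ofReal (C / B ^ 2) ∧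
        ∀ᵐ ω ∂P, ∀ c : ι → ℝ, ∑ i, c i ^ 2 ≤
          R ω * ∑ b, ∑ a, ∑ l, (∑ j, M b ω a (l, j) * c j) ^ 2 := by
  obtain ⟨C, hC, hC'⟩ := exists_lintegral_invSize_le ι
  lift C to NNReal using hC
  refine ⟨C ^ 8, fun {Ω} _ P B hB M hM ↦ ?_⟩
  have hB0 : (0 : ℝ) < B := by exact_mod_cast hB
  have hprod0 : ∀ H : Fin 8 → ι × ι → ℝ, 0 ≤ ∏ a, invSize (H a) :=
    fun H ↦ Finset.prod_nonneg fun a _ ↦ invSize_nonneg _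
  have hprodm : Measurable (fun H : Fin 8 → ι × ι → ℝ ↦ ∏ a, invSize (H a)) :=
    Finset.measurable_prod _ fun a _ ↦ measurable_invSize.comp (measurable_pi_apply a)
  -- With `u b` the bound from group `b` and `q b` its quadratic form, `‖c‖² ≤ u b * q b` for each
  -- `b`; Cauchy-Schwarz over the `B` groups gives `B² ‖c‖² ≤ (∑ u b) (∑ q b)`. The groups need not
  -- be independent of one another.
  refine ⟨fun ω ↦ (∑ b, √(∏ a, invSize (M b ω a))) / B ^ 2, ?_, fun ω ↦ by positivity, ?_, ?_⟩
  · refine Measurable.div_const (Finset.measurable_sum _ fun b _ ↦ ?_) _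
    exact (hprodm.comp (hM b).measurable).sqrt
  · have h1 : ∀ ω, ((∑ b, √(∏ a, invSize (M b ω a))) / B ^ 2) ^ 2 ≤
        ∑ b, (1 / B ^ 3) * ∏ a, invSize (M b ω a) := by
      intro ω
      have := sq_sum_le_card_mul_sum_sq (s := (Finset.univ : Finset (Fin B)))
        (f := fun b ↦ √(∏ a, invSize (M b ω a)))
      simp only [Finset.card_univ, Fintype.card_fin, Real.sq_sqrt (hprod0 _)] at this
      rw [div_pow, div_le_iff₀ (by positivity), ← Finset.mul_sum]
      refine this.trans (le_of_eq ?_)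
      field_simp
    calc ∫⁻ ω, ENNReal.ofReal (((∑ b, √(∏ a, invSize (M b ω a))) / B ^ 2) ^ 2) ∂P
        ≤ ∫⁻ ω, ∑ b, ENNReal.ofReal (1 / B ^ 3) * ENNReal.ofReal (∏ a, invSize (M b ω a)) ∂P := by
          refine lintegral_mono fun ω ↦ ?_
          refine (ENNReal.ofReal_le_ofReal (h1 ω)).trans (le_of_eq ?_)
          rw [ENNReal.ofReal_sum_of_nonneg fun b _ ↦ mul_nonneg (by positivity) (hprod0 _)]
          exact Finset.sum_congr rfl fun b _ ↦ ENNReal.ofReal_mul (by positivity)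
      _ = ∑ b, ENNReal.ofReal (1 / B ^ 3) * ∫⁻ H : Fin 8 → ι × ι → ℝ,
            ENNReal.ofReal (∏ a, invSize (H a)) ∂blockLaw ι := by
          have hm : ∀ b, Measurable (fun ω ↦ ENNReal.ofReal (∏ a, invSize (M b ω a))) :=
            fun b ↦ (hprodm.comp (hM b).measurable).ennreal_ofReal
          rw [lintegral_finsetSum _ fun b _ ↦ (hm b).const_mul _]
          refine Finset.sum_congr rfl fun b _ ↦ ?_
          rw [lintegral_const_mul _ (hm b), ← (hM b).lintegral_comp hprodm.ennreal_ofReal]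
      _ ≤ ∑ _b : Fin B, ENNReal.ofReal (1 / B ^ 3) * (C : ENNReal) ^ 8 := by
          refine Finset.sum_le_sum fun b _ ↦ ?_
          rw [lintegral_prod_invSize]
          gcongr
      _ = ENNReal.ofReal ((C ^ 8 : NNReal) / B ^ 2) := by
          rw [Finset.sum_const, Finset.card_univ, Fintype.card_fin, nsmul_eq_mul,
            ← ENNReal.ofReal_natCast, ← ENNReal.ofReal_coe_nnreal,
            ← ENNReal.ofReal_pow C.coe_nonneg, ← ENNReal.ofReal_mul (by positivity),
            ← ENNReal.ofReal_mul (by positivity)]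
          congr 1
          push_cast
          field_simp
  · have hdet : ∀ᵐ H ∂blockLaw ι, ∀ a, (toMatrix (H a)).det ≠ 0 := by
      rw [ae_all_iff]
      intro a
      exact (measurePreserving_eval (fun _ : Fin 8 ↦ matrixLaw ι) a).quasiMeasurePreserving.ae
        det_ne_zero_ae
    have hdet' : ∀ᵐ ω ∂P, ∀ b a, (toMatrix (M b ω a)).det ≠ 0 := by
      rw [ae_all_iff]
      intro b
      exact (hM b).quasiMeasurePreserving.ae hdet
    filter_upwards [hdet'] with ω hω c
    set q : Fin B → ℝ := fun b ↦ ∑ a, ∑ l, (∑ j, M b ω a (l, j) * c j) ^ 2 with hq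
    set u : Fin B → ℝ := fun b ↦ √(∏ a, invSize (M b ω a)) with hu
    have hq0 : ∀ b, 0 ≤ q b := fun b ↦ Finset.sum_nonneg fun _ _ ↦
      Finset.sum_nonneg fun _ _ ↦ sq_nonneg _
    have hu0 : ∀ b, 0 ≤ u b := fun b ↦ Real.sqrt_nonneg _
    have hc0 : 0 ≤ ∑ i, c i ^ 2 := Finset.sum_nonneg fun _ _ ↦ sq_nonneg _
    have h1 : ∀ b, √(∑ i, c i ^ 2) ≤ √(u b) * √(q b) := fun b ↦ by
      rw [← Real.sqrt_mul (hu0 b)]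
      exact Real.sqrt_le_sqrt (sum_sq_le_sqrt_prod_invSize (M b ω) (hω b) c)
    have h2 : B * √(∑ i, c i ^ 2) ≤ √(∑ b, u b) * √(∑ b, q b) := by
      calc B * √(∑ i, c i ^ 2) = ∑ _b : Fin B, √(∑ i, c i ^ 2) := by simp
        _ ≤ ∑ b, √(u b) * √(q b) := Finset.sum_le_sum fun b _ ↦ h1 b
        _ ≤ _ := Real.sum_sqrt_mul_sqrt_le _ hu0 hq0
    have h3 : (B * √(∑ i, c i ^ 2)) ^ 2 ≤ (√(∑ b, u b) * √(∑ b, q b)) ^ 2 := by gcongr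
    rw [mul_pow, mul_pow, Real.sq_sqrt hc0, Real.sq_sqrt (Finset.sum_nonneg fun b _ ↦ hu0 b),
      Real.sq_sqrt (Finset.sum_nonneg fun b _ ↦ hq0 b)] at h3
    rw [div_mul_eq_mul_div, le_div_iff₀ (by positivity)]
    linarith

/-- The coefficients of independent standard Gaussian vectors in a family of orthonormal
elementary tensors are independent standard Gaussian variables. -/
theorem measurePreserving_tensor {τ K : Type*} [Fintype τ] [Fintype K] [DecidableEq K] {p : ℕ}
    (ε : K → τ → ℝ) (φ : K → Vec p)
    (h : ∀ k k', (∑ r, ε k r * ε k' r) * inner ℝ (φ k) (φ k') = if k = k' then 1 else 0) :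
    MeasurePreserving (fun (x : τ → Vec p) k ↦ ∑ r, ε k r * inner ℝ (x r) (φ k))
      (Measure.pi fun _ ↦ stdGaussian (Vec p)) (Measure.pi fun _ ↦ gaussianReal 0 1) := by
  have h1 := measurePreserving_sum_stdGaussian (E := Vec p) (F := EuclideanSpace ℝ K) (τ := τ)
    (fun r x ↦ WithLp.toLp 2 fun k ↦ ε k r * inner ℝ x (φ k))
    (fun r t ↦ ∑ k, (t k * ε k r) • φ k) (fun r ↦ by fun_prop) (fun r x t ↦ by
      rw [PiLp.inner_apply, inner_sum]
      refine Finset.sum_congr rfl fun k _ ↦ ?_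
      rw [inner_smul_right]
      simp only [RCLike.inner_apply, conj_trivial]
      ring) (fun t ↦ by
      have : ∀ r, ‖∑ k, (t k * ε k r) • φ k‖ ^ 2 =
          ∑ k, ∑ k', t k * t k' * (ε k r * ε k' r * inner ℝ (φ k) (φ k')) := by
        intro r
        rw [← real_inner_self_eq_norm_sq, sum_inner]
        refine Finset.sum_congr rfl fun k _ ↦ ?_
        rw [inner_sum]
        refine Finset.sum_congr rfl fun k' _ ↦ ?_
        rw [inner_smul_left, inner_smul_right, RCLike.conj_to_real]
        ring
      simp_rw [this]
      rw [Finset.sum_comm, EuclideanSpace.real_norm_sq_eq]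
      refine Finset.sum_congr rfl fun k _ ↦ ?_
      rw [Finset.sum_comm]
      simp_rw [← Finset.mul_sum, ← Finset.sum_mul, h]
      simp [pow_two])
  have h2 : MeasurePreserving (WithLp.ofLp (p := 2) (V := K → ℝ))
      (stdGaussian (EuclideanSpace ℝ K)) (Measure.pi fun _ ↦ gaussianReal 0 1) := by
    refine ⟨by fun_prop, ?_⟩
    rw [← map_pi_eq_stdGaussian, Measure.map_map (by fun_prop) (by fun_prop)]
    exact Measure.map_id
  convert! h2.comp h1 using 1
  ext x k
  simp

theorem measurePreserving_curry {A K : Type*} [Fintype A] [Fintype K] {X : Type*}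
    [MeasurableSpace X] (μ : Measure X) [IsProbabilityMeasure μ] :
    MeasurePreserving (fun (x : A × K → X) a k ↦ x (a, k)) (Measure.pi fun _ ↦ μ)
      (Measure.pi fun _ ↦ Measure.pi fun _ ↦ μ) := by
  refine ⟨by fun_prop, ?_⟩
  have := Measure.infinitePi_map_curry (ι := A) (κ := K) (fun _ _ ↦ μ)
  simp only [Measure.infinitePi_eq_pi] at this
  exact this

/-- The blocks of `exists_inverse_bound` are realized as coefficients of the Gaussian rows in
elementary tensors `ε ⊗ φ`. Orthonormality is required only within each group `b`, since only the
law of each group matters. -/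
theorem exists_tensor_inverse_bound (ι : Type*) [Fintype ι] [DecidableEq ι] :
    ∃ C : NNReal, ∀ {τ : Type} [Fintype τ] (p B : ℕ), 0 < B →
      ∀ (ε : Fin B → Fin 8 × (ι × ι) → τ → ℝ) (φ : Fin B → Fin 8 × (ι × ι) → Vec p),
      (∀ b k k', (∑ r, ε b k r * ε b k' r) * inner ℝ (φ b k) (φ b k') =
        if k = k' then 1 else 0) →
      ∃ R : (τ → Vec p) → ℝ, Measurable R ∧ (∀ ω, 0 ≤ R ω) ∧
        ∫⁻ x, ENNReal.ofReal (R x ^ 2) ∂(Measure.pi fun _ ↦ stdGaussian (Vec p)) ≤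
          ENNReal.ofReal (C / B ^ 2) ∧
        ∀ᵐ x ∂(Measure.pi fun _ : τ ↦ stdGaussian (Vec p)), ∀ c : ι → ℝ, ∑ i, c i ^ 2 ≤
          R x * ∑ b, ∑ a, ∑ l, (∑ j, (∑ r, ε b (a, l, j) r * inner ℝ (x r) (φ b (a, l, j))) *
            c j) ^ 2 := by
  obtain ⟨C, hC⟩ := exists_inverse_bound ι
  refine ⟨C, fun {τ} _ p B hB ε φ h ↦ ?_⟩
  exact hC (Measure.pi fun _ : τ ↦ stdGaussian (Vec p)) B hB
    (fun b x a k ↦ ∑ r, ε b (a, k) r * inner ℝ (x r) (φ b (a, k)))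
    (fun b ↦ (measurePreserving_curry (gaussianReal 0 1)).comp
      (measurePreserving_tensor (ε b) (φ b) (h b)))

/-- Inverse of `y ↦ Xᵀ y` on the span of an orthonormal family `e`, tested on an orthonormal
family `f`. -/
theorem exists_inverse_bound_transpose (ι : Type*) [Fintype ι] [DecidableEq ι] :
    ∃ C : NNReal, ∀ {τ : Type} [Fintype τ] (p B : ℕ), 0 < B →
      ∀ (e : ι → EuclideanSpace ℝ τ) (f : Fin B × Fin 8 × ι → Vec p),
      Orthonormal ℝ e → Orthonormal ℝ f →
      ∃ R : (τ → Vec p) → ℝ, Measurable R ∧ (∀ ω, 0 ≤ R ω) ∧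
        ∫⁻ x, ENNReal.ofReal (R x ^ 2) ∂(Measure.pi fun _ ↦ stdGaussian (Vec p)) ≤
          ENNReal.ofReal (C / B ^ 2) ∧
        ∀ᵐ x ∂(Measure.pi fun _ : τ ↦ stdGaussian (Vec p)), ∀ c : ι → ℝ, ∑ i, c i ^ 2 ≤
          R x * ∑ k, inner ℝ (∑ r, (∑ j, c j • e j) r • x r) (f k) ^ 2 := by
  obtain ⟨C, hC⟩ := exists_tensor_inverse_bound ι
  refine ⟨C, fun {τ} _ p B hB e f he hf ↦ ?_⟩
  rw [orthonormal_iff_ite] at he hf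
  -- The column index of a block selects the weight vector `e j`; the group, the block and the row
  -- index select the test vector `f (b, a, l)`.
  obtain ⟨R, hRm, hR0, hRi, hR⟩ := hC (τ := τ) p B hB (fun b k r ↦ e k.2.2 r)
    (fun b k ↦ f (b, k.1, k.2.1)) (by
      rintro b ⟨a, l, j⟩ ⟨a', l', j'⟩
      have h1 := he j j'
      rw [PiLp.inner_apply] at h1
      simp only [RCLike.inner_apply, conj_trivial] at h1
      have h2 : ((a, l, j) = (a', l', j')) ↔ (j = j' ∧ (b, a, l) = (b, a', l')) := by
        simp only [Prod.mk.injEq]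
        tauto
      simp_rw [mul_comm (e j _), h1, hf, if_congr h2 rfl rfl]
      rw [ite_and, ite_mul, one_mul, zero_mul])
  refine ⟨R, hRm, hR0, hRi, ?_⟩
  filter_upwards [hR] with x hx c
  refine (hx c).trans (le_of_eq ?_)
  rw [Fintype.sum_prod_type]
  simp_rw [Fintype.sum_prod_type]
  congr 1
  refine Finset.sum_congr rfl fun b _ ↦ Finset.sum_congr rfl fun a _ ↦
    Finset.sum_congr rfl fun l _ ↦ ?_
  congr 1
  simp_rw [sum_inner, inner_smul_left, RCLike.conj_to_real, Finset.sum_mul]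
  rw [Finset.sum_comm]
  refine Finset.sum_congr rfl fun r _ ↦ ?_
  rw [WithLp.ofLp_sum, Finset.sum_apply, Finset.sum_mul]
  refine Finset.sum_congr rfl fun j _ ↦ ?_
  rw [PiLp.smul_apply, smul_eq_mul]
  ring

/-- Inverse of `u ↦ X u` on the span of an orthonormal family `f`, tested on a family of rows. -/
theorem exists_inverse_bound_rows (ι : Type*) [Fintype ι] [DecidableEq ι] :
    ∃ C : NNReal, ∀ {τ : Type} [Fintype τ] (p B : ℕ), 0 < B →
      ∀ (e : Fin B × Fin 8 × ι → τ) (f : ι → Vec p),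
      Function.Injective e → Orthonormal ℝ f →
      ∃ R : (τ → Vec p) → ℝ, Measurable R ∧ (∀ ω, 0 ≤ R ω) ∧
        ∫⁻ x, ENNReal.ofReal (R x ^ 2) ∂(Measure.pi fun _ ↦ stdGaussian (Vec p)) ≤
          ENNReal.ofReal (C / B ^ 2) ∧
        ∀ᵐ x ∂(Measure.pi fun _ : τ ↦ stdGaussian (Vec p)), ∀ c : ι → ℝ, ∑ i, c i ^ 2 ≤
          R x * ∑ k, inner ℝ (x (e k)) (∑ j, c j • f j) ^ 2 := by
  classical
  obtain ⟨C, hC⟩ := exists_tensor_inverse_bound ι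
  refine ⟨C, fun {τ} _ p B hB e f he hf ↦ ?_⟩
  rw [orthonormal_iff_ite] at hf
  -- The roles are exchanged: the row index of a block selects one Gaussian row through an indicator
  -- weight, and the column index selects the direction `f j`.
  obtain ⟨R, hRm, hR0, hRi, hR⟩ := hC (τ := τ) p B hB
    (fun b k r ↦ if r = e (b, k.1, k.2.1) then 1 else 0)
    (fun b k ↦ f k.2.2) (by
      rintro b ⟨a, l, j⟩ ⟨a', l', j'⟩
      have h2 : ((a, l, j) = (a', l', j')) ↔ (e (b, a', l') = e (b, a, l) ∧ j = j') := by
        rw [he.eq_iff]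
        simp only [Prod.mk.injEq]
        tauto
      simp only [mul_ite, mul_one, mul_zero, Finset.sum_ite_eq', Finset.mem_univ, if_true, hf,
        if_congr h2 rfl rfl]
      rw [ite_and]
      split_ifs <;> rfl)
  refine ⟨R, hRm, hR0, hRi, ?_⟩
  filter_upwards [hR] with x hx c
  refine (hx c).trans (le_of_eq ?_)
  rw [Fintype.sum_prod_type]
  simp_rw [Fintype.sum_prod_type]
  congr 1
  refine Finset.sum_congr rfl fun b _ ↦ Finset.sum_congr rfl fun a _ ↦
    Finset.sum_congr rfl fun l _ ↦ ?_
  congr 1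
  simp_rw [inner_sum, inner_smul_right]
  refine Finset.sum_congr rfl fun j _ ↦ ?_
  simp only [ite_mul, one_mul, zero_mul, Finset.sum_ite_eq', Finset.mem_univ, if_true]
  ring

end InverseBound

end

section

/-! ### Negative moments of the Gram matrix -/

section GramInv

variable {ι E : Type*} [Fintype ι] [NormedAddCommGroup E] [InnerProductSpace ℝ E]

/-- The inverse of the smallest eigenvalue of the Gram matrix of the family `b`. -/
def gramInv (b : ι → E) : ENNReal :=
  ⨆ c : ι → ℝ, ENNReal.ofReal (∑ j, c j ^ 2) / ENNReal.ofReal (‖∑ j, c j • b j‖ ^ 2)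

theorem gramInv_le {b : ι → E} {R : ℝ} (hR : 0 ≤ R)
    (h : ∀ c : ι → ℝ, ∑ j, c j ^ 2 ≤ R * ‖∑ j, c j • b j‖ ^ 2) :
    gramInv b ≤ ENNReal.ofReal R := by
  refine iSup_le fun c ↦ ENNReal.div_le_of_le_mul ?_
  rw [← ENNReal.ofReal_mul hR]
  exact ENNReal.ofReal_le_ofReal (h c)

theorem sum_sq_le_gramInv {b : ι → E} (hb : gramInv b ≠ ⊤) (c : ι → ℝ) :
    ∑ j, c j ^ 2 ≤ (gramInv b).toReal * ‖∑ j, c j • b j‖ ^ 2 := by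
  have h : ENNReal.ofReal (∑ j, c j ^ 2) / ENNReal.ofReal (‖∑ j, c j • b j‖ ^ 2) ≤ gramInv b :=
    le_iSup (fun c : ι → ℝ ↦
      ENNReal.ofReal (∑ j, c j ^ 2) / ENNReal.ofReal (‖∑ j, c j • b j‖ ^ 2)) c
  rw [ENNReal.div_le_iff_le_mul (Or.inr hb) (Or.inl ENNReal.ofReal_ne_top)] at h
  nth_rewrite 1 [← ENNReal.ofReal_toReal hb] at h
  rwa [← ENNReal.ofReal_mul ENNReal.toReal_nonneg,
    ENNReal.ofReal_le_ofReal_iff (by positivity)] at h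

/-- For fixed `c` the quotient is continuous into `ENNReal`, where inversion is continuous also at
zero, so the uncountable supremum is lower semicontinuous. -/
theorem measurable_gramInv [MeasurableSpace (ι → E)] [BorelSpace (ι → E)] :
    Measurable (gramInv : (ι → E) → ENNReal) := by
  refine LowerSemicontinuous.measurable (lowerSemicontinuous_iSup fun c ↦ ?_)
  refine Continuous.lowerSemicontinuous ?_
  simp only [div_eq_mul_inv]
  refine (ENNReal.continuous_const_mul ENNReal.ofReal_ne_top).comp
    (continuous_inv.comp (ENNReal.continuous_ofReal.comp ?_))
  fun_prop

end GramInv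

section Frames

variable {E : Type*} [NormedAddCommGroup E] [InnerProductSpace ℝ E] [FiniteDimensional ℝ E]

theorem exists_orthonormal_of_card_le (V : Submodule ℝ E) {κ : Type*} [Fintype κ]
    (h : Fintype.card κ ≤ Module.finrank ℝ V) :
    ∃ f : κ → E, Orthonormal ℝ f ∧ ∀ k, f k ∈ V := by
  let s : κ ↪ Fin (Module.finrank ℝ V) :=
    (Fintype.equivFin κ).toEmbedding.trans (Fin.castLEEmb h)
  refine ⟨fun k ↦ stdOrthonormalBasis ℝ V (s k), ?_, fun k ↦ Submodule.coe_mem _⟩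
  exact ((stdOrthonormalBasis ℝ V).orthonormal.comp s s.injective).comp_linearIsometry
    V.subtypeₗᵢ

/-- Random subspaces of dimension at most `card ι` are padded to dimension exactly `card ι`, so that
the inverse bounds apply with constants depending on `ι` alone. -/
theorem exists_orthonormal_span_ge (U : Submodule ℝ E) {ι : Type*} [Fintype ι]
    (h : Module.finrank ℝ U ≤ Fintype.card ι) (h' : Fintype.card ι ≤ Module.finrank ℝ E) :
    ∃ f : ι → E, Orthonormal ℝ f ∧ ∀ u ∈ U, ∃ c : ι → ℝ, u = ∑ j, c j • f j := by
  obtain ⟨W, hW, hWd⟩ : ∃ W : Submodule ℝ E, U ≤ W ∧ Module.finrank ℝ W = Fintype.card ι := by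
    obtain ⟨g, hg, hgU⟩ := exists_orthonormal_of_card_le Uᗮ
      (κ := Fin (Fintype.card ι - Module.finrank ℝ U)) (by
        have := U.finrank_add_finrank_orthogonal
        simp only [Fintype.card_fin]
        omega)
    refine ⟨U ⊔ Submodule.span ℝ (Set.range g), le_sup_left, ?_⟩
    have h₁ := Submodule.finrank_sup_add_finrank_inf_eq U (Submodule.span ℝ (Set.range g))
    have h₂ : U ⊓ Submodule.span ℝ (Set.range g) = ⊥ := by
      refine disjoint_iff.1 (U.orthogonal_disjoint.mono_right ?_)
      rw [Submodule.span_le]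
      rintro _ ⟨k, rfl⟩
      exact hgU k
    rw [h₂, finrank_bot, finrank_span_eq_card hg.linearIndependent, Fintype.card_fin] at h₁
    omega
  let b := (stdOrthonormalBasis ℝ W).reindex ((finCongr hWd).trans (Fintype.equivFin ι).symm)
  refine ⟨fun k ↦ b k, b.orthonormal.comp_linearIsometry W.subtypeₗᵢ, fun u hu ↦
    ⟨fun j ↦ b.repr ⟨u, hW hu⟩ j, ?_⟩⟩
  have := congrArg (Subtype.val) (b.sum_repr ⟨u, hW hu⟩)
  simpa using this.symm

end Frames

variable {m n nv p : ℕ}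

/-- Projecting the combination of rows onto `V`, which is orthogonal to all validation inputs, kills
the identity part of `adaptOp` and leaves `-(α / n)` times the projection of `∑ y_t X_t`. The
weights `y_t = ⟪X_t, u_i⟫`, with `u_i = ∑ c (i, a) S (i, a)`, depend only on the part `Y'` of the
training inputs in `Vᗮ`, while the projection depends on the part `Y` in `V`. The three hypotheses
invert in turn `c ↦ u`, `u ↦ y` and `y ↦` projection, and `(n / α) ^ 2` undoes the scalar factor. -/
theorem sum_sq_le_of_chain (α : ℝ) (hα : α ≠ 0) (hn : 0 < n) (S : Fin m × Fin nv → Vec p)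
    (V : Submodule ℝ (Vec p)) (hS : ∀ j, S j ∈ Vᗮ) (Y Y' X : Fin m × Fin n → Vec p)
    (hX : ∀ r, X r = V.starProjection (Y r) + Vᗮ.starProjection (Y' r))
    {R₁ R₂ R₃ : ℝ} (hR₁ : 0 ≤ R₁) (hR₂ : 0 ≤ R₂)
      (hR₃ : 0 ≤ R₃)
    (h₁ : ∀ c : Fin m × Fin nv → ℝ, ∑ j, c j ^ 2 ≤ R₁ * ‖∑ j, c j • S j‖ ^ 2)
    (h₂ : ∀ i, ∀ u ∈ Submodule.span ℝ (Set.range S),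
      ‖u‖ ^ 2 ≤ R₂ * ∑ r, inner ℝ (Y' (i, r)) u ^ 2)
    (h₃ : ∀ c : Fin m × Fin nv → ℝ, ∀ y : Fin m × Fin n → ℝ,
      (∀ i r, y (i, r) = ∑ a, c (i, a) * inner ℝ (Y' (i, r)) (S (i, a))) →
        ∑ r, y r ^ 2 ≤ R₃ * ‖V.starProjection (∑ r, y r • Y r)‖ ^ 2)
    (c : Fin m × Fin nv → ℝ) :
    ∑ j, c j ^ 2 ≤ R₁ * R₂ * R₃ * (n / α) ^ 2 *
      ‖∑ j, c j • adaptOp α (fun r ↦ X (j.1, r)) (S j)‖ ^ 2 := by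
  have hn0 : (n : ℝ) ≠ 0 := by exact_mod_cast hn.ne'
  set u : Fin m → Vec p := fun i ↦ ∑ a, c (i, a) • S (i, a) with hu
  set y : Fin m × Fin n → ℝ := fun t ↦ inner ℝ (Y' t) (u t.1) with hy
  have hV (v : Vec p) (hv : v ∈ Vᗮ) : V.starProjection v = 0 := by
    rw [Submodule.starProjection_apply_eq_zero_iff]; exact hv
  have hXS (t) (j) : inner ℝ (X t) (S j) = inner ℝ (Y' t) (S j) := by
    rw [hX, inner_add_left, Submodule.inner_starProjection_left_eq_right, hV _ (hS j),
      Submodule.inner_starProjection_left_eq_right, Submodule.starProjection_eq_self_iff.2 (hS j)]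
    simp
  have hPX (t) : V.starProjection (X t) = V.starProjection (Y t) := by
    rw [hX, map_add, hV _ (Submodule.starProjection_apply_mem _ _), add_zero,
      Submodule.starProjection_eq_self_iff.2 (Submodule.starProjection_apply_mem _ _)]
  -- The component of the rows in `Vᗮ` is discarded, which is harmless for a lower bound on the norm
  -- but uses `α ≠ 0`.
  have hrow : V.starProjection (∑ j, c j • adaptOp α (fun r ↦ X (j.1, r)) (S j)) =
      -(α / n) • V.starProjection (∑ t, y t • Y t) := by
    simp only [map_sum, map_smul, adaptOp, map_sub, hV _ (hS _), hXS, hPX, Fintype.sum_prod_type,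
      hy, hu, inner_sum, inner_smul_right, zero_sub, Finset.smul_sum, Finset.sum_smul, smul_neg,
      neg_smul, Finset.sum_neg_distrib]
    congr 1
    refine Finset.sum_congr rfl fun i _ ↦ ?_
    rw [Finset.sum_comm]
    refine Finset.sum_congr rfl fun r _ ↦ Finset.sum_congr rfl fun a _ ↦ ?_
    simp only [smul_smul]
    congr 1
    ring
  have e₁ (i : Fin m) : ∑ a, c (i, a) ^ 2 ≤ R₁ * ‖u i‖ ^ 2 := by
    have := h₁ (fun j ↦ if j.1 = i then c j else 0)
    have h0 : (∑ j, (if j.1 = i then c j else 0) • S j) = u i := by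
      rw [Fintype.sum_prod_type, Finset.sum_eq_single i (by simp +contextual) (by simp)]
      simp [hu]
    rw [h0, Fintype.sum_prod_type, Finset.sum_eq_single i (by simp +contextual) (by simp)] at this
    simpa using this
  have e₂ (i : Fin m) : ‖u i‖ ^ 2 ≤ R₂ * ∑ r, y (i, r) ^ 2 :=
    h₂ i (u i) (Submodule.sum_mem _ fun a _ ↦ Submodule.smul_mem _ _
      (Submodule.subset_span ⟨_, rfl⟩))
  have e₃ := h₃ c y (fun i r ↦ by simp [hy, hu, inner_sum, inner_smul_right])
  have e₄ : ‖V.starProjection (∑ t, y t • Y t)‖ ^ 2 ≤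
      (n / α) ^ 2 * ‖∑ j, c j • adaptOp α (fun r ↦ X (j.1, r)) (S j)‖ ^ 2 := by
    have h := Submodule.norm_starProjection_apply_le V
      (∑ j, c j • adaptOp α (fun r ↦ X (j.1, r)) (S j))
    rw [hrow, norm_smul] at h
    have h' := pow_le_pow_left₀ (by positivity) h 2
    rw [mul_pow, norm_neg, Real.norm_eq_abs, sq_abs] at h'
    calc _ = (n / α) ^ 2 * ((α / n) ^ 2 * ‖V.starProjection (∑ t, y t • Y t)‖ ^ 2) := by
          field_simp
      _ ≤ _ := by gcongr
  calc ∑ j, c j ^ 2 = ∑ i, ∑ a, c (i, a) ^ 2 := Fintype.sum_prod_type _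
    _ ≤ ∑ i, R₁ * (R₂ * ∑ r, y (i, r) ^ 2) := by
        gcongr with i
        exact (e₁ i).trans (by gcongr; exact e₂ i)
    _ = R₁ * R₂ * ∑ t, y t ^ 2 := by
        rw [Fintype.sum_prod_type, ← Finset.mul_sum, ← Finset.mul_sum, mul_assoc]
    _ ≤ R₁ * R₂ * (R₃ * ((n / α) ^ 2 * ‖∑ j, c j • adaptOp α (fun r ↦ X (j.1, r)) (S j)‖ ^ 2)) := by
        gcongr
        exact e₃.trans (by gcongr)
    _ = _ := by ring

end

/-! ### Inverse bounds on subspaces, and the second moment of `gramInv` for the rows -/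

section

/-- The norm of the projection onto `V` is bounded below by Bessel's inequality for `8 * card ι * B`
orthonormal vectors of `V`, the number needed for `B` groups of eight blocks. -/
theorem exists_transpose_bound (ι : Type*) [Fintype ι] [DecidableEq ι] :
    ∃ C : NNReal, ∀ {τ : Type} [Fintype τ] (p B : ℕ), 0 < B →
      ∀ (W : Submodule ℝ (EuclideanSpace ℝ τ)) (V : Submodule ℝ (Vec p)),
      Module.finrank ℝ W ≤ Fintype.card ι → Fintype.card ι ≤ Fintype.card τ →
      8 * Fintype.card ι * B ≤ Module.finrank ℝ V →
      ∃ R : (τ → Vec p) → ℝ, Measurable R ∧ (∀ x, 0 ≤ R x) ∧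
        ∫⁻ x, ENNReal.ofReal (R x ^ 2) ∂(Measure.pi fun _ ↦ stdGaussian (Vec p)) ≤
          ENNReal.ofReal (C / B ^ 2) ∧
        ∀ᵐ x ∂(Measure.pi fun _ : τ ↦ stdGaussian (Vec p)), ∀ y ∈ W, ∑ r, y r ^ 2 ≤
          R x * ‖V.starProjection (∑ r, y r • x r)‖ ^ 2 := by
  obtain ⟨C, hC⟩ := exists_inverse_bound_transpose ι
  refine ⟨C, fun {τ} _ p B hB W V hW hτ hV ↦ ?_⟩
  obtain ⟨e, he, heW⟩ := exists_orthonormal_span_ge W (ι := ι) hW (by simpa using hτ)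
  obtain ⟨f, hf, hfV⟩ := exists_orthonormal_of_card_le V (κ := Fin B × Fin 8 × ι) (by
    simp only [Fintype.card_prod, Fintype.card_fin]
    refine le_trans (le_of_eq ?_) hV
    ring)
  obtain ⟨R, hRm, hR0, hRi, hR⟩ := hC p B hB e f he hf
  refine ⟨R, hRm, hR0, hRi, hR.mono fun x hx y hy ↦ ?_⟩
  obtain ⟨c, rfl⟩ := heW y hy
  have h1 : ∑ r, (∑ j, c j • e j) r ^ 2 = ∑ j, c j ^ 2 := by
    rw [← EuclideanSpace.real_norm_sq_eq, ← real_inner_self_eq_norm_sq, he.inner_sum]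
    simp [sq]
  rw [h1]
  refine (hx c).trans (mul_le_mul_of_nonneg_left ?_ (hR0 x))
  have := hf.sum_inner_products_le (V.starProjection (∑ r, (∑ j, c j • e j) r • x r))
    (s := Finset.univ)
  refine le_trans (le_of_eq (Finset.sum_congr rfl fun k _ ↦ ?_)) this
  rw [Real.norm_eq_abs, sq_abs, ← Submodule.inner_starProjection_left_eq_right,
    Submodule.starProjection_eq_self_iff.2 (hfV k), real_inner_comm]

theorem exists_row_bound (ι : Type*) [Fintype ι] [DecidableEq ι] :
    ∃ C : NNReal, ∀ {τ : Type} [Fintype τ] (p B : ℕ), 0 < B →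
      ∀ (e : Fin B × Fin 8 × ι → τ) (U : Submodule ℝ (Vec p)), Function.Injective e →
      Module.finrank ℝ U ≤ Fintype.card ι → Fintype.card ι ≤ p →
      ∃ R : (τ → Vec p) → ℝ, Measurable R ∧ (∀ x, 0 ≤ R x) ∧
        ∫⁻ x, ENNReal.ofReal (R x ^ 2) ∂(Measure.pi fun _ ↦ stdGaussian (Vec p)) ≤
          ENNReal.ofReal (C / B ^ 2) ∧
        ∀ᵐ x ∂(Measure.pi fun _ : τ ↦ stdGaussian (Vec p)), ∀ u ∈ U, ‖u‖ ^ 2 ≤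
          R x * ∑ k, inner ℝ (x (e k)) u ^ 2 := by
  obtain ⟨C, hC⟩ := exists_inverse_bound_rows ι
  refine ⟨C, fun {τ} _ p B hB e U he hU hp ↦ ?_⟩
  obtain ⟨f, hf, hfU⟩ := exists_orthonormal_span_ge U (ι := ι) hU (by simpa using hp)
  obtain ⟨R, hRm, hR0, hRi, hR⟩ := hC p B hB e f he hf
  refine ⟨R, hRm, hR0, hRi, hR.mono fun x hx u hu ↦ ?_⟩
  obtain ⟨c, rfl⟩ := hfU u hu
  have h1 : ‖∑ j, c j • f j‖ ^ 2 = ∑ j, c j ^ 2 := by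
    rw [← real_inner_self_eq_norm_sq, hf.inner_sum]
    simp [sq]
  rw [h1]
  exact hx c

theorem exists_family_bound (ι : Type) [Fintype ι] [DecidableEq ι] :
    ∃ C : NNReal, ∀ (p B : ℕ), 0 < B → 8 * Fintype.card ι * B ≤ p →
      ∃ R : (ι → Vec p) → ℝ, Measurable R ∧ (∀ x, 0 ≤ R x) ∧
        ∫⁻ x, ENNReal.ofReal (R x ^ 2) ∂(Measure.pi fun _ ↦ stdGaussian (Vec p)) ≤
          ENNReal.ofReal (C / B ^ 2) ∧
        ∀ᵐ x ∂(Measure.pi fun _ : ι ↦ stdGaussian (Vec p)), ∀ c : ι → ℝ, ∑ j, c j ^ 2 ≤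
          R x * ‖∑ j, c j • x j‖ ^ 2 := by
  obtain ⟨C, hC⟩ := exists_transpose_bound ι
  refine ⟨C, fun p B hB h ↦ ?_⟩
  obtain ⟨R, hRm, hR0, hRi, hR⟩ := hC (τ := ι) p B hB ⊤ ⊤ (by simp) le_rfl (by simpa using h)
  refine ⟨R, hRm, hR0, hRi, hR.mono fun x hx c ↦ ?_⟩
  have h' := hx (WithLp.toLp 2 c) trivial
  rwa [Submodule.starProjection_eq_self_iff.2 Submodule.mem_top] at h'

variable {m n nv p : ℕ}

theorem measurable_gramInv_adaptOp (α : ℝ) :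
    Measurable (fun x : (Fin m × Fin nv → Vec p) × (Fin m × Fin n → Vec p) ↦
      gramInv fun j ↦ adaptOp α (fun r ↦ x.2 (j.1, r)) (x.1 j)) := by
  refine measurable_gramInv.comp (measurable_pi_lambda _ fun j ↦ Continuous.measurable ?_)
  unfold adaptOp
  fun_prop

/-- The validation inputs are frozen and the training inputs are split along their span `U` and its
complement, two independent parts. With the part in `U` frozen as well, the last inverse bound is
integrated over the part in `Uᗮ`, and the middle one afterwards. The two second moments are of order
`B⁻²` each, and the factor `(n / α) ^ 2` contributes `n ^ 4`. -/
theorem exists_lintegral_gramInv_le_of_family (m nv : ℕ) (α : ℝ) (hα : α ≠ 0) :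
    ∃ C : NNReal, ∀ n p B : ℕ, 0 < B → 8 * (m * nv) * B + m * nv ≤ p → 8 * (m * nv) * B ≤ n →
      0 < n → ∀ (S : Fin m × Fin nv → Vec p) (R₁ : ℝ), 0 ≤ R₁ →
      (∀ c : Fin m × Fin nv → ℝ, ∑ j, c j ^ 2 ≤ R₁ * ‖∑ j, c j • S j‖ ^ 2) →
      ∫⁻ X : Fin m × Fin n → Vec p,
        gramInv (fun j ↦ adaptOp α (fun r ↦ X (j.1, r)) (S j)) ^ 2
          ∂(Measure.pi fun _ ↦ stdGaussian (Vec p)) ≤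
        ENNReal.ofReal (R₁ ^ 2) * ENNReal.ofReal (C * n ^ 4 / B ^ 4) := by
  obtain ⟨C₂, hC₂⟩ := exists_row_bound (Fin m × Fin nv)
  obtain ⟨C₃, hC₃⟩ := exists_transpose_bound (Fin m × Fin nv)
  refine ⟨C₃ * (m * (m * C₂)) * (‖α⁻¹‖₊) ^ 4, fun n p B hB hp hn hn0 S R₁ hR₁ h₁ ↦ ?_⟩
  set U := Submodule.span ℝ (Set.range S) with hU
  have hcard : Fintype.card (Fin m × Fin nv) = m * nv := by simp
  have hUd : Module.finrank ℝ U ≤ m * nv := hcard ▸ finrank_range_le_card S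
  have hVd : 8 * (m * nv) * B ≤ Module.finrank ℝ Uᗮ := by
    have := U.finrank_add_finrank_orthogonal
    rw [finrank_euclideanSpace_fin] at this
    omega
  have hJn : Fintype.card (Fin B × Fin 8 × (Fin m × Fin nv)) ≤ Fintype.card (Fin n) := by
    simp only [Fintype.card_prod, Fintype.card_fin]
    refine le_trans (le_of_eq ?_) hn
    ring
  obtain ⟨ε⟩ := Function.Embedding.nonempty_of_card_le hJn
  have hJp : Fintype.card (Fin m × Fin nv) ≤ p := by rw [hcard]; omega
  have hJτ : Fintype.card (Fin m × Fin nv) ≤ Fintype.card (Fin m × Fin n) := by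
    simp only [Fintype.card_prod, Fintype.card_fin]
    rcases Nat.eq_zero_or_pos m with rfl | hm
    · simp
    · have : nv ≤ m * nv := Nat.le_mul_of_pos_left _ hm
      have : m * nv ≤ 8 * (m * nv) * B := by nlinarith
      exact Nat.mul_le_mul_left _ (by omega)
  choose R₂ hR₂m hR₂0 hR₂i hR₂ using fun i : Fin m ↦ hC₂ (τ := Fin m × Fin n) p B hB
    (fun k ↦ (i, ε k)) U (fun k k' h ↦ ε.injective (Prod.ext_iff.1 h).2) (hcard ▸ hUd) hJp
  rw [← ae_all_iff] at hR₂
  set F : (Fin m × Fin n → Vec p) → ENNReal :=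
    fun X ↦ gramInv (fun j ↦ adaptOp α (fun r ↦ X (j.1, r)) (S j)) ^ 2 with hF
  have hFm : Measurable F :=
    ((measurable_gramInv_adaptOp α).comp measurable_prodMk_left).pow_const 2
  have hmp := measurePreserving_split (τ := Fin m × Fin n) Uᗮ
  have hFm' := (hFm.comp hmp.measurable).aemeasurable (μ :=
    (Measure.pi fun _ : Fin m × Fin n ↦ stdGaussian (Vec p)).prod
      (Measure.pi fun _ : Fin m × Fin n ↦ stdGaussian (Vec p)))
  have hlp := lintegral_prod_symm _ hFm'
  simp only [Function.comp_apply] at hlp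
  rw [← hmp.lintegral_comp hFm, hlp]
  have key : ∀ᵐ Y' ∂(Measure.pi fun _ : Fin m × Fin n ↦ stdGaussian (Vec p)),
      ∫⁻ Y, F (fun r ↦ Uᗮ.starProjection (Y r) + Uᗮᗮ.starProjection (Y' r))
        ∂(Measure.pi fun _ : Fin m × Fin n ↦ stdGaussian (Vec p)) ≤
      ENNReal.ofReal (R₁ ^ 2) * ENNReal.ofReal ((n / α) ^ 4) * ENNReal.ofReal (C₃ / B ^ 2) *
        (m * ∑ i, ENNReal.ofReal (R₂ i Y' ^ 2)) := by
    filter_upwards [hR₂] with Y' hY'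
    -- Once `Y'` is fixed, the weights `y` range over the image of `Q`, a fixed space of dimension
    -- at most `m * nv`; this is the subspace on which the transpose is inverted.
    let Q : (Fin m × Fin nv → ℝ) →ₗ[ℝ] EuclideanSpace ℝ (Fin m × Fin n) :=
      { toFun := fun c ↦ WithLp.toLp 2 fun t ↦ ∑ a, c (t.1, a) * inner ℝ (Y' t) (S (t.1, a))
        map_add' := fun c d ↦ by
          ext t
          simp [add_mul, Finset.sum_add_distrib]
        map_smul' := fun c d ↦ by
          ext t
          simp [mul_assoc, Finset.mul_sum] }
    obtain ⟨R₃, hR₃m, hR₃0, hR₃i, hR₃⟩ := hC₃ (τ := Fin m × Fin n) p B hB Q.range Uᗮ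
      ((LinearMap.finrank_range_le Q).trans (by simp)) hJτ (by rwa [hcard])
    -- A single constant valid for all tasks; the sum is used instead of the maximum at the cost of
    -- a factor `m` in the second moment.
    set ρ := ∑ i, R₂ i Y' with hρ
    have hρ0 : 0 ≤ ρ := Finset.sum_nonneg fun i _ ↦ hR₂0 i Y'
    calc ∫⁻ Y, F (fun r ↦ Uᗮ.starProjection (Y r) + Uᗮᗮ.starProjection (Y' r))
        ∂(Measure.pi fun _ : Fin m × Fin n ↦ stdGaussian (Vec p))
        ≤ ∫⁻ Y, ENNReal.ofReal ((R₁ * ρ * (n / α) ^ 2) ^ 2) * ENNReal.ofReal (R₃ Y ^ 2)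
          ∂(Measure.pi fun _ : Fin m × Fin n ↦ stdGaussian (Vec p)) := by
          refine lintegral_mono_ae (hR₃.mono fun Y hY ↦ ?_)
          rw [← ENNReal.ofReal_mul (by positivity)]
          have hR₃Y := hR₃0 Y
          have := gramInv_le (R := R₁ * ρ * R₃ Y * (n / α) ^ 2) (by positivity)
            (sum_sq_le_of_chain α hα hn0 S Uᗮ (fun j ↦ ?_) Y Y' _ (fun _ ↦ rfl) hR₁ hρ0
              hR₃Y h₁ (fun i u hu ↦ ?_) (fun c y hy ↦ ?_))
          · calc _ ≤ ENNReal.ofReal (R₁ * ρ * R₃ Y * (n / α) ^ 2) ^ 2 := pow_le_pow_left' this 2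
              _ = _ := by
                rw [← ENNReal.ofReal_pow (by positivity)]
                congr 1
                ring
          · exact Submodule.le_orthogonal_orthogonal _ (Submodule.subset_span ⟨j, rfl⟩)
          · refine (hY' i u hu).trans ?_
            refine mul_le_mul (Finset.single_le_sum (f := fun i ↦ R₂ i Y')
              (fun i _ ↦ hR₂0 i Y') (Finset.mem_univ i)) ?_
              (Finset.sum_nonneg fun _ _ ↦ sq_nonneg _) hρ0
            rw [← Finset.sum_map Finset.univ ε (fun r ↦ inner ℝ (Y' (i, r)) u ^ 2)]
            exact Finset.sum_le_sum_of_subset_of_nonneg (Finset.subset_univ _)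
              fun _ _ _ ↦ sq_nonneg _
          · have hyQ : WithLp.toLp 2 y ∈ Q.range := by
              refine ⟨c, ?_⟩
              ext t
              exact (hy t.1 t.2).symm
            simpa using hY _ hyQ
      _ ≤ ENNReal.ofReal ((R₁ * ρ * (n / α) ^ 2) ^ 2) * ENNReal.ofReal (C₃ / B ^ 2) := by
          rw [lintegral_const_mul _ (by fun_prop)]
          gcongr
      _ ≤ _ := by
          have h2 : (R₁ * ρ * (n / α) ^ 2) ^ 2 ≤
              R₁ ^ 2 * (n / α) ^ 4 * (m * ∑ i, R₂ i Y' ^ 2) := by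
            have h3 : ρ ^ 2 ≤ m * ∑ i, R₂ i Y' ^ 2 := by
              simpa using sq_sum_le_card_mul_sum_sq (s := Finset.univ) (f := fun i ↦ R₂ i Y')
            calc _ = R₁ ^ 2 * (n / α) ^ 4 * ρ ^ 2 := by ring
              _ ≤ _ := by gcongr
          refine (mul_le_mul_left (ENNReal.ofReal_le_ofReal h2) _).trans (le_of_eq ?_)
          rw [ENNReal.ofReal_mul (by positivity), ENNReal.ofReal_mul (by positivity),
            ENNReal.ofReal_mul (by positivity), ENNReal.ofReal_natCast,
            ENNReal.ofReal_sum_of_nonneg fun _ _ ↦ sq_nonneg _]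
          ring
  refine (lintegral_mono_ae key).trans ?_
  rw [lintegral_const_mul _ (by fun_prop), lintegral_const_mul _ (by fun_prop),
    lintegral_finsetSum _ (by fun_prop)]
  calc _ ≤ ENNReal.ofReal (R₁ ^ 2) * ENNReal.ofReal ((n / α) ^ 4) * ENNReal.ofReal (C₃ / B ^ 2) *
        (m * ∑ _i : Fin m, ENNReal.ofReal (C₂ / B ^ 2)) := by
        gcongr with i
        exact hR₂i i
    _ = _ := by
        rw [Finset.sum_const, Finset.card_univ, Fintype.card_fin, nsmul_eq_mul, mul_assoc,
          mul_assoc]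
        congr 1
        rw [← ENNReal.ofReal_natCast, ← ENNReal.ofReal_mul (by positivity),
          ← ENNReal.ofReal_mul (by positivity), ← ENNReal.ofReal_mul (by positivity),
          ← ENNReal.ofReal_mul (by positivity)]
        congr 1
        have : |α| ^ 4 = α ^ 4 := by rw [← abs_pow, abs_of_nonneg (by positivity)]
        simp only [NNReal.coe_mul, NNReal.coe_natCast, NNReal.coe_pow, coe_nnnorm, norm_inv,
          Real.norm_eq_abs, inv_pow, this]
        field_simp

/-- Rearrangement of the inputs of all the tasks. -/
def groupInputs (x : (Fin m × Fin nv → Vec p) × (Fin m × Fin n → Vec p)) : Inputs m n nv p :=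
  fun i ↦ (fun r ↦ x.2 (i, r), fun a ↦ x.1 (i, a))

theorem measurePreserving_groupInputs :
    MeasurePreserving (groupInputs (m := m) (n := n) (nv := nv) (p := p))
      ((Measure.pi fun _ ↦ stdGaussian (Vec p)).prod (Measure.pi fun _ ↦ stdGaussian (Vec p)))
      (inputsLaw m n nv p) := by
  have h₁ := (measurePreserving_curry (A := Fin m) (K := Fin n) (stdGaussian (Vec p))).prod
    (measurePreserving_curry (A := Fin m) (K := Fin nv) (stdGaussian (Vec p)))
  have h₂ := (measurePreserving_arrowProdEquivProdArrow (Fin n → Vec p) (Fin nv → Vec p) (Fin m)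
    (fun _ ↦ inputLaw n p) (fun _ ↦ inputLaw nv p)).symm
  exact (h₂.comp h₁).comp Measure.measurePreserving_swap

theorem measurable_gramInv_row (α : ℝ) :
    Measurable (fun I : Inputs m n nv p ↦ gramInv (row α I)) :=
  measurable_gramInv.comp (measurable_pi_lambda _ fun j ↦
    (PolyGrowth.row α PolyGrowth.id j).continuous.measurable)

/-- Integration over the validation inputs contributes the remaining factor `B⁻²`. With `n` and `B`
of order `p` the bound is of order `p⁻²`. -/
theorem exists_lintegral_gramInv_row_le_of_ne_zero (m nv : ℕ) (α : ℝ) (hα : α ≠ 0) :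
    ∃ C : NNReal, ∀ n p B : ℕ, 0 < B → 8 * (m * nv) * B + m * nv ≤ p → 8 * (m * nv) * B ≤ n →
      0 < n → ∫⁻ I, gramInv (row α I) ^ 2 ∂inputsLaw m n nv p ≤
        ENNReal.ofReal (C * n ^ 4 / B ^ 6) := by
  obtain ⟨C₁, hC₁⟩ := exists_family_bound (Fin m × Fin nv)
  obtain ⟨C, hC⟩ := exists_lintegral_gramInv_le_of_family m nv α hα
  refine ⟨C₁ * C, fun n p B hB hp hn hn0 ↦ ?_⟩
  obtain ⟨R, hRm, hR0, hRi, hR⟩ := hC₁ p B hB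
    (by simp only [Fintype.card_prod, Fintype.card_fin]; omega)
  have hm := ((measurable_gramInv_adaptOp (m := m) (n := n) (nv := nv) (p := p) α).pow_const 2)
  rw [← measurePreserving_groupInputs.lintegral_comp ((measurable_gramInv_row _).pow_const 2)]
  calc _ = ∫⁻ x : (Fin m × Fin nv → Vec p) × (Fin m × Fin n → Vec p),
        gramInv (fun j ↦ adaptOp α (fun r ↦ x.2 (j.1, r)) (x.1 j)) ^ 2
        ∂((Measure.pi fun _ ↦ stdGaussian (Vec p)).prod
          (Measure.pi fun _ ↦ stdGaussian (Vec p))) := rfl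
    _ ≤ ∫⁻ S : Fin m × Fin nv → Vec p, ENNReal.ofReal (R S ^ 2) *
        ENNReal.ofReal (C * n ^ 4 / B ^ 4) ∂(Measure.pi fun _ ↦ stdGaussian (Vec p)) := by
        rw [lintegral_prod _ hm.aemeasurable]
        exact lintegral_mono_ae (hR.mono fun S hS ↦ hC n p B hB hp hn hn0 S (R S) (hR0 S) hS)
    _ ≤ ENNReal.ofReal (C₁ / B ^ 2) * ENNReal.ofReal (C * n ^ 4 / B ^ 4) := by
        rw [lintegral_mul_const _ (by fun_prop)]
        gcongr
    _ = _ := by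
        rw [← ENNReal.ofReal_mul (by positivity)]
        congr 1
        simp only [NNReal.coe_mul]
        field_simp

/-- Without inner adaptation the rows are the validation inputs themselves and a single inverse
bound suffices. -/
theorem exists_lintegral_gramInv_row_zero_le (m nv : ℕ) :
    ∃ C : NNReal, ∀ n p B : ℕ, 0 < B → 8 * (m * nv) * B ≤ p →
      ∫⁻ I, gramInv (row 0 I) ^ 2 ∂inputsLaw m n nv p ≤ ENNReal.ofReal (C / B ^ 2) := by
  obtain ⟨C, hC⟩ := exists_family_bound (Fin m × Fin nv)
  refine ⟨C, fun n p B hB hp ↦ ?_⟩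
  obtain ⟨R, hRm, hR0, hRi, hR⟩ := hC p B hB
    (by simpa only [Fintype.card_prod, Fintype.card_fin] using hp)
  have hm := ((measurable_gramInv_adaptOp (m := m) (n := n) (nv := nv) (p := p) 0).pow_const 2)
  rw [← measurePreserving_groupInputs.lintegral_comp ((measurable_gramInv_row _).pow_const 2)]
  calc _ = ∫⁻ x : (Fin m × Fin nv → Vec p) × (Fin m × Fin n → Vec p),
        gramInv (fun j ↦ adaptOp 0 (fun r ↦ x.2 (j.1, r)) (x.1 j)) ^ 2
        ∂((Measure.pi fun _ ↦ stdGaussian (Vec p)).prod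
          (Measure.pi fun _ ↦ stdGaussian (Vec p))) := rfl
    _ ≤ ∫⁻ S : Fin m × Fin nv → Vec p, ENNReal.ofReal (R S ^ 2)
        ∂(Measure.pi fun _ ↦ stdGaussian (Vec p)) := by
        rw [lintegral_prod _ hm.aemeasurable]
        refine lintegral_mono_ae (hR.mono fun S hS ↦ ?_)
        simp only [adaptOp, zero_div, zero_smul, sub_zero, lintegral_const, measure_univ, mul_one]
        rw [ENNReal.ofReal_pow (hR0 S)]
        exact pow_le_pow_left' (gramInv_le (hR0 S) hS) 2
    _ ≤ _ := hRi

/-- Negative moment of the Gram matrix of the meta-training problem. -/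
theorem exists_lintegral_gramInv_row_le (m nv : ℕ) (α K : ℝ) :
    ∃ C : NNReal, ∃ p₀ : ℕ, ∀ n p : ℕ, p₀ ≤ p → p₀ ≤ n → (p : ℝ) ≤ K * n → (n : ℝ) ≤ K * p →
      ∫⁻ I, gramInv (row α I) ^ 2 ∂inputsLaw m n nv p ≤ ENNReal.ofReal (C / p ^ 2) := by
  set K' := max K 1 with hK'
  have hK1 : 1 ≤ K' := le_max_right _ _
  set M := 9 * (m * nv) + 1 with hM
  have hM0 : (0 : ℝ) < M := by positivity
  -- Take `B = ⌊min p n / M⌋`. The choice `M = 9 m nv + 1` gives `8 m nv B + m nv ≤ M B` because `B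
  -- ≥ 1`, and `min p n < M (B + 1) ≤ 2 M B` shows that `B` is of order `p`.
  have main : ∀ n p : ℕ, M ≤ p → M ≤ n → (p : ℝ) ≤ K * n → (n : ℝ) ≤ K * p →
      ∃ B : ℕ, 0 < B ∧ 8 * (m * nv) * B + m * nv ≤ p ∧ 8 * (m * nv) * B ≤ n ∧ 0 < n ∧
        (p : ℝ) ≤ 2 * M * K' * B ∧ (n : ℝ) ≤ K' * p := by
    intro n p hp hn hpn hnp
    have hB : 0 < min p n / M := Nat.div_pos (le_min hp hn) (by omega)
    have h₁ : M * (min p n / M) ≤ min p n := Nat.mul_div_le _ _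
    have h₂ : min p n < M * (min p n / M + 1) := Nat.lt_mul_div_succ _ (by omega)
    set B := min p n / M
    have h₃ : 8 * (m * nv) * B + m * nv ≤ M * B := by
      rw [hM]
      nlinarith
    have h₄ : (min p n : ℕ) ≤ 2 * M * B := by nlinarith
    have h₅ : (min (p : ℝ) n) ≤ 2 * M * B := by exact_mod_cast h₄
    have h₆ : (p : ℝ) ≤ K' * min (p : ℝ) n := by
      rcases min_cases (p : ℝ) n with h | h
      · rw [h.1]
        nlinarith [Nat.cast_nonneg (α := ℝ) p]
      · rw [h.1]
        exact hpn.trans (by gcongr; exact le_max_left _ _)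
    refine ⟨B, hB, (h₃.trans h₁).trans (min_le_left _ _),
      ((by omega : _ ≤ M * B).trans h₁).trans (min_le_right _ _), by omega, ?_,
      hnp.trans (by gcongr; exact le_max_left _ _)⟩
    calc (p : ℝ) ≤ K' * (2 * M * B) := h₆.trans (by gcongr)
      _ = _ := by ring
  rcases eq_or_ne α 0 with rfl | hα
  · obtain ⟨C, hC⟩ := exists_lintegral_gramInv_row_zero_le m nv
    refine ⟨C * (2 * M * K'.toNNReal) ^ 2, M, fun n p hp hn hpn hnp ↦ ?_⟩
    obtain ⟨B, hB, h₁, -, -, h₂, -⟩ := main n p hp hn hpn hnp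
    have hp0 : (0 : ℝ) < p := by
      exact_mod_cast (by omega : 0 < p)
    refine (hC n p B hB (by omega)).trans (ENNReal.ofReal_le_ofReal ?_)
    rw [div_le_div_iff₀ (by positivity) (by positivity)]
    simp only [NNReal.coe_mul, NNReal.coe_pow, NNReal.coe_natCast, NNReal.coe_ofNat,
      Real.coe_toNNReal K' (by linarith)]
    calc (C : ℝ) * p ^ 2 ≤ C * (2 * M * K' * B) ^ 2 := by gcongr
      _ = _ := by ring
  · obtain ⟨C, hC⟩ := exists_lintegral_gramInv_row_le_of_ne_zero m nv α hα
    refine ⟨C * K'.toNNReal ^ 4 * (2 * M * K'.toNNReal) ^ 6, M, fun n p hp hn hpn hnp ↦ ?_⟩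
    obtain ⟨B, hB, h₁, h₂, hn0, h₃, h₄⟩ := main n p hp hn hpn hnp
    have hp0 : (0 : ℝ) < p := by
      exact_mod_cast (by omega : 0 < p)
    refine (hC n p B hB h₁ h₂ hn0).trans (ENNReal.ofReal_le_ofReal ?_)
    rw [div_le_div_iff₀ (by positivity) (by positivity)]
    simp only [NNReal.coe_mul, NNReal.coe_pow, NNReal.coe_natCast, NNReal.coe_ofNat,
      Real.coe_toNNReal K' (by linarith)]
    calc (C : ℝ) * n ^ 4 * p ^ 2 ≤ C * (K' * p) ^ 4 * p ^ 2 := by gcongr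
      _ = C * K' ^ 4 * p ^ 6 := by ring
      _ ≤ C * K' ^ 4 * (2 * M * K' * B) ^ 6 := by gcongr
      _ = _ := by ring

end

section

/-! ### Minimum-distance solution of a linear system -/

section GramSolve

variable {ι E : Type*} [Fintype ι] [NormedAddCommGroup E] [InnerProductSpace ℝ E]

theorem gram_mulVec_apply (b : ι → E) (c : ι → ℝ) (k : ι) :
    (Matrix.gram ℝ b).mulVec c k = inner ℝ (b k) (∑ j, c j • b j) := by
  simp [Matrix.mulVec, dotProduct, Matrix.gram_apply, inner_sum, inner_smul_right, mul_comm]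

variable [DecidableEq ι]

/-- The combination `v` of the family `b` with `⟪b k, v⟫ = s k` for all `k`. -/
def gramSolve (b : ι → E) (s : ι → ℝ) : E :=
  ∑ j, ((Matrix.gram ℝ b)⁻¹.mulVec s) j • b j

theorem isUnit_gram {b : ι → E} (hb : gramInv b ≠ ⊤) : IsUnit (Matrix.gram ℝ b) := by
  rw [← Matrix.mulVec_injective_iff_isUnit]
  have h0 (c : ι → ℝ) (hc : (Matrix.gram ℝ b).mulVec c = 0) : c = 0 := by
    have h1 : ‖∑ j, c j • b j‖ ^ 2 = 0 := by
      rw [← real_inner_self_eq_norm_sq]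
      rw [sum_inner]
      refine Finset.sum_eq_zero fun j _ ↦ ?_
      rw [inner_smul_left, ← gram_mulVec_apply, hc]
      simp
    have h2 := sum_sq_le_gramInv hb c
    rw [h1, mul_zero] at h2
    have h3 := (Finset.sum_eq_zero_iff_of_nonneg fun j _ ↦ sq_nonneg (c j)).1
      (le_antisymm h2 (Finset.sum_nonneg fun _ _ ↦ sq_nonneg _))
    funext j
    simpa using h3 j (Finset.mem_univ j)
  intro c d h
  have := h0 (c - d) (by rw [Matrix.mulVec_sub, h, sub_self])
  exact sub_eq_zero.1 this

theorem inner_gramSolve {b : ι → E} (hb : gramInv b ≠ ⊤) (s : ι → ℝ) (k : ι) :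
    inner ℝ (b k) (gramSolve b s) = s k := by
  have hu := (Matrix.isUnit_iff_isUnit_det _).1 (isUnit_gram hb)
  rw [gramSolve, ← gram_mulVec_apply, Matrix.mulVec_mulVec, Matrix.mul_nonsing_inv _ hu,
    Matrix.one_mulVec]

theorem gramSolve_sub (b : ι → E) (s t : ι → ℝ) :
    gramSolve b (s - t) = gramSolve b s - gramSolve b t := by
  simp [gramSolve, Matrix.mulVec_sub, sub_smul, Finset.sum_sub_distrib]

theorem inner_gramSolve_left {b : ι → E} (v : E) (s : ι → ℝ) :
    inner ℝ (gramSolve b s) v = ∑ j, ((Matrix.gram ℝ b)⁻¹.mulVec s) j * inner ℝ (b j) v := by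
  simp [gramSolve, sum_inner, inner_smul_left]

theorem inner_gramSolve_gramSolve {b : ι → E} (hb : gramInv b ≠ ⊤) (s t : ι → ℝ) :
    inner ℝ (gramSolve b s) (gramSolve b t) =
      ∑ j, ∑ k, (Matrix.gram ℝ b)⁻¹ j k * (s k * t j) := by
  rw [inner_gramSolve_left]
  refine Finset.sum_congr rfl fun j _ ↦ ?_
  rw [inner_gramSolve hb, Matrix.mulVec, dotProduct, Finset.sum_mul]
  exact Finset.sum_congr rfl fun k _ ↦ by ring

/-- If `c` are the coefficients of the solution `v`, then `‖v‖² = ⟨c, s⟩` and `‖c‖² ≤ gramInv *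
‖v‖²`; Cauchy-Schwarz then allows one factor `‖v‖²` to be cancelled. -/
theorem norm_gramSolve_sq_le {b : ι → E} (hb : gramInv b ≠ ⊤) (s : ι → ℝ) :
    ‖gramSolve b s‖ ^ 2 ≤ (gramInv b).toReal * ∑ j, s j ^ 2 := by
  set ρ := (gramInv b).toReal with hρ
  have hρ0 : 0 ≤ ρ := ENNReal.toReal_nonneg
  set c := (Matrix.gram ℝ b)⁻¹.mulVec s with hc
  have h1 : ‖gramSolve b s‖ ^ 2 = ∑ j, c j * s j := by
    rw [← real_inner_self_eq_norm_sq, inner_gramSolve_left]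
    simp_rw [inner_gramSolve hb]
    rfl
  have h2 : ∑ j, c j ^ 2 ≤ ρ * ‖gramSolve b s‖ ^ 2 := sum_sq_le_gramInv hb c
  have h3 : (∑ j, c j * s j) ^ 2 ≤ (∑ j, c j ^ 2) * ∑ j, s j ^ 2 :=
    Finset.sum_mul_sq_le_sq_mul_sq _ _ _
  set q := ‖gramSolve b s‖ ^ 2
  have hq : 0 ≤ q := sq_nonneg _
  have hs : 0 ≤ ∑ j, s j ^ 2 := Finset.sum_nonneg fun _ _ ↦ sq_nonneg _
  rw [← h1] at h3
  rcases hq.eq_or_lt with h | h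
  · rw [← h]
    positivity
  · refine le_of_mul_le_mul_left ?_ h
    calc q * q ≤ (∑ j, c j ^ 2) * ∑ j, s j ^ 2 := by rw [← sq]; exact h3
      _ ≤ ρ * q * ∑ j, s j ^ 2 := by gcongr
      _ = _ := by ring

/-- The entries of the inverse Gram matrix are inner products of the solutions for the coordinate
right-hand sides. -/
theorem abs_inv_gram_le {b : ι → E} (hb : gramInv b ≠ ⊤) (j k : ι) :
    |(Matrix.gram ℝ b)⁻¹ j k| ≤ (gramInv b).toReal := by
  have h1 : (Matrix.gram ℝ b)⁻¹ j k =
      inner ℝ (gramSolve b (Pi.single k 1)) (gramSolve b (Pi.single j 1)) := by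
    rw [inner_gramSolve_gramSolve hb, Finset.sum_eq_single j, Finset.sum_eq_single k] <;>
      simp +contextual [Pi.single_apply]
  have h2 (i : ι) : ‖gramSolve b (Pi.single i 1)‖ ^ 2 ≤ (gramInv b).toReal := by
    simpa [Pi.single_apply, ite_pow] using norm_gramSolve_sq_le hb (Pi.single i 1)
  rw [h1]
  refine (abs_real_inner_le_norm _ _).trans ?_
  nlinarith [h2 j, h2 k, sq_nonneg (‖gramSolve b (Pi.single k 1)‖ -
    ‖gramSolve b (Pi.single j 1)‖)]

/-- Distance of the solution nearest to the initial point `w + u`, from the point `w`. -/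
theorem norm_add_gramSolve_sub_sq {b : ι → E} (hb : gramInv b ≠ ⊤) (u : E) (s : ι → ℝ) :
    ‖u + gramSolve b (fun j ↦ s j - inner ℝ (b j) u)‖ ^ 2 =
      ‖u‖ ^ 2 - ‖gramSolve b (fun j ↦ inner ℝ (b j) u)‖ ^ 2 + ‖gramSolve b s‖ ^ 2 := by
  set t : ι → ℝ := fun j ↦ inner ℝ (b j) u with ht
  have h1 : u + gramSolve b (fun j ↦ s j - inner ℝ (b j) u) =
      u - gramSolve b t + gramSolve b s := by
    have : (fun j ↦ s j - inner ℝ (b j) u) = s - t := rfl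
    rw [this, gramSolve_sub]
    abel
  -- `gramSolve b t` is the orthogonal projection of `u` onto the span of `b`, so `u - gramSolve b
  -- t` is orthogonal to every solution and Pythagoras applies twice.
  have h2 (s' : ι → ℝ) : inner ℝ (gramSolve b s') (u - gramSolve b t) = 0 := by
    rw [inner_gramSolve_left]
    refine Finset.sum_eq_zero fun j _ ↦ ?_
    rw [inner_sub_right, inner_gramSolve hb, ht]
    simp
  have h3 : ‖u‖ ^ 2 = ‖u - gramSolve b t‖ ^ 2 + ‖gramSolve b t‖ ^ 2 := by
    have := norm_add_sq_real (u - gramSolve b t) (gramSolve b t)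
    rw [real_inner_comm, h2, sub_add_cancel] at this
    linarith
  rw [h1, norm_add_sq_real, real_inner_comm, h2, h3]
  ring

end GramSolve

/-! ### Convergence of gradient descent on a consistent least-squares problem -/

section GradientDescent

variable {ι E : Type*} [Fintype ι] [NormedAddCommGroup E] [InnerProductSpace ℝ E]

/-- With `q = ∑ ⟪b j, e⟫²`, a small step decreases `‖e‖²` by at least `c * q`, and on the span of
the rows `q` dominates `‖e‖²` up to the factor `gramInv`. The `+ 1` keeps the denominator positive
when `gramInv` vanishes. -/
theorem norm_sq_gradientStep_le {b : ι → E} (hb : gramInv b ≠ ⊤) {c : ℝ} (hc : 0 ≤ c)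
    (hc1 : c * ∑ j, ‖b j‖ ^ 2 ≤ 1) (d : ι → ℝ) (e : E) (he : e = ∑ j, d j • b j) :
    ‖e - c • ∑ j, (inner ℝ (b j) e : ℝ) • b j‖ ^ 2 ≤
      (1 - c / ((gramInv b).toReal + 1)) * ‖e‖ ^ 2 := by
  set ρ := (gramInv b).toReal with hρ
  have hρ0 : 0 ≤ ρ := ENNReal.toReal_nonneg
  set s : ι → ℝ := fun j ↦ inner ℝ (b j) e with hs
  set M := ∑ j, ‖b j‖ ^ 2 with hM
  set q := ∑ j, s j ^ 2 with hq
  have hq0 : 0 ≤ q := Finset.sum_nonneg fun _ _ ↦ sq_nonneg _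
  have h1 : ‖∑ j, s j • b j‖ ^ 2 ≤ M * q := by
    have : ‖∑ j, s j • b j‖ ≤ ∑ j, ‖b j‖ * |s j| := (norm_sum_le _ _).trans
      (le_of_eq (Finset.sum_congr rfl fun j _ ↦ by rw [norm_smul, Real.norm_eq_abs, mul_comm]))
    calc ‖∑ j, s j • b j‖ ^ 2 ≤ (∑ j, ‖b j‖ * |s j|) ^ 2 := by gcongr
      _ ≤ M * ∑ j, |s j| ^ 2 := Finset.sum_mul_sq_le_sq_mul_sq _ _ _
      _ = M * q := by simp_rw [sq_abs]; rfl
  have h2 : inner ℝ e (∑ j, s j • b j) = q := by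
    rw [inner_sum]
    refine Finset.sum_congr rfl fun j _ ↦ ?_
    rw [inner_smul_right, real_inner_comm, sq]
  have h3 : ‖e‖ ^ 2 ≤ (ρ + 1) * q := by
    have h4 : ‖e‖ ^ 2 = ∑ j, d j * s j := by
      rw [← real_inner_self_eq_norm_sq]
      nth_rewrite 1 [he]
      simp [sum_inner, inner_smul_left, hs]
    have h5 : (∑ j, d j * s j) ^ 2 ≤ (∑ j, d j ^ 2) * q := Finset.sum_mul_sq_le_sq_mul_sq _ _ _
    have h6 : ∑ j, d j ^ 2 ≤ ρ * ‖e‖ ^ 2 := by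
      rw [he]
      exact sum_sq_le_gramInv hb d
    rw [← h4] at h5
    rcases (sq_nonneg ‖e‖).eq_or_lt with h | h
    · rw [← h]
      positivity
    · refine le_of_mul_le_mul_left ?_ h
      calc ‖e‖ ^ 2 * ‖e‖ ^ 2 ≤ (∑ j, d j ^ 2) * q := by rw [← sq]; exact h5
        _ ≤ ρ * ‖e‖ ^ 2 * q := by gcongr
        _ ≤ ‖e‖ ^ 2 * ((ρ + 1) * q) := by nlinarith [mul_nonneg h.le hq0]
  have h7 : c / (ρ + 1) * ‖e‖ ^ 2 ≤ c * q := by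
    rw [div_mul_eq_mul_div, div_le_iff₀ (by positivity)]
    nlinarith
  rw [norm_sub_sq_real, inner_smul_right, h2, norm_smul, mul_pow, Real.norm_eq_abs, sq_abs]
  have h8 : c ^ 2 * ‖∑ j, s j • b j‖ ^ 2 ≤ c * q := by
    calc c ^ 2 * ‖∑ j, s j • b j‖ ^ 2 ≤ c ^ 2 * (M * q) := by gcongr
      _ = (c * M) * (c * q) := by ring
      _ ≤ 1 * (c * q) := by gcongr
      _ = _ := one_mul _
  linarith

/-- Each step adds a combination of the rows, so the error never leaves their span, where the step
is a contraction. Hence the limit is the one solution in `ω₀` plus the span. -/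
theorem tendsto_gradientDescent {b : ι → E} (hb : gramInv b ≠ ⊤) {c : ℝ} (hc : 0 < c)
    (hc1 : c * ∑ j, ‖b j‖ ^ 2 ≤ 1) (hc2 : c ≤ 1) (ω₀ : E) (d : ι → ℝ) :
    Tendsto (fun k : ℕ ↦ (fun u ↦ u - c • ∑ j,
      (inner ℝ (b j) (u - (ω₀ + ∑ j, d j • b j)) : ℝ) • b j)^[k] ω₀) atTop
      (𝓝 (ω₀ + ∑ j, d j • b j)) := by
  set ω := ω₀ + ∑ j, d j • b j with hω
  set T : E → E := fun u ↦ u - c • ∑ j, (inner ℝ (b j) (u - ω) : ℝ) • b j with hT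
  set q := 1 - c / ((gramInv b).toReal + 1) with hq
  have hρ0 : 0 ≤ (gramInv b).toReal := ENNReal.toReal_nonneg
  have hq1 : q < 1 := by
    have : 0 < c / ((gramInv b).toReal + 1) := by positivity
    linarith
  have hq0 : 0 ≤ q := by
    rw [hq, sub_nonneg, div_le_one (by positivity)]
    linarith
  have key (k : ℕ) : (∃ d : ι → ℝ, T^[k] ω₀ - ω = ∑ j, d j • b j) ∧
      ‖T^[k] ω₀ - ω‖ ^ 2 ≤ q ^ k * ‖ω₀ - ω‖ ^ 2 := by
    induction k with
    | zero =>
      refine ⟨⟨-d, ?_⟩, by simp⟩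
      simp [hω]
    | succ k ih =>
      obtain ⟨⟨f, hf⟩, hk⟩ := ih
      have hstep : T^[k + 1] ω₀ - ω = (T^[k] ω₀ - ω) -
          c • ∑ j, (inner ℝ (b j) (T^[k] ω₀ - ω) : ℝ) • b j := by
        rw [Function.iterate_succ_apply']
        simp only [hT]
        abel
      refine ⟨⟨fun j ↦ f j - c * inner ℝ (b j) (T^[k] ω₀ - ω), ?_⟩, ?_⟩
      · rw [hstep]
        nth_rewrite 1 [hf]
        simp only [Finset.smul_sum, smul_smul, sub_smul, Finset.sum_sub_distrib]
      · rw [hstep]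
        refine (norm_sq_gradientStep_le hb hc.le hc1 f _ hf).trans ?_
        calc q * ‖T^[k] ω₀ - ω‖ ^ 2 ≤ q * (q ^ k * ‖ω₀ - ω‖ ^ 2) := by gcongr
          _ = _ := by ring
  rw [tendsto_iff_norm_sub_tendsto_zero]
  have h1 : Tendsto (fun k : ℕ ↦ √(q ^ k * ‖ω₀ - ω‖ ^ 2)) atTop (𝓝 0) := by
    have := ((tendsto_pow_atTop_nhds_zero_of_lt_one hq0 hq1).mul_const (‖ω₀ - ω‖ ^ 2)).sqrt
    simpa using this
  exact squeeze_zero (fun _ ↦ norm_nonneg _) (fun k ↦ Real.le_sqrt_of_sq_le (key k).2) h1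

end GradientDescent

variable {p : ℕ}

theorem hasGradientAt_sq_sub_inner (y : ℝ) (x θ : Vec p) :
    HasGradientAt (fun θ : Vec p ↦ (y - inner ℝ x θ) ^ 2 / 2) (-(y - inner ℝ x θ) • x) θ := by
  have h1 : HasFDerivAt (fun θ : Vec p ↦ y - inner ℝ x θ) (-(innerSL ℝ x)) θ :=
    (innerSL ℝ x).hasFDerivAt.const_sub y
  have h2 := (h1.pow 2).mul_const (2⁻¹ : ℝ)
  rw [hasGradientAt_iff_hasFDerivAt]
  convert! h2 using 1
  ext v
  simp
  ring

theorem adapt_eq {n : ℕ} (α : ℝ) (D : Points n p) (ω : Vec p) :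
    adapt α D ω = ω + (α / n) • ∑ j, ((D j).2 - inner ℝ (D j).1 ω) • (D j).1 := by
  have h (j : Fin n) : gradient (pointLoss (D j)) ω =
      -(((D j).2 - inner ℝ (D j).1 ω) • (D j).1) := by
    rw [← neg_smul]
    exact (hasGradientAt_sq_sub_inner _ _ _).gradient
  simp only [adapt, h, Finset.sum_neg_distrib, smul_neg, sub_neg_eq_add]

/-- A consistent least-squares problem is solved by gradient descent. -/
theorem outerLoop_eq {ι : Type*} [Fintype ι] [DecidableEq ι] {L : Vec p → ℝ} {b : ι → Vec p}
    (hb : gramInv b ≠ ⊤) {κ : ℝ} (hκ : 0 < κ) (γ : ι → ℝ)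
    (hL : ∀ ω, L ω = κ * ∑ j, (γ j - inner ℝ (b j) ω) ^ 2 / 2) (ω₀ : Vec p) :
    outerLoop L ω₀ = ω₀ + gramSolve b (fun j ↦ γ j - inner ℝ (b j) ω₀) := by
  set ω := ω₀ + gramSolve b (fun j ↦ γ j - inner ℝ (b j) ω₀) with hω
  have hγ (j : ι) : γ j = inner ℝ (b j) ω := by
    rw [hω, inner_add_right, inner_gramSolve hb]
    ring
  have hgrad (u : Vec p) : gradient L u = κ • ∑ j, (inner ℝ (b j) (u - ω) : ℝ) • b j := by
    have h1 : HasGradientAt L (κ • ∑ j, (-(γ j - inner ℝ (b j) u)) • b j) u := by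
      rw [hasGradientAt_iff_hasFDerivAt, funext hL]
      have := (HasFDerivAt.fun_sum fun j (_ : j ∈ Finset.univ) ↦
        (hasGradientAt_sq_sub_inner (γ j) (b j) u).hasFDerivAt).const_mul κ
      convert! this using 1
      simp [map_sum, map_smul]
    rw [h1.gradient]
    congr 1
    refine Finset.sum_congr rfl fun j _ ↦ ?_
    rw [hγ, inner_sub_right, neg_sub]
  have hsol : IsOuterLoopSolution L ω₀ ω := by
    refine ⟨fun u ↦ ?_, ?_⟩
    · rw [hL, hL]
      simp_rw [hγ]
      simp only [sub_self]
      have : 0 ≤ κ * ∑ j, (inner ℝ (b j) ω - inner ℝ (b j) u) ^ 2 / 2 := by positivity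
      simpa using this
    · set M := ∑ j, ‖b j‖ ^ 2 with hM
      have hM0 : 0 ≤ M := by positivity
      -- Step sizes below this threshold satisfy both `η κ M ≤ 1` and `η κ ≤ 1`; the `+ 1` serves
      -- the second bound and the case `M = 0`.
      have hmem : Set.Ioo (0 : ℝ) (1 / (κ * (M + 1))) ∈ 𝓝[>] (0 : ℝ) :=
        Ioo_mem_nhdsGT (by positivity)
      filter_upwards [hmem] with η hη
      have h2 : η * κ * (M + 1) ≤ 1 := by
        have := hη.2.le
        rw [le_div_iff₀ (by positivity)] at this
        linarith
      have hηκ : 0 < η * κ := mul_pos hη.1 hκ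
      have := tendsto_gradientDescent hb hηκ (by rw [← hM]; nlinarith) (by nlinarith) ω₀
        ((Matrix.gram ℝ b)⁻¹.mulVec (fun j ↦ γ j - inner ℝ (b j) ω₀))
      convert! this using 3
      funext u
      rw [hgrad, smul_smul]
      rfl
  exact (Classical.epsilon_spec_aux _ _ ⟨ω, hsol⟩).unique hsol

end

section

/-! ### The outer loop in the mixed linear regression model -/

variable {m n nv p : ℕ}

/-- Inputs of the meta-training tasks. -/
def inputs (S : Fin m → Task n nv p) : Inputs m n nv p :=
  fun i ↦ (fun r ↦ ((S i).2.1 r).1, fun a ↦ ((S i).2.2 a).1)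

/-- Residuals, at the mean `w₀` of the generating parameters, of the linear system solved by the
outer loop. -/
def residual (α : ℝ) (w₀ : Vec p) (S : Fin m → Task n nv p) (j : Fin m × Fin nv) : ℝ :=
  inner ℝ (row α (inputs S) j) ((S j.1).1 - w₀) + ((S j.1).2.2 j.2).2 +
    ∑ r, -(α / n * inner ℝ ((S j.1).2.1 r).1 ((S j.1).2.2 j.2).1) * ((S j.1).2.1 r).2

theorem inner_adapt {α : ℝ} (D : Points n p) (x ω : Vec p) :
    inner ℝ x (adapt α D ω) = inner ℝ (adaptOp α (fun r ↦ (D r).1) x) ω +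
      ∑ r, α / n * (D r).2 * inner ℝ (D r).1 x := by
  simp only [adapt_eq, inner_add_right, inner_smul_right, inner_sum, adaptOp, inner_sub_left,
    inner_smul_left, sum_inner, Finset.mul_sum, RCLike.conj_to_real]
  rw [sub_add_eq_add_sub, add_sub_assoc, ← Finset.sum_sub_distrib]
  congr 1
  refine Finset.sum_congr rfl fun r _ ↦ ?_
  rw [real_inner_comm x (D r).1]
  ring

/-- By symmetry of `adaptOp` the inner step is transferred from `ω` to the validation input.
Recentring at `w₀` leaves `residual`, a linear form in centred parameters and label noise, as the
only noise-dependent term. -/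
theorem evalSet_sub_inner_adapt (α : ℝ) (w₀ ω : Vec p) (S : Fin m → Task n nv p)
    (j : Fin m × Fin nv) :
    ((S j.1).evalSet j.2).2 - inner ℝ ((S j.1).evalSet j.2).1 (adapt α (S j.1).adaptSet ω) =
      (residual α w₀ S j + inner ℝ (row α (inputs S) j) w₀) - inner ℝ (row α (inputs S) j) ω := by
  have h : adaptOp α (fun r ↦ ((S j.1).adaptSet r).1) ((S j.1).evalSet j.2).1 =
    row α (inputs S) j := rfl
  rw [inner_adapt, h]
  have h' : inner ℝ (row α (inputs S) j) (S j.1).1 = inner ℝ ((S j.1).2.2 j.2).1 (S j.1).1 -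
      ∑ r, α / n * inner ℝ ((S j.1).2.1 r).1 (S j.1).1 *
        inner ℝ ((S j.1).2.1 r).1 ((S j.1).2.2 j.2).1 := by
    simp only [row, inputs, adaptOp, inner_sub_left, inner_smul_left, sum_inner, Finset.mul_sum,
      RCLike.conj_to_real]
    congr 1
    exact Finset.sum_congr rfl fun r _ ↦ by ring
  simp only [residual, inner_sub_right, h', Task.evalSet, Task.adaptSet, label]
  simp only [mul_add, add_mul, Finset.sum_add_distrib, neg_mul, Finset.sum_neg_distrib]
  have : ∑ r, α / n * inner ℝ ((S j.1).2.1 r).1 ((S j.1).2.2 j.2).1 * ((S j.1).2.1 r).2 =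
      ∑ r, α / n * ((S j.1).2.1 r).2 * inner ℝ ((S j.1).2.1 r).1 ((S j.1).2.2 j.2).1 :=
    Finset.sum_congr rfl fun r _ ↦ by ring
  rw [this]
  ring

/-- The point reached by the outer loop. -/
def trained (α : ℝ) (w₀ ω₀ : Vec p) (S : Fin m → Task n nv p) : Vec p :=
  ω₀ + gramSolve (row α (inputs S))
    (fun j ↦ residual α w₀ S j - inner ℝ (row α (inputs S) j) (ω₀ - w₀))

theorem outerLoop_metaLoss (hm : 0 < m) (hnv : 0 < nv) (α : ℝ) (w₀ ω₀ : Vec p)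
    (S : Fin m → Task n nv p) (hS : gramInv (row α (inputs S)) ≠ ⊤) :
    outerLoop (metaLoss α (fun i ↦ (S i).adaptSet) fun i ↦ (S i).evalSet) ω₀ =
      trained α w₀ ω₀ S := by
  have hm0 : (0 : ℝ) < m := by exact_mod_cast hm
  have hnv0 : (0 : ℝ) < nv := by exact_mod_cast hnv
  rw [outerLoop_eq hS (κ := (nv * m : ℝ)⁻¹) (by positivity)
    (fun j ↦ residual α w₀ S j + inner ℝ (row α (inputs S) j) w₀) (fun ω ↦ ?_), trained]
  · congr 2
    funext j
    rw [inner_sub_right]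
    ring
  · simp only [metaLoss, dataLoss, pointLoss, Fintype.sum_prod_type, Finset.mul_sum,
      Finset.sum_div]
    refine Finset.sum_congr rfl fun i _ ↦ Finset.sum_congr rfl fun a _ ↦ ?_
    rw [evalSet_sub_inner_adapt α w₀ ω S (i, a)]
    field_simp

theorem norm_trained_sub_sq (α : ℝ) (w₀ ω₀ : Vec p)
    (S : Fin m → Task n nv p) (hS : gramInv (row α (inputs S)) ≠ ⊤) :
    ‖trained α w₀ ω₀ S - w₀‖ ^ 2 = ‖ω₀ - w₀‖ ^ 2 -
      ‖gramSolve (row α (inputs S)) (fun j ↦ inner ℝ (row α (inputs S) j) (ω₀ - w₀))‖ ^ 2 +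
      ‖gramSolve (row α (inputs S)) (residual α w₀ S)‖ ^ 2 := by
  rw [← norm_add_gramSolve_sub_sq hS]
  congr 2
  rw [trained]
  abel

/-! ### Separation of inputs and noise -/

/-- Centered generating parameters and label noises of one task. -/
abbrev Noise (n nv p : ℕ) : Type := Vec p × (Fin n → ℝ) × (Fin nv → ℝ)

/-- Law of the noise of one task. -/
abbrev noiseLaw (n nv p : ℕ) (σ ν : ℝ) (w₀ : Vec p) : Measure (Noise n nv p) :=
  (multivariateGaussian w₀ ((ν ^ 2 / p) • (1 : Matrix (Fin p) (Fin p) ℝ))).prod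
    ((Measure.pi fun _ ↦ gaussianReal 0 (σ ^ 2).toNNReal).prod
      (Measure.pi fun _ ↦ gaussianReal 0 (σ ^ 2).toNNReal))

/-- The task with given inputs and noise. -/
def mkTask (x : ((Fin n → Vec p) × (Fin nv → Vec p)) × Noise n nv p) : Task n nv p :=
  (x.2.1, fun r ↦ (x.1.1 r, x.2.2.1 r), fun a ↦ (x.1.2 a, x.2.2.2 a))

/-- Serves to regroup the law of a task, in which every input is paired with its noise, as inputs
times noise, so that the noise can be integrated with the inputs fixed. -/
theorem measurePreserving_prodProdProdComm {A B C D : Type*} [MeasurableSpace A]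
    [MeasurableSpace B] [MeasurableSpace C] [MeasurableSpace D] (μA : Measure A) (μB : Measure B)
    (μC : Measure C) (μD : Measure D) [IsProbabilityMeasure μA] [IsProbabilityMeasure μB]
    [IsProbabilityMeasure μC] [IsProbabilityMeasure μD] :
    MeasurePreserving (fun x : (A × B) × (C × D) ↦ ((x.1.1, x.2.1), (x.1.2, x.2.2)))
      ((μA.prod μB).prod (μC.prod μD)) ((μA.prod μC).prod (μB.prod μD)) := by
  have h₁ := measurePreserving_prodAssoc μA μB (μC.prod μD)
  have h₂ := (measurePreserving_prodAssoc μB μC μD).symm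
  have h₃ := (Measure.measurePreserving_swap (μ := μB) (ν := μC)).prod (MeasurePreserving.id μD)
  have h₄ := measurePreserving_prodAssoc μC μB μD
  have h₅ := (measurePreserving_prodAssoc μA μC (μB.prod μD)).symm
  exact (h₅.comp ((MeasurePreserving.id μA).prod (h₄.comp (h₃.comp h₂)))).comp h₁

theorem measurePreserving_mkTask (σ ν : ℝ) (w₀ : Vec p) :
    MeasurePreserving (mkTask (n := n) (nv := nv) (p := p))
      ((taskInputLaw n nv p).prod (noiseLaw n nv p σ ν w₀)) (taskLaw n nv p σ ν w₀) := by
  set μ := multivariateGaussian w₀ ((ν ^ 2 / p) • (1 : Matrix (Fin p) (Fin p) ℝ))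
  have hp (k : ℕ) := (measurePreserving_arrowProdEquivProdArrow (Vec p) ℝ (Fin k)
    (fun _ ↦ stdGaussian (Vec p)) (fun _ ↦ gaussianReal 0 (σ ^ 2).toNNReal)).symm
  have h₁ := measurePreserving_prodProdProdComm (inputLaw n p) (inputLaw nv p)
    (Measure.pi fun _ : Fin n ↦ gaussianReal 0 (σ ^ 2).toNNReal)
    (Measure.pi fun _ : Fin nv ↦ gaussianReal 0 (σ ^ 2).toNNReal)
  have h₂ := ((hp n).prod (hp nv)).comp h₁
  have h₃ := (MeasurePreserving.id μ).prod
    (h₂.comp (Measure.measurePreserving_swap (ν := taskInputLaw n nv p)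
      (μ := ((Measure.pi fun _ : Fin n ↦ gaussianReal 0 (σ ^ 2).toNNReal).prod
        (Measure.pi fun _ : Fin nv ↦ gaussianReal 0 (σ ^ 2).toNNReal)))))
  have h₄ := measurePreserving_prodAssoc μ
    ((Measure.pi fun _ : Fin n ↦ gaussianReal 0 (σ ^ 2).toNNReal).prod
        (Measure.pi fun _ : Fin nv ↦ gaussianReal 0 (σ ^ 2).toNNReal)) (taskInputLaw n nv p)
  exact (h₃.comp h₄).comp (Measure.measurePreserving_swap)

/-- The tasks with given inputs and noises. -/
def mkTasks (x : Inputs m n nv p × (Fin m → Noise n nv p)) : Fin m → Task n nv p :=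
  fun i ↦ mkTask (x.1 i, x.2 i)

theorem measurePreserving_mkTasks (σ ν : ℝ) (w₀ : Vec p) :
    MeasurePreserving (mkTasks (m := m) (n := n) (nv := nv) (p := p))
      ((inputsLaw m n nv p).prod (Measure.pi fun _ ↦ noiseLaw n nv p σ ν w₀))
      (Measure.pi fun _ ↦ taskLaw n nv p σ ν w₀) := by
  have h₁ := (measurePreserving_arrowProdEquivProdArrow ((Fin n → Vec p) × (Fin nv → Vec p))
    (Noise n nv p) (Fin m) (fun _ ↦ taskInputLaw n nv p) (fun _ ↦ noiseLaw n nv p σ ν w₀)).symm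
  have h₂ := measurePreserving_pi (fun _ : Fin m ↦ (taskInputLaw n nv p).prod
    (noiseLaw n nv p σ ν w₀)) (fun _ : Fin m ↦ taskLaw n nv p σ ν w₀)
    (fun _ ↦ measurePreserving_mkTask σ ν w₀)
  exact h₂.comp h₁

end

section

/-! ### Second moments of the noise -/

section Orthogonality

variable {E F : Type*} [NormedAddCommGroup E] [NormedAddCommGroup F] [MeasurableSpace E]
  [MeasurableSpace F] [OpensMeasurableSpace E] [OpensMeasurableSpace F]

theorem integral_const_add_sq {μ : Measure E} [HasMoments μ] {f : E → ℝ}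
    (hf : PolyGrowth f) (h0 : ∫ x, f x ∂μ = 0) (c : ℝ) :
    ∫ x, (c + f x) ^ 2 ∂μ = c ^ 2 + ∫ x, f x ^ 2 ∂μ := by
  have h (x : E) : (c + f x) ^ 2 = (c ^ 2 + 2 * c * f x) + f x ^ 2 := by ring
  simp_rw [h]
  rw [integral_add (PolyGrowth.integrable (by fun_prop)) (PolyGrowth.integrable (by fun_prop)),
    integral_add (PolyGrowth.integrable (by fun_prop)) (PolyGrowth.integrable (by fun_prop)),
    integral_const_mul, h0]
  simp

variable [SecondCountableTopology E] [SecondCountableTopology F]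

theorem integral_prod_add_mul_add {μ : Measure E} {ν : Measure F} [HasMoments μ] [HasMoments ν] {f f' : E → ℝ} {g g' : F → ℝ}
    (hf : PolyGrowth f) (hf' : PolyGrowth f') (hg : PolyGrowth g) (hg' : PolyGrowth g')
    (h0 : ∫ x, f x ∂μ = 0) (h0' : ∫ x, f' x ∂μ = 0) :
    ∫ x, (f x.1 + g x.2) * (f' x.1 + g' x.2) ∂μ.prod ν =
      ∫ x, f x * f' x ∂μ + ∫ y, g y * g' y ∂ν := by
  have h (x : E × F) : (f x.1 + g x.2) * (f' x.1 + g' x.2) =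
      (f x.1 * f' x.1 + g x.2 * g' x.2) + (f x.1 * g' x.2 + f' x.1 * g x.2) := by ring
  simp_rw [h]
  rw [integral_add (PolyGrowth.integrable (by fun_prop)) (PolyGrowth.integrable (by fun_prop)),
    integral_add (PolyGrowth.integrable (by fun_prop)) (PolyGrowth.integrable (by fun_prop)),
    integral_add (PolyGrowth.integrable (by fun_prop)) (PolyGrowth.integrable (by fun_prop)),
    integral_prod_mul f g', integral_prod_mul f' g, h0, h0',
    integral_fun_fst (μ := μ) (ν := ν) (fun x ↦ f x * f' x),
    integral_fun_snd (μ := μ) (ν := ν) (fun y ↦ g y * g' y)]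
  simp

theorem integral_eval_mul_eval {ι : Type*} [Fintype ι] [DecidableEq ι] (μ : Measure E)
    [IsProbabilityMeasure μ] {f g : E → ℝ} (hf : PolyGrowth f) (hg : PolyGrowth g)
    (h0 : ∫ x, f x ∂μ = 0) (i j : ι) :
    ∫ x : ι → E, f (x i) * g (x j) ∂(Measure.pi fun _ ↦ μ) =
      if i = j then ∫ x, f x * g x ∂μ else 0 := by
  split_ifs with h
  · subst h
    exact integral_comp_eval (μ := fun _ : ι ↦ μ) (i := i) (f := fun x ↦ f x * g x)
      (PolyGrowth.continuous (by fun_prop)).aestronglyMeasurable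
  · have hind : IndepFun (fun x : ι → E ↦ f (x i)) (fun x ↦ g (x j)) (Measure.pi fun _ ↦ μ) :=
      ((iIndepFun_pi (μ := fun _ : ι ↦ μ) (X := fun _ ↦ id) (fun _ ↦ aemeasurable_id)).indepFun
        h).comp hf.continuous.measurable hg.continuous.measurable
    rw [hind.integral_fun_mul_eq_mul_integral
      (hf.continuous.comp (continuous_apply i)).aestronglyMeasurable
      (hg.continuous.comp (continuous_apply j)).aestronglyMeasurable,
      integral_comp_eval (μ := fun _ : ι ↦ μ) (i := i) (f := f)
        hf.continuous.aestronglyMeasurable, h0, zero_mul]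

end Orthogonality

theorem integral_sq_gaussianReal_sq (σ : ℝ) :
    ∫ x, x * x ∂gaussianReal 0 (σ ^ 2).toNNReal = σ ^ 2 := by
  have h := variance_id_gaussianReal (μ := 0) (v := (σ ^ 2).toNNReal)
  rw [variance_of_integral_eq_zero (by fun_prop) (by simp)] at h
  simpa [sq, Real.coe_toNNReal _ (mul_self_nonneg σ)] using h

theorem integral_sum_mul_gaussianReal {k : ℕ} (σ : ℝ) (s : Fin k → ℝ) :
    ∫ z : Fin k → ℝ, ∑ r, s r * z r ∂(Measure.pi fun _ ↦ gaussianReal 0 (σ ^ 2).toNNReal) = 0 := by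
  rw [integral_finsetSum _ fun r _ ↦ PolyGrowth.integrable (by fun_prop)]
  refine Finset.sum_eq_zero fun r _ ↦ ?_
  rw [integral_const_mul, integral_comp_eval (μ := fun _ : Fin k ↦ gaussianReal 0 (σ ^ 2).toNNReal)
    (i := r) (f := fun x ↦ x) (by fun_prop)]
  simp

theorem integral_sum_mul_sum_gaussianReal {k : ℕ} (σ : ℝ) (s t : Fin k → ℝ) :
    ∫ z : Fin k → ℝ, (∑ r, s r * z r) * ∑ r, t r * z r
      ∂(Measure.pi fun _ ↦ gaussianReal 0 (σ ^ 2).toNNReal) = σ ^ 2 * ∑ r, s r * t r := by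
  have h (z : Fin k → ℝ) : (∑ r, s r * z r) * ∑ r, t r * z r =
      ∑ r, ∑ q, s r * t q * (z r * z q) := by
    rw [Finset.sum_mul_sum]
    exact Finset.sum_congr rfl fun r _ ↦ Finset.sum_congr rfl fun q _ ↦ by ring
  simp_rw [h]
  rw [integral_finsetSum _ fun r _ ↦ PolyGrowth.integrable (by fun_prop), Finset.mul_sum]
  refine Finset.sum_congr rfl fun r _ ↦ ?_
  rw [integral_finsetSum _ fun q _ ↦ PolyGrowth.integrable (by fun_prop)]
  simp_rw [integral_const_mul, integral_eval_mul_eval (gaussianReal 0 (σ ^ 2).toNNReal)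
    PolyGrowth.id PolyGrowth.id (by simp), integral_sq_gaussianReal_sq]
  simp [mul_comm]

section Parameters

variable {p : ℕ} (ν : ℝ) (w₀ : Vec p)

theorem integral_inner_sub_parameters (v : Vec p) :
    ∫ w, inner ℝ v (w - w₀)
      ∂(multivariateGaussian w₀ ((ν ^ 2 / p) • (1 : Matrix (Fin p) (Fin p) ℝ))) = 0 := by
  have h' : Integrable (fun w : Vec p ↦ w)
      (multivariateGaussian w₀ ((ν ^ 2 / p) • (1 : Matrix (Fin p) (Fin p) ℝ))) :=
    IsGaussian.integrable_id
  have h : Integrable (fun w : Vec p ↦ w - w₀)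
      (multivariateGaussian w₀ ((ν ^ 2 / p) • (1 : Matrix (Fin p) (Fin p) ℝ))) :=
    h'.sub (integrable_const w₀)
  rw [integral_inner h, integral_sub h' (integrable_const _), integral_id_multivariateGaussian]
  simp

theorem integral_inner_sub_mul_inner_sub_parameters (v v' : Vec p) :
    ∫ w, inner ℝ v (w - w₀) * inner ℝ v' (w - w₀)
      ∂(multivariateGaussian w₀ ((ν ^ 2 / p) • (1 : Matrix (Fin p) (Fin p) ℝ))) =
      ν ^ 2 / p * inner ℝ v v' := by
  have hS : ((ν ^ 2 / p) • (1 : Matrix (Fin p) (Fin p) ℝ)).PosSemidef :=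
    Matrix.PosSemidef.one.smul (by positivity)
  have h := covarianceBilin_multivariateGaussian (μ := w₀) hS v v'
  rw [covarianceBilin_apply IsGaussian.memLp_two_id] at h
  simp only [integral_id_multivariateGaussian'] at h
  rw [h, Matrix.smul_mulVec, Matrix.one_mulVec, dotProduct_smul, smul_eq_mul]
  congr 1
  simp [PiLp.inner_apply, dotProduct, mul_comm]

theorem integral_norm_sub_sq_parameters (hp : 0 < p) (ω : Vec p) :
    ∫ w, ‖w - ω‖ ^ 2
      ∂(multivariateGaussian w₀ ((ν ^ 2 / p) • (1 : Matrix (Fin p) (Fin p) ℝ))) =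
      ν ^ 2 + ‖ω - w₀‖ ^ 2 := by
  have h (w : Vec p) : ‖w - ω‖ ^ 2 = ∑ k, ((w₀ - ω) k +
      inner ℝ (EuclideanSpace.single k 1) (w - w₀)) ^ 2 := by
    rw [EuclideanSpace.real_norm_sq_eq]
    refine Finset.sum_congr rfl fun k _ ↦ ?_
    simp [EuclideanSpace.inner_single_left]
  simp_rw [h]
  rw [integral_finsetSum _ fun k _ ↦ PolyGrowth.integrable (by fun_prop)]
  have h' (k : Fin p) : ∫ w, ((w₀ - ω) k + inner ℝ (EuclideanSpace.single k 1) (w - w₀)) ^ 2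
      ∂(multivariateGaussian w₀ ((ν ^ 2 / p) • (1 : Matrix (Fin p) (Fin p) ℝ))) =
      (w₀ - ω) k ^ 2 + ν ^ 2 / p := by
    rw [integral_const_add_sq (by fun_prop) (integral_inner_sub_parameters ν w₀ _)]
    simp_rw [sq (inner ℝ _ (_ : Vec p))]
    rw [integral_inner_sub_mul_inner_sub_parameters]
    simp
  simp_rw [h', Finset.sum_add_distrib]
  rw [← EuclideanSpace.real_norm_sq_eq, norm_sub_rev w₀ ω]
  have : (p : ℝ) ≠ 0 := by exact_mod_cast hp.ne'
  simp
  field_simp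
  ring

end Parameters

variable {m n nv p : ℕ}

/-- A linear form of the noise of a task. -/
def noiseForm (w₀ v : Vec p) (s : Fin n → ℝ) (t : Fin nv → ℝ) (ζ : Noise n nv p) : ℝ :=
  inner ℝ v (ζ.1 - w₀) + (∑ r, s r * ζ.2.1 r + ∑ a, t a * ζ.2.2 a)

@[fun_prop]
theorem PolyGrowth.noiseForm {E : Type*} [NormedAddCommGroup E] (w₀ : Vec p) {v : E → Vec p}
    {s : E → Fin n → ℝ} {t : E → Fin nv → ℝ} {ζ : E → Noise n nv p} (hv : PolyGrowth v)
    (hs : ∀ r, PolyGrowth fun x ↦ s x r) (ht : ∀ a, PolyGrowth fun x ↦ t x a)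
    (hζ : PolyGrowth ζ) :
    PolyGrowth (fun x ↦ noiseForm w₀ (v x) (s x) (t x) (ζ x)) := by
  unfold MAML.noiseForm
  fun_prop

instance (n nv p : ℕ) (σ ν : ℝ) (w₀ : Vec p) : HasMoments (noiseLaw n nv p σ ν w₀) :=
  HasMoments.prod _ _

theorem integral_noiseForm (σ ν : ℝ) (w₀ v : Vec p) (s : Fin n → ℝ) (t : Fin nv → ℝ) :
    ∫ ζ, noiseForm w₀ v s t ζ ∂noiseLaw n nv p σ ν w₀ = 0 := by
  unfold noiseForm
  have h1 := integral_inner_sub_parameters ν w₀ v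
  have h2 := integral_sum_mul_gaussianReal σ s
  have h3 := integral_sum_mul_gaussianReal σ t
  rw [integral_add (PolyGrowth.integrable (by fun_prop)) (PolyGrowth.integrable (by fun_prop)),
    integral_fun_fst (fun w ↦ inner ℝ v (w - w₀)), h1,
    integral_fun_snd (fun z : (Fin n → ℝ) × (Fin nv → ℝ) ↦
      ∑ r, s r * z.1 r + ∑ a, t a * z.2 a),
    integral_add (PolyGrowth.integrable (by fun_prop)) (PolyGrowth.integrable (by fun_prop)),
    integral_fun_fst (fun z : Fin n → ℝ ↦ ∑ r, s r * z r), h2,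
    integral_fun_snd (fun z : Fin nv → ℝ ↦ ∑ r, t r * z r), h3]
  simp

theorem integral_noiseForm_mul (σ ν : ℝ) (w₀ v v' : Vec p) (s s' : Fin n → ℝ)
    (t t' : Fin nv → ℝ) :
    ∫ ζ, noiseForm w₀ v s t ζ * noiseForm w₀ v' s' t' ζ ∂noiseLaw n nv p σ ν w₀ =
      ν ^ 2 / p * inner ℝ v v' + σ ^ 2 * (∑ r, s r * s' r + ∑ a, t a * t' a) := by
  unfold noiseForm
  rw [integral_prod_add_mul_add (f := fun w ↦ inner ℝ v (w - w₀))
    (f' := fun w ↦ inner ℝ v' (w - w₀))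
    (g := fun z : (Fin n → ℝ) × (Fin nv → ℝ) ↦ ∑ r, s r * z.1 r + ∑ a, t a * z.2 a)
    (g' := fun z : (Fin n → ℝ) × (Fin nv → ℝ) ↦ ∑ r, s' r * z.1 r + ∑ a, t' a * z.2 a)
    (by fun_prop) (by fun_prop) (by fun_prop) (by fun_prop)
    (integral_inner_sub_parameters ν w₀ v) (integral_inner_sub_parameters ν w₀ v'),
    integral_inner_sub_mul_inner_sub_parameters,
    integral_prod_add_mul_add (f := fun z : Fin n → ℝ ↦ ∑ r, s r * z r)
    (f' := fun z : Fin n → ℝ ↦ ∑ r, s' r * z r) (g := fun z : Fin nv → ℝ ↦ ∑ r, t r * z r)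
    (g' := fun z : Fin nv → ℝ ↦ ∑ r, t' r * z r) (by fun_prop) (by fun_prop) (by fun_prop)
    (by fun_prop) (integral_sum_mul_gaussianReal σ s) (integral_sum_mul_gaussianReal σ s'),
    integral_sum_mul_sum_gaussianReal, integral_sum_mul_sum_gaussianReal]
  ring

/-- Covariance of the residuals given the inputs. -/
def residualCov (σ ν α : ℝ) (I : Inputs m n nv p) (j k : Fin m × Fin nv) : ℝ :=
  if j.1 = k.1 then ν ^ 2 / p * inner ℝ (row α I j) (row α I k) +
    σ ^ 2 * ((α / n) ^ 2 * ∑ r, inner ℝ ((I j.1).1 r) ((I j.1).2 j.2) *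
      inner ℝ ((I j.1).1 r) ((I j.1).2 k.2) + if j.2 = k.2 then 1 else 0) else 0

theorem residual_mkTasks (α : ℝ) (w₀ : Vec p) (I : Inputs m n nv p) (ζ : Fin m → Noise n nv p)
    (j : Fin m × Fin nv) :
    residual α w₀ (mkTasks (I, ζ)) j = noiseForm w₀ (row α I j)
      (fun r ↦ -(α / n * inner ℝ ((I j.1).1 r) ((I j.1).2 j.2))) (Pi.single j.2 1) (ζ j.1) := by
  have : inputs (mkTasks (I, ζ)) = I := rfl
  simp only [residual, noiseForm, this]
  simp only [mkTasks, mkTask, Pi.single_apply, ite_mul, one_mul, zero_mul, Finset.sum_ite_eq',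
    Finset.mem_univ, if_true]
  ring

/-- For fixed inputs each residual is a centred linear form in the noise of its own task, so
residuals of different tasks are uncorrelated. -/
theorem integral_residual_mul (σ ν α : ℝ) (w₀ : Vec p) (I : Inputs m n nv p)
    (j k : Fin m × Fin nv) :
    ∫ ζ, residual α w₀ (mkTasks (I, ζ)) j * residual α w₀ (mkTasks (I, ζ)) k
      ∂(Measure.pi fun _ ↦ noiseLaw n nv p σ ν w₀) = residualCov σ ν α I j k := by
  simp_rw [residual_mkTasks]
  rcases eq_or_ne j.1 k.1 with h | h
  · rw [← h, integral_eval_mul_eval _ (by fun_prop) (by fun_prop) (integral_noiseForm ..), if_pos rfl,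
      integral_noiseForm_mul, residualCov, if_pos h]
    congr 2
    congr 1
    · rw [Finset.mul_sum]
      exact Finset.sum_congr rfl fun r _ ↦ by ring
    · simp [Pi.single_apply, eq_comm]
  · rw [integral_eval_mul_eval _ (by fun_prop) (by fun_prop) (integral_noiseForm ..), if_neg h,
      residualCov, if_neg h]

/-! ### The meta-testing task -/

/-- The label noise is centred and independent of the inputs, so the cross term vanishes; the noise
contributes `σ² (α / n)²` times the mean `n p` of `∑ ‖X r‖²`. -/
theorem integral_norm_sub_sq_points (σ α : ℝ) (hn : 0 < n) (v : Vec p) :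
    ∫ D : Points n p, ‖adaptOp α (fun r ↦ (D r).1) v - (α / n) • ∑ r, (D r).2 • (D r).1‖ ^ 2
      ∂pointsLaw n p σ = hCoef α p n * ‖v‖ ^ 2 + σ ^ 2 * (α ^ 2 * p / n) := by
  have hmp := (measurePreserving_arrowProdEquivProdArrow (Vec p) ℝ (Fin n)
    (fun _ ↦ stdGaussian (Vec p)) (fun _ ↦ gaussianReal 0 (σ ^ 2).toNNReal)).symm
  have hn0 : (n : ℝ) ≠ 0 := by exact_mod_cast hn.ne'
  rw [show pointsLaw n p σ = _ from hmp.map_eq.symm, integral_map hmp.measurable.aemeasurable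
    (PolyGrowth.continuous (by fun_prop)).aestronglyMeasurable]
  change ∫ z : (Fin n → Vec p) × (Fin n → ℝ),
    ‖adaptOp α z.1 v - (α / n) • ∑ r, z.2 r • z.1 r‖ ^ 2 ∂(inputLaw n p).prod
      (Measure.pi fun _ ↦ gaussianReal 0 (σ ^ 2).toNNReal) = _
  rw [integral_prod _ (PolyGrowth.integrable (by fun_prop))]
  have h (X : Fin n → Vec p) : ∫ z : Fin n → ℝ,
      ‖adaptOp α X v - (α / n) • ∑ r, z r • X r‖ ^ 2
        ∂(Measure.pi fun _ ↦ gaussianReal 0 (σ ^ 2).toNNReal) =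
      ‖adaptOp α X v‖ ^ 2 + σ ^ 2 * (α / n) ^ 2 * ∑ r, ‖X r‖ ^ 2 := by
    have h1 (z : Fin n → ℝ) : ‖adaptOp α X v - (α / n) • ∑ r, z r • X r‖ ^ 2 =
        ∑ k, (adaptOp α X v k + ∑ r, -(α / n * X r k) * z r) ^ 2 := by
      rw [EuclideanSpace.real_norm_sq_eq]
      refine Finset.sum_congr rfl fun k _ ↦ ?_
      congr 1
      simp only [PiLp.sub_apply, PiLp.smul_apply, WithLp.ofLp_sum, Finset.sum_apply, smul_eq_mul,
        neg_mul, Finset.sum_neg_distrib, Finset.mul_sum, ← sub_eq_add_neg]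
      congr 1
      exact Finset.sum_congr rfl fun r _ ↦ by ring
    simp_rw [h1]
    rw [integral_finsetSum _ fun k _ ↦ PolyGrowth.integrable (by fun_prop)]
    have h2 (k : Fin p) : ∫ z : Fin n → ℝ, (adaptOp α X v k + ∑ r, -(α / n * X r k) * z r) ^ 2
        ∂(Measure.pi fun _ ↦ gaussianReal 0 (σ ^ 2).toNNReal) =
        adaptOp α X v k ^ 2 + σ ^ 2 * (α / n) ^ 2 * ∑ r, X r k ^ 2 := by
      rw [integral_const_add_sq (by fun_prop) (integral_sum_mul_gaussianReal σ _)]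
      simp_rw [sq (∑ r, _)]
      rw [integral_sum_mul_sum_gaussianReal, mul_assoc, Finset.mul_sum _ _ ((α / n) ^ 2)]
      congr 2
      exact Finset.sum_congr rfl fun r _ ↦ by ring
    simp_rw [h2]
    rw [Finset.sum_add_distrib, ← EuclideanSpace.real_norm_sq_eq, ← Finset.mul_sum,
      Finset.sum_comm]
    simp_rw [← EuclideanSpace.real_norm_sq_eq]
  simp_rw [h]
  rw [integral_add (PolyGrowth.integrable (by fun_prop)) (PolyGrowth.integrable (by fun_prop)),
    integral_norm_sq_adaptOp α hn, integral_const_mul,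
    integral_finsetSum _ fun r _ ↦ PolyGrowth.integrable (by fun_prop)]
  have h3 (r : Fin n) : ∫ X : Fin n → Vec p, ‖X r‖ ^ 2 ∂inputLaw n p = p := by
    rw [← integral_norm_sq_stdGaussian p]
    exact integral_comp_eval (μ := fun _ : Fin n ↦ stdGaussian (Vec p)) (i := r)
      (f := fun x ↦ ‖x‖ ^ 2) (by fun_prop)
  simp_rw [h3]
  simp
  field_simp

theorem integral_dataLoss_label {k : ℕ} (hk : 0 < k) (σ : ℝ) (w θ : Vec p) :
    ∫ D : Points k p, dataLoss (label w D) θ ∂pointsLaw k p σ = (σ ^ 2 + ‖w - θ‖ ^ 2) / 2 := by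
  have hk0 : (k : ℝ) ≠ 0 := by exact_mod_cast hk.ne'
  have h (D : Points k p) : dataLoss (label w D) θ =
      ∑ j, (2 * k : ℝ)⁻¹ * ((inner ℝ (D j).1 (w - θ) + (D j).2) *
        (inner ℝ (D j).1 (w - θ) + (D j).2)) := by
    simp only [dataLoss, pointLoss, label, Finset.sum_div]
    refine Finset.sum_congr rfl fun j _ ↦ ?_
    rw [inner_sub_right]
    field_simp
    ring
  simp_rw [h]
  rw [integral_finsetSum _ fun k _ ↦ PolyGrowth.integrable (by fun_prop)]
  have h2 (j : Fin k) : ∫ D : Points k p, (inner ℝ (D j).1 (w - θ) + (D j).2) *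
        (inner ℝ (D j).1 (w - θ) + (D j).2) ∂pointsLaw k p σ = ‖w - θ‖ ^ 2 + σ ^ 2 := by
    refine (integral_comp_eval (μ := fun _ : Fin k ↦ (stdGaussian (Vec p)).prod
      (gaussianReal 0 (σ ^ 2).toNNReal)) (i := j) (f := fun d ↦
        (inner ℝ d.1 (w - θ) + d.2) * (inner ℝ d.1 (w - θ) + d.2))
      (PolyGrowth.continuous (by fun_prop)).aestronglyMeasurable).trans ?_
    rw [integral_prod_add_mul_add (f := fun x ↦ inner ℝ x (w - θ))
      (f' := fun x ↦ inner ℝ x (w - θ)) (g := fun z ↦ z) (g' := fun z ↦ z)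
      (by fun_prop) (by fun_prop) (by fun_prop) (by fun_prop) (integral_inner_stdGaussian _)
      (integral_inner_stdGaussian _), integral_inner_mul_inner_stdGaussian,
      integral_sq_gaussianReal_sq, real_inner_self_eq_norm_sq]
  simp_rw [integral_const_mul, h2]
  simp
  field_simp
  ring

theorem adapt_label (α : ℝ) (w ω : Vec p) (D : Points n p) :
    w - adapt α (label w D) ω =
      adaptOp α (fun r ↦ (D r).1) (w - ω) - (α / n) • ∑ r, (D r).2 • (D r).1 := by
  rw [adapt_eq, adaptOp, sub_sub, ← smul_add, ← Finset.sum_add_distrib, sub_add_eq_sub_sub]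
  congr 2
  refine Finset.sum_congr rfl fun r _ ↦ ?_
  simp only [label, inner_sub_right, ← add_smul]
  congr 1
  ring

@[fun_prop]
theorem PolyGrowth.dataLoss_adapt {E : Type*} [NormedAddCommGroup E] {a b : ℕ} (α : ℝ)
    {T : E → Task a b p} {ω : E → Vec p} (hT : PolyGrowth T) (hω : PolyGrowth ω) :
    PolyGrowth (fun x ↦ dataLoss (T x).evalSet (adapt α (T x).adaptSet (ω x))) := by
  simp only [dataLoss, pointLoss, adapt_eq, Task.evalSet, Task.adaptSet, label]
  fun_prop

/-- Integrate over the test points, which gives `(σ² + ‖w - θ‖²) / 2`, then over the target data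
through `adapt_label`, and finally over `w`, whose `p` coordinates have variance `ν² / p` each. -/
theorem integral_testTask {nr ns : ℕ} (hnr : 0 < nr) (hns : 0 < ns) (hp : 0 < p) (σ ν α : ℝ)
    (w₀ ω : Vec p) :
    ∫ T : Task nr ns p, dataLoss T.evalSet (adapt α T.adaptSet ω) ∂taskLaw nr ns p σ ν w₀ =
      σ ^ 2 / 2 * (1 + α ^ 2 * p / nr) + hCoef α p nr / 2 * (ν ^ 2 + ‖ω - w₀‖ ^ 2) := by
  have h (w : Vec p) : ∫ D : Points nr p × Points ns p,
      dataLoss (label w D.2) (adapt α (label w D.1) ω) ∂(pointsLaw nr p σ).prod (pointsLaw ns p σ) =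
      σ ^ 2 / 2 * (1 + α ^ 2 * p / nr) + hCoef α p nr / 2 * ‖w - ω‖ ^ 2 := by
    rw [integral_prod]
    · simp_rw [integral_dataLoss_label hns, adapt_label]
      rw [integral_div, integral_add (PolyGrowth.integrable (by fun_prop))
        (PolyGrowth.integrable (by fun_prop)), integral_norm_sub_sq_points σ α hnr]
      simp
      ring
    · exact PolyGrowth.integrable (PolyGrowth.dataLoss_adapt α
        (T := fun D : Points nr p × Points ns p ↦ (w, D)) (ω := fun _ ↦ ω)
        (by fun_prop) (by fun_prop))
  rw [taskLaw, integral_prod]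
  · change ∫ w, ∫ D : Points nr p × Points ns p,
      dataLoss (label w D.2) (adapt α (label w D.1) ω)
        ∂(pointsLaw nr p σ).prod (pointsLaw ns p σ)
        ∂(multivariateGaussian w₀ ((ν ^ 2 / p) • (1 : Matrix (Fin p) (Fin p) ℝ))) = _
    simp_rw [h]
    rw [integral_add (PolyGrowth.integrable (by fun_prop)) (PolyGrowth.integrable (by fun_prop)),
      integral_const_mul (hCoef α p nr / 2), integral_norm_sub_sq_parameters ν w₀ hp]
    simp
  · exact PolyGrowth.integrable (μ := taskLaw nr ns p σ ν w₀) (PolyGrowth.dataLoss_adapt α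
        (T := fun T ↦ T) (ω := fun _ ↦ ω) (by fun_prop) (by fun_prop))

end

section

/-! ### Distance of the trained parameters from the mean of the generating parameters -/

variable {m n nv p : ℕ}

theorem measurePreserving_inputs (σ ν : ℝ) (w₀ : Vec p) :
    MeasurePreserving (inputs (m := m) (n := n) (nv := nv))
      (Measure.pi fun _ ↦ taskLaw n nv p σ ν w₀) (inputsLaw m n nv p) := by
  have hm : Measurable (inputs (m := m) (n := n) (nv := nv) (p := p)) := by
    unfold inputs
    fun_prop
  refine ⟨hm, ?_⟩
  have hT := measurePreserving_mkTasks (m := m) (n := n) (nv := nv) σ ν w₀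
  rw [← hT.map_eq, Measure.map_map hm hT.measurable]
  exact Measure.map_fst_prod.trans (by simp)

theorem measurable_inv_gram_row (α : ℝ) (j k : Fin m × Fin nv) :
    Measurable (fun I : Inputs m n nv p ↦ (Matrix.gram ℝ (row α I))⁻¹ j k) := by
  have hc : Continuous (fun I : Inputs m n nv p ↦ Matrix.gram ℝ (row α I)) := by
    refine continuous_matrix fun i i' ↦ ?_
    simp only [Matrix.gram_apply]
    exact PolyGrowth.continuous (by fun_prop)
  simp only [Matrix.inv_def, Ring.inverse_eq_inv', Matrix.smul_apply, smul_eq_mul]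
  exact hc.matrix_det.measurable.inv.mul (hc.matrix_adjugate.matrix_elem j k).measurable

@[fun_prop]
theorem PolyGrowth.residual {E : Type*} [NormedAddCommGroup E] (α : ℝ) (w₀ : Vec p)
    {S : E → Fin m → Task n nv p} (hS : PolyGrowth S) (j : Fin m × Fin nv) :
    PolyGrowth (fun x ↦ residual α w₀ (S x) j) := by
  unfold MAML.residual MAML.row MAML.inputs
  fun_prop

@[fun_prop]
theorem PolyGrowth.residualCov {E : Type*} [NormedAddCommGroup E] (σ ν α : ℝ)
    {I : E → Inputs m n nv p} (hI : PolyGrowth I) (j k : Fin m × Fin nv) :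
    PolyGrowth (fun x ↦ residualCov σ ν α (I x) j k) := by
  unfold MAML.residualCov
  split_ifs <;> fun_prop

section NegativeMoment

variable {α M : ℝ}

theorem gramInv_ne_top_ae (hM : ∫⁻ I, gramInv (row α I) ^ 2 ∂inputsLaw m n nv p ≤
    ENNReal.ofReal M) : ∀ᵐ I ∂inputsLaw m n nv p, gramInv (row α I) ≠ ⊤ := by
  have := ae_lt_top ((measurable_gramInv_row (m := m) (n := n) (nv := nv) (p := p) α).pow_const 2)
    (hM.trans_lt ENNReal.ofReal_lt_top).ne
  filter_upwards [this] with I hI h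
  simp [h] at hI

theorem integrable_gramInv_sq (hM : ∫⁻ I, gramInv (row α I) ^ 2 ∂inputsLaw m n nv p ≤
    ENNReal.ofReal M) :
    Integrable (fun I ↦ (gramInv (row α I)).toReal ^ 2) (inputsLaw m n nv p) := by
  have := integrable_toReal_of_lintegral_ne_top
    ((measurable_gramInv_row (m := m) (n := n) (nv := nv) (p := p) α).pow_const 2).aemeasurable
    (hM.trans_lt ENNReal.ofReal_lt_top).ne
  simpa using this

theorem integral_gramInv_sq_le (hM0 : 0 ≤ M)
    (hM : ∫⁻ I, gramInv (row α I) ^ 2 ∂inputsLaw m n nv p ≤ ENNReal.ofReal M) :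
    ∫ I, (gramInv (row α I)).toReal ^ 2 ∂inputsLaw m n nv p ≤ M := by
  have h := integral_toReal
    ((measurable_gramInv_row (m := m) (n := n) (nv := nv) (p := p) α).pow_const 2).aemeasurable
    (ae_lt_top ((measurable_gramInv_row (m := m) (n := n) (nv := nv) (p := p) α).pow_const 2)
      (hM.trans_lt ENNReal.ofReal_lt_top).ne)
  simp only [ENNReal.toReal_pow] at h
  rw [h]
  exact ENNReal.toReal_le_of_le_ofReal hM0 hM

theorem integrable_of_abs_le_gramInv_mul (hM : ∫⁻ I, gramInv (row α I) ^ 2 ∂inputsLaw m n nv p ≤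
    ENNReal.ofReal M) {f g : Inputs m n nv p → ℝ}
    (hf : AEStronglyMeasurable f (inputsLaw m n nv p))
    (hg : Integrable (fun I ↦ g I ^ 2) (inputsLaw m n nv p))
    (hfg : ∀ᵐ I ∂inputsLaw m n nv p, |f I| ≤ (gramInv (row α I)).toReal * |g I|) :
    Integrable f (inputsLaw m n nv p) := by
  refine ((integrable_gramInv_sq hM).add hg).mono' hf (hfg.mono fun I hI ↦ ?_)
  have h0 : 0 ≤ (gramInv (row α I)).toReal := ENNReal.toReal_nonneg
  rw [Real.norm_eq_abs, Pi.add_apply, ← sq_abs (g I)]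
  nlinarith [sq_nonneg ((gramInv (row α I)).toReal - |g I|), abs_nonneg (g I)]

/-- Cauchy-Schwarz in the form of a weighted arithmetic-geometric mean inequality. The weight `p *
s` balances a second moment `M / p²` of `gramInv` against a second moment `c * s²` of `g`; both
terms become multiples of `s / p`. -/
theorem abs_integral_le_of_abs_le_gramInv_mul (hM0 : 0 ≤ M)
    (hM : ∫⁻ I, gramInv (row α I) ^ 2 ∂inputsLaw m n nv p ≤ ENNReal.ofReal (M / p ^ 2))
    (hp : 0 < p) {f g : Inputs m n nv p → ℝ} {c s : ℝ} (hs : 0 < s)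
    (hg : Integrable (fun I ↦ g I ^ 2) (inputsLaw m n nv p))
    (hgs : ∫ I, g I ^ 2 ∂inputsLaw m n nv p ≤ c * s ^ 2)
    (hfg : ∀ᵐ I ∂inputsLaw m n nv p, |f I| ≤ (gramInv (row α I)).toReal * |g I|) :
    |∫ I, f I ∂inputsLaw m n nv p| ≤ (M + c) * (s / p) := by
  have hp0 : (0 : ℝ) < p := by exact_mod_cast hp
  have h1 := integral_gramInv_sq_le (by positivity) hM
  have h2 := integrable_gramInv_sq hM
  have hc : 0 ≤ c := by
    have : 0 ≤ c * s ^ 2 := (integral_nonneg fun I ↦ sq_nonneg (g I)).trans hgs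
    exact nonneg_of_mul_nonneg_left this (by positivity)
  have h3 : ‖∫ I, f I ∂inputsLaw m n nv p‖ ≤
      ∫ I, (p * s * (gramInv (row α I)).toReal ^ 2 + (p * s)⁻¹ * g I ^ 2)
        ∂inputsLaw m n nv p := by
    refine norm_integral_le_of_norm_le ((h2.const_mul _).add (hg.const_mul _))
      (hfg.mono fun I hI ↦ ?_)
    have h0 : 0 ≤ (gramInv (row α I)).toReal := ENNReal.toReal_nonneg
    rw [Real.norm_eq_abs, ← sq_abs (g I)]
    refine hI.trans ?_
    have h4 : (p * s) * (p * s)⁻¹ = 1 := mul_inv_cancel₀ (by positivity)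
    have h5 : 0 < (p * s : ℝ)⁻¹ := by positivity
    set ρ := (gramInv (row α I)).toReal
    set q := (p * s : ℝ)⁻¹
    have h6 : p * s * ρ ^ 2 + q * |g I| ^ 2 - ρ * |g I| =
        q * ((p * s * ρ - |g I|) ^ 2 + p * s * ρ * |g I|) := by
      linear_combination (-(p * s * ρ ^ 2) + ρ * |g I|) * h4
    have h7 : 0 ≤ q * ((p * s * ρ - |g I|) ^ 2 + p * s * ρ * |g I|) := by positivity
    linarith
  rw [integral_add (h2.const_mul _) (hg.const_mul _), integral_const_mul, integral_const_mul] at h3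
  rw [← Real.norm_eq_abs]
  refine h3.trans ?_
  calc _ ≤ p * s * (M / p ^ 2) + (p * s)⁻¹ * (c * s ^ 2) := by gcongr
    _ = _ := by
      field_simp

end NegativeMoment

/-- This is the trace of `G⁻¹ G`. It makes the leading contribution of the noise exact, with no
expansion of `G⁻¹`. -/
theorem sum_inv_gram_mul {ι E : Type*} [Fintype ι] [DecidableEq ι] [NormedAddCommGroup E]
    [InnerProductSpace ℝ E] {b : ι → E} (hb : gramInv b ≠ ⊤) :
    ∑ j, ∑ k, (Matrix.gram ℝ b)⁻¹ j k * inner ℝ (b k) (b j) = Fintype.card ι := by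
  have hu := (Matrix.isUnit_iff_isUnit_det _).1 (isUnit_gram hb)
  have h := congrArg Matrix.trace (Matrix.nonsing_inv_mul _ hu)
  rw [Matrix.trace_one] at h
  rw [← h]
  rfl

theorem integrable_residual_form {α : ℝ} (hM : ∃ M, ∫⁻ I, gramInv (row α I) ^ 2 ∂inputsLaw m n nv p ≤
    ENNReal.ofReal M) (σ ν : ℝ) (w₀ : Vec p) (j k : Fin m × Fin nv) :
    Integrable (fun S : Fin m → Task n nv p ↦ (Matrix.gram ℝ (row α (inputs S)))⁻¹ j k *
      (residual α w₀ S k * residual α w₀ S j)) (Measure.pi fun _ ↦ taskLaw n nv p σ ν w₀) := by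
  obtain ⟨M, hM⟩ := hM
  have hmp := measurePreserving_inputs (m := m) (n := n) (nv := nv) σ ν w₀
  have h1 := hmp.integrable_comp_of_integrable (integrable_gramInv_sq hM)
  have h2 : Integrable (fun S : Fin m → Task n nv p ↦ (residual α w₀ S k * residual α w₀ S j) ^ 2)
      (Measure.pi fun _ ↦ taskLaw n nv p σ ν w₀) := PolyGrowth.integrable (by fun_prop)
  refine (h1.add h2).mono' ?_ ?_
  · exact (((measurable_inv_gram_row α j k).comp hmp.measurable).aestronglyMeasurable).mul
      (PolyGrowth.continuous (by fun_prop)).aestronglyMeasurable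
  · filter_upwards [hmp.quasiMeasurePreserving.ae (gramInv_ne_top_ae hM)] with S hS
    have h3 := abs_inv_gram_le hS j k
    have h0 : 0 ≤ (gramInv (row α (inputs S))).toReal := ENNReal.toReal_nonneg
    rw [Real.norm_eq_abs, abs_mul, Pi.add_apply, Function.comp_apply,
      ← sq_abs (residual α w₀ S k * residual α w₀ S j)]
    set x := |residual α w₀ S k * residual α w₀ S j|
    have hx : 0 ≤ x := abs_nonneg _
    nlinarith [mul_le_mul_of_nonneg_right h3 hx,
      sq_nonneg ((gramInv (row α (inputs S))).toReal - x)]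

/-- The inverse Gram matrix depends on the inputs only, so Fubini averages the product of residuals
first. -/
theorem integral_residual_form {α : ℝ} (hM : ∃ M, ∫⁻ I, gramInv (row α I) ^ 2 ∂inputsLaw m n nv p ≤
    ENNReal.ofReal M) (σ ν : ℝ) (w₀ : Vec p) (j k : Fin m × Fin nv) :
    ∫ S : Fin m → Task n nv p, (Matrix.gram ℝ (row α (inputs S)))⁻¹ j k *
      (residual α w₀ S k * residual α w₀ S j) ∂(Measure.pi fun _ ↦ taskLaw n nv p σ ν w₀) =
    ∫ I, (Matrix.gram ℝ (row α I))⁻¹ j k * residualCov σ ν α I k j ∂inputsLaw m n nv p := by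
  have hmp := measurePreserving_mkTasks (m := m) (n := n) (nv := nv) σ ν w₀
  have hi := integrable_residual_form hM σ ν w₀ j k
  have hi' := hmp.integrable_comp_of_integrable hi
  rw [← hmp.map_eq] at hi ⊢
  rw [integral_map hmp.measurable.aemeasurable hi.aestronglyMeasurable]
  refine (integral_prod _ hi').trans ?_
  refine integral_congr_ae (ae_of_all _ fun I ↦ ?_)
  simp only [Function.comp_apply]
  have hI (ζ : Fin m → Noise n nv p) : inputs (mkTasks (I, ζ)) = I := rfl
  simp_rw [hI]
  rw [integral_const_mul, integral_residual_mul]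

end

/-! ### Comparison of the residual covariance with the Gram matrix, and the resulting distance
estimate -/

section

/-- For `α ≠ 1` the first square is a positive constant; for `α = 1` it vanishes and the term `(p +
1) / n` must be bounded below, which is where `n ≤ K * p` enters. -/
theorem exists_le_hCoef (α K : ℝ) : ∃ c : ℝ, 0 < c ∧ ∀ n p : ℕ, 0 < n → (n : ℝ) ≤ K * p →
    c ≤ hCoef α p n := by
  rcases eq_or_ne α 1 with rfl | hα
  · refine ⟨(max K 1)⁻¹, by positivity, fun n p hn h ↦ ?_⟩
    have hn0 : (0 : ℝ) < n := by exact_mod_cast hn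
    have h1 : (n : ℝ) ≤ max K 1 * p := h.trans (by gcongr; exact le_max_left _ _)
    have h2 : (max K 1)⁻¹ ≤ ((p : ℝ) + 1) / n := by
      rw [inv_eq_one_div, div_le_div_iff₀ (by positivity) hn0]
      nlinarith [le_max_right K 1]
    simpa [hCoef] using h2
  · refine ⟨(1 - α) ^ 2, sq_pos_of_ne_zero (sub_ne_zero.2 hα.symm), fun n p _ _ ↦ ?_⟩
    unfold hCoef
    have : 0 ≤ α ^ 2 * (((p : ℝ) + 1) / n) := by positivity
    linarith

/-- Average variance of the residuals. -/
def residualVar (σ ν α : ℝ) (p n : ℕ) : ℝ :=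
  ν ^ 2 * hCoef α p n + σ ^ 2 * (1 + α ^ 2 * p / n)

/-- The contribution of `ν²` to the covariance is itself a multiple of the Gram matrix and cancels.
The factor `residualVar / (p * hCoef)` makes the diagonal means agree, so that only two centred
fluctuations remain. -/
theorem residualCov_sub_eq_of_fst_eq {m n nv p : ℕ} (σ ν α : ℝ) (hn : 0 < n) (hp : 0 < p)
    (hh : hCoef α p n ≠ 0) (I : Inputs m n nv p) (i : Fin m) (a b : Fin nv) :
    residualCov σ ν α I (i, a) (i, b) - residualVar σ ν α p n / (p * hCoef α p n) *
        inner ℝ (row α I (i, a)) (row α I (i, b)) =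
      -(σ ^ 2 * (1 + α ^ 2 * p / n) / (p * hCoef α p n)) *
        (inner ℝ (row α I (i, a)) (row α I (i, b)) -
          if ((i, a) : Fin m × Fin nv) = (i, b) then p * hCoef α p n else 0) +
      σ ^ 2 * (α / n) ^ 2 * (∑ r, (inner ℝ ((I i).1 r) ((I i).2 a) : ℝ) *
        inner ℝ ((I i).1 r) ((I i).2 b) - if a = b then (n * p : ℝ) else 0) := by
  have hn0 : (n : ℝ) ≠ 0 := by exact_mod_cast hn.ne'
  have hp0 : (p : ℝ) ≠ 0 := by exact_mod_cast hp.ne'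
  simp only [residualCov, residualVar, if_true, Prod.mk.injEq, true_and]
  split_ifs with h
  · field_simp
    ring
  · field_simp
    ring

/-- Gram fluctuations have second moment `O(p)` and a coefficient `O(1 / p)`; those of the training
Gram matrix have second moment `O(n³)` and a coefficient `O(1 / n²)`. Both give `O(1 / p)`. For
different tasks the covariance vanishes and only the small Gram entry is left. -/
theorem integral_residualCov_sub_sq_le (σ ν α K : ℝ) : ∃ C : ℝ, 0 ≤ C ∧ ∀ m n nv p : ℕ,
    0 < n → 0 < p → (p : ℝ) ≤ K * n → (n : ℝ) ≤ K * p → ∀ j k : Fin m × Fin nv,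
    ∫ I, (residualCov σ ν α I j k - residualVar σ ν α p n / (p * hCoef α p n) *
      inner ℝ (row α I j) (row α I k)) ^ 2 ∂inputsLaw m n nv p ≤ C / p := by
  obtain ⟨C₁, hC₁0, hC₁⟩ := integral_gram_sub_sq_le α K
  obtain ⟨C₂, hC₂0, hC₂⟩ := integral_trainGram_sub_sq_le K
  obtain ⟨c, hc0, hc⟩ := exists_le_hCoef α K
  set A := σ ^ 2 * (1 + α ^ 2 * |K|) / c with hA
  have hA0 : 0 ≤ A := by positivity
  refine ⟨2 * A ^ 2 * C₁ + 2 * (σ ^ 2 * α ^ 2) ^ 2 * C₂ * |K| + (ν ^ 2 + A) ^ 2 * C₁,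
    by positivity, fun m n nv p hn hp hpn hnp j k ↦ ?_⟩
  have hn0 : (0 : ℝ) < n := by exact_mod_cast hn
  have hp0 : (0 : ℝ) < p := by exact_mod_cast hp
  have hh := hc n p hn hnp
  have hh0 : 0 < hCoef α p n := hc0.trans_le hh
  have hK : (p : ℝ) ≤ |K| * n := hpn.trans (by gcongr; exact le_abs_self K)
  have hA1 : σ ^ 2 * (1 + α ^ 2 * p / n) / (p * hCoef α p n) ≤ A / p := by
    rw [hA, div_div]
    have : α ^ 2 * p / n ≤ α ^ 2 * |K| := by
      rw [div_le_iff₀ hn0, mul_assoc]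
      gcongr
    rw [mul_comm c]
    gcongr
  have hA2 : 0 ≤ σ ^ 2 * (1 + α ^ 2 * p / n) / (p * hCoef α p n) := by positivity
  obtain ⟨i, a⟩ := j
  obtain ⟨i', b⟩ := k
  have h₁ := hC₁ m n nv p hn hp hpn (i, a) (i', b)
  rcases eq_or_ne i i' with rfl | hi
  · have h₂ := hC₂ m n nv p hn hp hpn i a b
    simp_rw [residualCov_sub_eq_of_fst_eq σ ν α hn hp hh0.ne']
    set B := σ ^ 2 * (1 + α ^ 2 * p / n) / (p * hCoef α p n)
    set f : Inputs m n nv p → ℝ := fun I ↦ inner ℝ (row α I (i, a)) (row α I (i, b)) -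
          if ((i, a) : Fin m × Fin nv) = (i, b) then p * hCoef α p n else 0 with hf
    set g : Inputs m n nv p → ℝ := fun I ↦ ∑ r, (inner ℝ ((I i).1 r) ((I i).2 a) : ℝ) *
        inner ℝ ((I i).1 r) ((I i).2 b) - if a = b then (n * p : ℝ) else 0 with hg
    have hfP : PolyGrowth f := by fun_prop
    have hgP : PolyGrowth g := by fun_prop
    calc ∫ I, (-B * f I + σ ^ 2 * (α / n) ^ 2 * g I) ^ 2 ∂inputsLaw m n nv p
        ≤ ∫ I, (2 * B ^ 2 * f I ^ 2 + 2 * (σ ^ 2 * (α / n) ^ 2) ^ 2 * g I ^ 2)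
          ∂inputsLaw m n nv p := by
          refine integral_mono (PolyGrowth.integrable (by fun_prop))
            (PolyGrowth.integrable (by fun_prop)) fun I ↦ ?_
          simp only
          nlinarith [sq_nonneg (B * f I + σ ^ 2 * (α / n) ^ 2 * g I)]
      _ = 2 * B ^ 2 * ∫ I, f I ^ 2 ∂inputsLaw m n nv p +
          2 * (σ ^ 2 * (α / n) ^ 2) ^ 2 * ∫ I, g I ^ 2 ∂inputsLaw m n nv p := by
          rw [integral_add (PolyGrowth.integrable (by fun_prop))
            (PolyGrowth.integrable (by fun_prop)), integral_const_mul, integral_const_mul]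
      _ ≤ 2 * (A / p) ^ 2 * (C₁ * p) + 2 * (σ ^ 2 * (α / n) ^ 2) ^ 2 * (C₂ * n ^ 3) := by
          gcongr
      _ = (2 * A ^ 2 * C₁) / p + 2 * (σ ^ 2 * α ^ 2) ^ 2 * C₂ * (1 / n) := by
          field_simp
      _ ≤ (2 * A ^ 2 * C₁) / p + 2 * (σ ^ 2 * α ^ 2) ^ 2 * C₂ * (|K| / p) := by
          have : (1 : ℝ) / n ≤ |K| / p := by
            rw [div_le_div_iff₀ hn0 hp0]
            linarith
          gcongr
      _ ≤ _ := by
          rw [add_div, add_div, mul_div_assoc (2 * (σ ^ 2 * α ^ 2) ^ 2 * C₂)]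
          have : 0 ≤ (ν ^ 2 + A) ^ 2 * C₁ / p := by positivity
          linarith
  · have hne : ((i, a) : Fin m × Fin nv) ≠ (i', b) := fun h ↦ hi (Prod.mk.inj h).1
    simp only [hne, if_false, sub_zero] at h₁
    simp only [residualCov, if_neg hi, zero_sub, neg_sq, mul_pow]
    rw [integral_const_mul]
    have hB : residualVar σ ν α p n / (p * hCoef α p n) ≤ (ν ^ 2 + A) / p := by
      rw [residualVar, add_div, add_div, mul_div_mul_right _ _ hh0.ne']
      gcongr
    have hB0 : 0 ≤ residualVar σ ν α p n / (p * hCoef α p n) := by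
      unfold residualVar
      positivity
    calc _ ≤ ((ν ^ 2 + A) / p) ^ 2 * (C₁ * p) := by gcongr
      _ = (ν ^ 2 + A) ^ 2 * C₁ / p := by field_simp
      _ ≤ _ := by
        gcongr
        have : 0 ≤ 2 * A ^ 2 * C₁ + 2 * (σ ^ 2 * α ^ 2) ^ 2 * C₂ * |K| := by positivity
        linarith

/-- The squared distance is `‖u‖² - A + noise`. The captured part `A` of the initial error has mean
`O(‖u‖² / p)` up to the stated error, by the fourth moments of the rows. The noise is `tr (G⁻¹ Σ)`
on average, split as `N β` plus a remainder involving `Σ - β G`. -/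
theorem exists_norm_trained_sub_sq_estimate (m nv : ℕ) (σ ν α K : ℝ) :
    ∃ C : ℝ, ∃ p₀ : ℕ, 0 < p₀ ∧ ∀ n p : ℕ, p₀ ≤ p → p₀ ≤ n → (p : ℝ) ≤ K * n → (n : ℝ) ≤ K * p →
      (∀ᵐ I ∂inputsLaw m n nv p, gramInv (row α I) ≠ ⊤) ∧ ∀ w₀ ω₀ : Vec p,
      Integrable (fun S : Fin m → Task n nv p ↦ ‖trained α w₀ ω₀ S - w₀‖ ^ 2)
        (Measure.pi fun _ ↦ taskLaw n nv p σ ν w₀) ∧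
      |∫ S : Fin m → Task n nv p, ‖trained α w₀ ω₀ S - w₀‖ ^ 2
        ∂(Measure.pi fun _ ↦ taskLaw n nv p σ ν w₀) -
        (‖ω₀ - w₀‖ ^ 2 + m * nv * (residualVar σ ν α p n / (p * hCoef α p n)))| ≤
        C * ((‖ω₀ - w₀‖ ^ 2 + (√p)⁻¹) / p) := by
  obtain ⟨M, q₀, hM⟩ := exists_lintegral_gramInv_row_le m nv α K
  obtain ⟨C₁, hC₁0, hC₁⟩ := integral_residualCov_sub_sq_le σ ν α K
  obtain ⟨C₂, hC₂0, hC₂⟩ := integral_inner_row_pow_four_le α K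
  obtain ⟨c, hc0, hc⟩ := exists_le_hCoef α K
  set N : ℝ := m * nv with hN
  refine ⟨(M + N ^ 2 * C₂) + N ^ 2 * (M + C₁), max q₀ 1, by simp,
    fun n p hp hn hpn hnp ↦ ?_⟩
  have hn1 : 0 < n := lt_of_lt_of_le (by simp) hn
  have hp1 : 0 < p := lt_of_lt_of_le (by simp) hp
  have hp0 : (0 : ℝ) < p := by exact_mod_cast hp1
  replace hM := hM n p ((le_max_left _ _).trans hp) ((le_max_left _ _).trans hn) hpn hnp
  have hfin := gramInv_ne_top_ae hM
  have hh0 : 0 < hCoef α p n := hc0.trans_le (hc n p hn1 hnp)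
  refine ⟨hfin, fun w₀ ω₀ ↦ ?_⟩
  have hmp := measurePreserving_inputs (m := m) (n := n) (nv := nv) σ ν w₀
  set u := ω₀ - w₀ with hu
  set H : (Fin m × Fin nv) → (Fin m × Fin nv) → Inputs m n nv p → ℝ :=
    fun j k I ↦ (Matrix.gram ℝ (row α I))⁻¹ j k with hH
  have hHm (j k) : Measurable (H j k) := measurable_inv_gram_row α j k
  set β := residualVar σ ν α p n / (p * hCoef α p n) with hβ
  -- the part of the initial error that is seen by the data
  set A : Inputs m n nv p → ℝ := fun I ↦ ∑ j, ∑ k, H j k I *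
    (inner ℝ (row α I k) u * inner ℝ (row α I j) u) with hA
  set g : Inputs m n nv p → ℝ := fun I ↦ ∑ j, (inner ℝ (row α I j) u : ℝ) ^ 2 with hg
  have hAm : Measurable A := by
    refine Finset.measurable_sum _ fun j _ ↦ Finset.measurable_sum _ fun k _ ↦ (hHm j k).mul ?_
    exact (PolyGrowth.continuous (by fun_prop)).measurable
  have hAeq (I) (hI : gramInv (row α I) ≠ ⊤) :
      A I = ‖gramSolve (row α I) (fun j ↦ inner ℝ (row α I j) u)‖ ^ 2 := by
    rw [← real_inner_self_eq_norm_sq, inner_gramSolve_gramSolve hI]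
  have hAg : ∀ᵐ I ∂inputsLaw m n nv p, |A I| ≤ (gramInv (row α I)).toReal * |g I| := by
    filter_upwards [hfin] with I hI
    rw [hAeq I hI, abs_of_nonneg (sq_nonneg _)]
    exact (norm_gramSolve_sq_le hI _).trans (by gcongr; exact le_abs_self _)
  have hgi : Integrable (fun I ↦ g I ^ 2) (inputsLaw m n nv p) :=
    PolyGrowth.integrable (by fun_prop)
  have hAi : Integrable A (inputsLaw m n nv p) :=
    integrable_of_abs_le_gramInv_mul hM hAm.aestronglyMeasurable hgi hAg
  -- The scale fed to the weighted inequality must be positive even when `u = 0`; adding `p^(-1/2)`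
  -- costs nothing, since the noise remainder has that scale anyway.
  have hs : 0 < ‖u‖ ^ 2 + (√p)⁻¹ := by positivity
  have hgs : ∫ I, g I ^ 2 ∂inputsLaw m n nv p ≤ N ^ 2 * C₂ * (‖u‖ ^ 2 + (√p)⁻¹) ^ 2 := by
    calc ∫ I, g I ^ 2 ∂inputsLaw m n nv p
        ≤ ∫ I, N * ∑ j, (inner ℝ (row α I j) u : ℝ) ^ 4 ∂inputsLaw m n nv p := by
          refine integral_mono hgi (PolyGrowth.integrable (by fun_prop)) fun I ↦ ?_
          have := sq_sum_le_card_mul_sum_sq (s := Finset.univ)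
            (f := fun j ↦ (inner ℝ (row α I j) u : ℝ) ^ 2)
          simpa [← pow_mul, hN] using this
      _ = N * ∑ j, ∫ I, (inner ℝ (row α I j) u : ℝ) ^ 4 ∂inputsLaw m n nv p := by
          rw [integral_const_mul, integral_finsetSum _ fun j _ ↦ PolyGrowth.integrable (by fun_prop)]
      _ ≤ N * ∑ _j : Fin m × Fin nv, C₂ * ‖u‖ ^ 4 := by
          gcongr with j
          exact hC₂ m n nv p hn1 hpn j u
      _ = N ^ 2 * C₂ * (‖u‖ ^ 2) ^ 2 := by
          simp [hN]
          ring
      _ ≤ _ := by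
          gcongr
          have : 0 ≤ (√(p : ℝ))⁻¹ := by positivity
          linarith
  have hAb := abs_integral_le_of_abs_le_gramInv_mul M.coe_nonneg hM hp1 hs hgi hgs hAg
  -- the contribution of the noise
  have hRi (j k) := integrable_residual_form ⟨_, hM⟩ σ ν w₀ j k
  have hRe (j k) := integral_residual_form ⟨_, hM⟩ σ ν w₀ j k
  set D : (Fin m × Fin nv) → (Fin m × Fin nv) → Inputs m n nv p → ℝ :=
    fun j k I ↦ residualCov σ ν α I k j - β * inner ℝ (row α I k) (row α I j) with hD
  have hHP (j k) (f : Inputs m n nv p → ℝ) (hf : PolyGrowth f) :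
      (∀ᵐ I ∂inputsLaw m n nv p, |H j k I * f I| ≤ (gramInv (row α I)).toReal * |f I|) ∧
      Integrable (fun I ↦ H j k I * f I) (inputsLaw m n nv p) := by
    have h1 : ∀ᵐ I ∂inputsLaw m n nv p, |H j k I * f I| ≤ (gramInv (row α I)).toReal * |f I| := by
      filter_upwards [hfin] with I hI
      rw [abs_mul]
      gcongr
      exact abs_inv_gram_le hI j k
    exact ⟨h1, integrable_of_abs_le_gramInv_mul hM
      ((hHm j k).mul hf.continuous.measurable).aestronglyMeasurable
      (PolyGrowth.integrable (by fun_prop)) h1⟩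
  have hDP (j k) : PolyGrowth (D j k) := by
    simp only [hD]
    fun_prop
  have hDb (j k) : |∫ I, H j k I * D j k I ∂inputsLaw m n nv p| ≤ (M + C₁) * ((√p)⁻¹ / p) := by
    refine abs_integral_le_of_abs_le_gramInv_mul M.coe_nonneg hM hp1 (by positivity)
      (PolyGrowth.integrable ((hDP j k).pow 2)) ?_ (hHP j k _ (hDP j k)).1
    refine (hC₁ m n nv p hn1 hp1 hpn hnp k j).trans (le_of_eq ?_)
    rw [inv_pow, Real.sq_sqrt hp0.le, div_eq_mul_inv]
  have hsum : ∑ j, ∑ k, ∫ I, H j k I * residualCov σ ν α I k j ∂inputsLaw m n nv p =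
      N * β + ∑ j, ∑ k, ∫ I, H j k I * D j k I ∂inputsLaw m n nv p := by
    have e1 (j k) : ∫ I, H j k I * residualCov σ ν α I k j ∂inputsLaw m n nv p =
        β * ∫ I, H j k I * inner ℝ (row α I k) (row α I j) ∂inputsLaw m n nv p +
          ∫ I, H j k I * D j k I ∂inputsLaw m n nv p := by
      rw [← integral_const_mul, ← integral_add (((hHP j k _ (by fun_prop)).2).const_mul _)
        (hHP j k _ (hDP j k)).2]
      congr 1
      funext I
      simp only [hD]
      ring
    simp_rw [e1, Finset.sum_add_distrib]
    congr 1
    simp_rw [← Finset.mul_sum]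
    rw [mul_comm]
    congr 1
    have e2 : ∑ j, ∑ k, ∫ I, H j k I * inner ℝ (row α I k) (row α I j) ∂inputsLaw m n nv p =
        ∫ I, ∑ j, ∑ k, H j k I * inner ℝ (row α I k) (row α I j) ∂inputsLaw m n nv p := by
      rw [integral_finsetSum _ fun j _ ↦ integrable_finsetSum _ fun k _ ↦
        (hHP j k _ (by fun_prop)).2]
      refine Finset.sum_congr rfl fun j _ ↦ ?_
      rw [integral_finsetSum _ fun k _ ↦ (hHP j k _ (by fun_prop)).2]
    rw [e2, integral_congr_ae (g := fun _ ↦ N)]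
    · simp
    · filter_upwards [hfin] with I hI
      rw [sum_inv_gram_mul hI]
      simp [hN]
  -- the sum of the contributions
  have hae : (fun S : Fin m → Task n nv p ↦ ‖trained α w₀ ω₀ S - w₀‖ ^ 2)
      =ᵐ[Measure.pi fun _ ↦ taskLaw n nv p σ ν w₀] fun S ↦ (‖u‖ ^ 2 - A (inputs S)) +
        ∑ j, ∑ k, H j k (inputs S) * (residual α w₀ S k * residual α w₀ S j) := by
    filter_upwards [hmp.quasiMeasurePreserving.ae hfin] with S hS
    rw [norm_trained_sub_sq α w₀ ω₀ S hS, hAeq _ hS, ← inner_gramSolve_gramSolve hS,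
      real_inner_self_eq_norm_sq]
  have hi1 : Integrable (fun S : Fin m → Task n nv p ↦ A (inputs S))
      (Measure.pi fun _ ↦ taskLaw n nv p σ ν w₀) := hmp.integrable_comp_of_integrable hAi
  have hi2 : Integrable (fun S : Fin m → Task n nv p ↦ ‖u‖ ^ 2 - A (inputs S))
      (Measure.pi fun _ ↦ taskLaw n nv p σ ν w₀) := (integrable_const _).sub hi1
  have hi3 : Integrable (fun S : Fin m → Task n nv p ↦
      ∑ j, ∑ k, H j k (inputs S) * (residual α w₀ S k * residual α w₀ S j))
      (Measure.pi fun _ ↦ taskLaw n nv p σ ν w₀) :=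
    integrable_finsetSum _ fun j _ ↦ integrable_finsetSum _ fun k _ ↦ hRi j k
  refine ⟨(hi2.add hi3).congr hae.symm, ?_⟩
  have hAint : ∫ S : Fin m → Task n nv p, A (inputs S)
      ∂(Measure.pi fun _ ↦ taskLaw n nv p σ ν w₀) = ∫ I, A I ∂inputsLaw m n nv p := by
    rw [show inputsLaw m n nv p = _ from hmp.map_eq.symm,
      integral_map hmp.measurable.aemeasurable hAm.aestronglyMeasurable]
  rw [integral_congr_ae hae, integral_add hi2 hi3, integral_sub (integrable_const _) hi1, hAint,
    integral_finsetSum _ fun j _ ↦ integrable_finsetSum _ fun k _ ↦ hRi j k]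
  have e3 : ∑ j, ∫ S : Fin m → Task n nv p,
      ∑ k, H j k (inputs S) * (residual α w₀ S k * residual α w₀ S j)
        ∂(Measure.pi fun _ ↦ taskLaw n nv p σ ν w₀) =
      N * β + ∑ j, ∑ k, ∫ I, H j k I * D j k I ∂inputsLaw m n nv p := by
    rw [← hsum]
    refine Finset.sum_congr rfl fun j _ ↦ ?_
    rw [integral_finsetSum _ fun k _ ↦ hRi j k]
    exact Finset.sum_congr rfl fun k _ ↦ hRe j k
  rw [e3]
  have e4 : |∑ j, ∑ k, ∫ I, H j k I * D j k I ∂inputsLaw m n nv p| ≤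
      N ^ 2 * (M + C₁) * ((√p)⁻¹ / p) := by
    refine (Finset.abs_sum_le_sum_abs _ _).trans ?_
    calc _ ≤ ∑ _j : Fin m × Fin nv, ∑ _k : Fin m × Fin nv, (M + C₁) * ((√p)⁻¹ / p) :=
          Finset.sum_le_sum fun j _ ↦ (Finset.abs_sum_le_sum_abs _ _).trans
            (Finset.sum_le_sum fun k _ ↦ hDb j k)
      _ = _ := by
          simp [hN]
          ring
  have e5 : N ^ 2 * (M + C₁) * ((√p)⁻¹ / p) ≤ N ^ 2 * (M + C₁) * ((‖u‖ ^ 2 + (√p)⁻¹) / p) := by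
    gcongr
    have := sq_nonneg ‖u‖
    linarith
  simp only [integral_const, probReal_univ, one_smul]
  rw [abs_le] at hAb e4 ⊢
  constructor <;> linarith [hAb.1, hAb.2, e4.1, e4.2]

end

section

/-! ### The average test loss -/

variable {m n nv nr ns p : ℕ}

theorem measurable_trained (α : ℝ) (w₀ ω₀ : Vec p) :
    Measurable (trained α w₀ ω₀ : (Fin m → Task n nv p) → Vec p) := by
  have hin := (measurePreserving_inputs (m := m) (n := n) (nv := nv) 0 0 w₀).measurable
  have hrow (j : Fin m × Fin nv) :
      Measurable (fun S : Fin m → Task n nv p ↦ row α (inputs S) j) :=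
    (PolyGrowth.row α PolyGrowth.id j).continuous.measurable.comp hin
  have hres (j : Fin m × Fin nv) :
      Measurable (fun S : Fin m → Task n nv p ↦ residual α w₀ S j) :=
    (PolyGrowth.residual α w₀ PolyGrowth.id j).continuous.measurable
  have hH (j k : Fin m × Fin nv) := (measurable_inv_gram_row (n := n) (p := p) α j k).comp hin
  unfold trained gramSolve Matrix.mulVec dotProduct
  refine measurable_const.add (Finset.measurable_sum _ fun j _ ↦
    (Finset.measurable_sum _ fun k _ ↦ (hH j k).mul ((hres k).sub ?_)).smul (hrow j))
  exact (hrow k).inner measurable_const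

theorem measurable_dataLoss_trained (αt αr : ℝ) (w₀ ω₀ : Vec p) :
    Measurable (fun S : (Fin m → Task n nv p) × Task nr ns p ↦
      dataLoss S.2.evalSet (adapt αr S.2.adaptSet (trained αt w₀ ω₀ S.1))) := by
  have h1 : PolyGrowth (fun x : Vec p × Task nr ns p ↦
      dataLoss x.2.evalSet (adapt αr x.2.adaptSet x.1)) :=
    PolyGrowth.dataLoss_adapt αr (by fun_prop) (by fun_prop)
  have h2 : Measurable (fun S : (Fin m → Task n nv p) × Task nr ns p ↦
      (trained αt w₀ ω₀ S.1, S.2)) :=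
    ((measurable_trained αt w₀ ω₀).comp measurable_fst).prodMk measurable_snd
  have h3 := h1.continuous.measurable.comp h2
  exact h3

theorem testLoss_ae_eq (hm : 0 < m) (hnv : 0 < nv) (σ ν αt αr : ℝ) (w₀ ω₀ : Vec p)
    (hfin : ∀ᵐ I ∂inputsLaw m n nv p, gramInv (row αt I) ≠ ⊤) :
    testLoss αt αr ω₀ =ᵐ[law m n nv nr ns p σ ν w₀] fun S ↦
      dataLoss S.2.evalSet (adapt αr S.2.adaptSet (trained αt w₀ ω₀ S.1)) := by
  have h1 : ∀ᵐ S ∂law m n nv nr ns p σ ν w₀, gramInv (row αt (inputs S.1)) ≠ ⊤ :=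
    Measure.quasiMeasurePreserving_fst.ae
      ((measurePreserving_inputs σ ν w₀).quasiMeasurePreserving.ae hfin)
  refine h1.mono fun S hS ↦ ?_
  rw [testLoss, outerLoop_metaLoss hm hnv αt w₀ ω₀ S.1 hS]

theorem integrable_dataLoss_adapt (σ ν α : ℝ) (w₀ ω : Vec p) :
    Integrable (fun T : Task nr ns p ↦ dataLoss T.evalSet (adapt α T.adaptSet ω))
      (taskLaw nr ns p σ ν w₀) :=
  PolyGrowth.integrable (PolyGrowth.dataLoss_adapt α (by fun_prop) (by fun_prop))

theorem integrable_const_add_mul {Ω : Type*} [MeasurableSpace Ω] {μ : Measure Ω}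
    [IsFiniteMeasure μ] {f : Ω → ℝ} (hf : Integrable f μ) (a b c : ℝ) :
    Integrable (fun x ↦ a + b * (c + f x)) μ :=
  (integrable_const _).add (((integrable_const _).add hf).const_mul _)

theorem integral_const_add_mul {Ω : Type*} [MeasurableSpace Ω] {μ : Measure Ω}
    [IsProbabilityMeasure μ] {f : Ω → ℝ} (hf : Integrable f μ) (a b c : ℝ) :
    ∫ x, (a + b * (c + f x)) ∂μ = a + b * (c + ∫ x, f x ∂μ) := by
  have h : Integrable (fun x ↦ c + f x) μ := (integrable_const _).add hf
  rw [integral_add (integrable_const _) (h.const_mul _), integral_const_mul,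
    integral_add (integrable_const _) hf]
  simp

/-- The trained parameters are not of polynomial growth in the data. The loss is nonnegative, so it
suffices that its mean over the test task, affine in the squared distance, is integrable over the
training tasks. -/
theorem integrable_dataLoss_trained (hnr : 0 < nr) (hns : 0 < ns) (hp : 0 < p) (σ ν αt αr : ℝ)
    (w₀ ω₀ : Vec p)
    (hint : Integrable (fun S : Fin m → Task n nv p ↦ ‖trained αt w₀ ω₀ S - w₀‖ ^ 2)
      (Measure.pi fun _ ↦ taskLaw n nv p σ ν w₀)) :
    Integrable (fun S : (Fin m → Task n nv p) × Task nr ns p ↦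
      dataLoss S.2.evalSet (adapt αr S.2.adaptSet (trained αt w₀ ω₀ S.1)))
      (law m n nv nr ns p σ ν w₀) := by
  have h0 (D : Points ns p) (θ : Vec p) : 0 ≤ dataLoss D θ := by
    simp only [dataLoss, pointLoss]
    positivity
  have h1 : AEStronglyMeasurable (fun S : (Fin m → Task n nv p) × Task nr ns p ↦
      dataLoss S.2.evalSet (adapt αr S.2.adaptSet (trained αt w₀ ω₀ S.1)))
      (law m n nv nr ns p σ ν w₀) :=
    (measurable_dataLoss_trained αt αr w₀ ω₀).aestronglyMeasurable
  have h2 (S : Fin m → Task n nv p) : ∫ T : Task nr ns p,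
      ‖dataLoss T.evalSet (adapt αr T.adaptSet (trained αt w₀ ω₀ S))‖ ∂taskLaw nr ns p σ ν w₀ =
      σ ^ 2 / 2 * (1 + αr ^ 2 * p / nr) +
        hCoef αr p nr / 2 * (ν ^ 2 + ‖trained αt w₀ ω₀ S - w₀‖ ^ 2) := by
    rw [← integral_testTask hnr hns hp]
    exact integral_congr_ae (ae_of_all _ fun T ↦ Real.norm_of_nonneg (h0 _ _))
  have h3 : ∀ᵐ S ∂(Measure.pi fun _ : Fin m ↦ taskLaw n nv p σ ν w₀),
      Integrable (fun T : Task nr ns p ↦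
        dataLoss T.evalSet (adapt αr T.adaptSet (trained αt w₀ ω₀ S))) (taskLaw nr ns p σ ν w₀) :=
    ae_of_all _ fun S ↦ integrable_dataLoss_adapt σ ν αr w₀ (trained αt w₀ ω₀ S)
  have h4 : Integrable (fun S : Fin m → Task n nv p ↦ ∫ T : Task nr ns p,
      ‖dataLoss T.evalSet (adapt αr T.adaptSet (trained αt w₀ ω₀ S))‖ ∂taskLaw nr ns p σ ν w₀)
      (Measure.pi fun _ : Fin m ↦ taskLaw n nv p σ ν w₀) := by
    simp only [h2]
    exact integrable_const_add_mul hint _ _ _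
  have h5 := integrable_prod_iff h1
  exact h5.2 ⟨h3, h4⟩

theorem avgTestLoss_eq (hm : 0 < m) (hnv : 0 < nv) (hnr : 0 < nr)
    (hns : 0 < ns) (hp : 0 < p) (σ ν αt αr : ℝ) (w₀ ω₀ : Vec p)
    (hfin : ∀ᵐ I ∂inputsLaw m n nv p, gramInv (row αt I) ≠ ⊤)
    (hint : Integrable (fun S : Fin m → Task n nv p ↦ ‖trained αt w₀ ω₀ S - w₀‖ ^ 2)
      (Measure.pi fun _ ↦ taskLaw n nv p σ ν w₀)) :
    avgTestLoss m n nv nr ns p σ ν αt αr w₀ ω₀ =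
      σ ^ 2 / 2 * (1 + αr ^ 2 * p / nr) + hCoef αr p nr / 2 *
        (ν ^ 2 + ∫ S : Fin m → Task n nv p, ‖trained αt w₀ ω₀ S - w₀‖ ^ 2
          ∂(Measure.pi fun _ ↦ taskLaw n nv p σ ν w₀)) := by
  rw [avgTestLoss, integral_congr_ae (testLoss_ae_eq hm hnv σ ν αt αr w₀ ω₀ hfin), law,
    integral_prod _ (integrable_dataLoss_trained hnr hns hp σ ν αt αr w₀ ω₀ hint)]
  simp_rw [integral_testTask hnr hns hp]
  exact integral_const_add_mul hint _ _ _

/-- Nonasymptotic form of the approximation of the average test loss. -/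
theorem exists_avgTestLoss_estimate (hm : 0 < m) (hnv : 0 < nv) (σ ν αt αr K : ℝ) :
    ∃ C : ℝ, ∃ p₀ : ℕ, 0 ≤ C ∧ 0 < p₀ ∧ ∀ n nr ns p : ℕ, p₀ ≤ p → p₀ ≤ n → (p : ℝ) ≤ K * n →
      (n : ℝ) ≤ K * p → 0 < nr → 0 < ns → ∀ w₀ ω₀ : Vec p,
      Integrable (testLoss αt αr ω₀) (law m n nv nr ns p σ ν w₀) ∧
      |avgTestLoss m n nv nr ns p σ ν αt αr w₀ ω₀ -
        closedForm m n nv nr p σ ν αt αr ‖ω₀ - w₀‖| ≤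
        C * (hCoef αr p nr * ((‖ω₀ - w₀‖ ^ 2 + (√p)⁻¹) / p)) := by
  obtain ⟨C, p₀, hp₀, hC⟩ := exists_norm_trained_sub_sq_estimate m nv σ ν αt K
  obtain ⟨c, hc0, hc⟩ := exists_le_hCoef αt K
  refine ⟨|C| + nv * m, p₀, by positivity, hp₀, fun n nr ns p hp hn hpn hnp hnr hns w₀ ω₀ ↦ ?_⟩
  obtain ⟨hfin, h⟩ := hC n p hp hn hpn hnp
  obtain ⟨hint, hest⟩ := h w₀ ω₀
  have hp0 : (0 : ℝ) < p := by exact_mod_cast hp₀.trans_le hp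
  have h2 := avgTestLoss_eq hm hnv hnr hns (hp₀.trans_le hp) σ ν αt αr w₀ ω₀ hfin hint
  refine ⟨(integrable_dataLoss_trained hnr hns (hp₀.trans_le hp) σ ν αt αr w₀ ω₀ hint).congr
    (testLoss_ae_eq hm hnv σ ν αt αr w₀ ω₀ hfin).symm, ?_⟩
  set J := ∫ S : Fin m → Task n nv p, ‖trained αt w₀ ω₀ S - w₀‖ ^ 2
    ∂(Measure.pi fun _ ↦ taskLaw n nv p σ ν w₀)
  have hh0 : 0 < hCoef αt p n := hc0.trans_le (hc n p (hp₀.trans_le hn) hnp)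
  have hr0 := hCoef_nonneg αr p nr
  set d := ‖ω₀ - w₀‖
  -- The distance estimate is centred at `d²`, whereas the closed form has `(1 - nv m / p) d²`; the
  -- discrepancy is itself of the size of the error and is absorbed into the constant.
  have e : avgTestLoss m n nv nr ns p σ ν αt αr w₀ ω₀ - closedForm m n nv nr p σ ν αt αr d =
      hCoef αr p nr / 2 * ((J - (d ^ 2 + m * nv * (residualVar σ ν αt p n /
        (p * hCoef αt p n)))) + nv * m * (d ^ 2 / p)) := by
    rw [h2, closedForm, residualVar]
    field_simp
    ring
  rw [e, abs_mul, abs_of_nonneg (by positivity)]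
  set q := (d ^ 2 + (√p)⁻¹) / p with hq
  have hq0 : 0 ≤ q := by positivity
  have hdq : d ^ 2 / p ≤ q := by
    rw [hq]
    gcongr
    have : 0 ≤ (√(p : ℝ))⁻¹ := by positivity
    linarith
  have e2 : |(J - (d ^ 2 + m * nv * (residualVar σ ν αt p n /
      (p * hCoef αt p n)))) + nv * m * (d ^ 2 / p)| ≤ (|C| + nv * m) * q := by
    refine (abs_add_le _ _).trans ?_
    rw [add_mul, abs_of_nonneg (by positivity : 0 ≤ nv * m * (d ^ 2 / p))]
    gcongr
    exact hest.trans (by gcongr; exact le_abs_self C)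
  calc _ ≤ hCoef αr p nr / 2 * ((|C| + nv * m) * q) := by gcongr
    _ ≤ hCoef αr p nr * ((|C| + nv * m) * q) := by gcongr; linarith
    _ = _ := by ring

end

end MAML

end

/-! ### Asymptotic form of the estimate -/

theorem theorem1 (m nv : ℕ) (hm : 0 < m) (hnv : 0 < nv) (σ ν αt αr : ℝ)
    (p nt nr ns : ℝ → ℕ)
    (hover : ∀ᶠ ξ in atTop, nv * m < p ξ)
    (hp : (fun ξ ↦ (p ξ : ℝ)) =Θ[atTop] fun ξ ↦ ξ)
    (hnt : (fun ξ ↦ (nt ξ : ℝ)) =Θ[atTop] fun ξ ↦ ξ)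
    (hnr : ∀ᶠ ξ in atTop, 0 < nr ξ) (hns : ∀ᶠ ξ in atTop, 0 < ns ξ)
    (w₀ ω₀ : (ξ : ℝ) → MAML.Vec (p ξ))
    (hω₀ : (fun ξ ↦ ‖ω₀ ξ - w₀ ξ‖) =O[atTop] fun ξ ↦ ξ ^ (-(1 / 4) : ℝ)) :
    (∀ᶠ ξ in atTop,
      Integrable (MAML.testLoss αt αr (ω₀ ξ))
        (MAML.law m (nt ξ) nv (nr ξ) (ns ξ) (p ξ) σ ν (w₀ ξ))) ∧
    ((fun ξ ↦ MAML.avgTestLoss m (nt ξ) nv (nr ξ) (ns ξ) (p ξ) σ ν αt αr (w₀ ξ) (ω₀ ξ) -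
        MAML.closedForm m (nt ξ) nv (nr ξ) (p ξ) σ ν αt αr ‖ω₀ ξ - w₀ ξ‖)
      =O[atTop] fun ξ ↦ MAML.hCoef αr (p ξ) (nr ξ) * ξ ^ (-(3 / 2) : ℝ)) ∧
    (((fun ξ ↦ MAML.hCoef αr (p ξ) (nr ξ)) =O[atTop] fun _ ↦ (1 : ℝ)) →
      (fun ξ ↦ MAML.avgTestLoss m (nt ξ) nv (nr ξ) (ns ξ) (p ξ) σ ν αt αr (w₀ ξ) (ω₀ ξ) -
        MAML.closedForm m (nt ξ) nv (nr ξ) (p ξ) σ ν αt αr ‖ω₀ ξ - w₀ ξ‖)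
      =O[atTop] fun ξ ↦ ξ ^ (-(3 / 2) : ℝ)) := by
  obtain ⟨c₁, hc₁, h₁⟩ := hp.1.exists_pos
  obtain ⟨c₂, hc₂, h₂⟩ := hp.2.exists_pos
  obtain ⟨c₃, hc₃, h₃⟩ := hnt.1.exists_pos
  obtain ⟨c₄, hc₄, h₄⟩ := hnt.2.exists_pos
  obtain ⟨c₅, hc₅, h₅⟩ := hω₀.exists_pos
  -- The order relations with `ξ` give `p ≤ c₁ c₄ nt` and `nt ≤ c₃ c₂ p`, so the maximum of the two
  -- products bounds both ratios.
  obtain ⟨C, p₀, hC0, hp₀, hC⟩ := MAML.exists_avgTestLoss_estimate (m := m) (nv := nv) hm hnv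
    σ ν αt αr (max (c₁ * c₄) (c₃ * c₂))
  have main : ∀ᶠ ξ in atTop,
      Integrable (MAML.testLoss αt αr (ω₀ ξ))
        (MAML.law m (nt ξ) nv (nr ξ) (ns ξ) (p ξ) σ ν (w₀ ξ)) ∧
      ‖MAML.avgTestLoss m (nt ξ) nv (nr ξ) (ns ξ) (p ξ) σ ν αt αr (w₀ ξ) (ω₀ ξ) -
        MAML.closedForm m (nt ξ) nv (nr ξ) (p ξ) σ ν αt αr ‖ω₀ ξ - w₀ ξ‖‖ ≤
        C * ((c₅ ^ 2 + √c₂) * c₂) * ‖MAML.hCoef αr (p ξ) (nr ξ) * ξ ^ (-(3 / 2) : ℝ)‖ := by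
    filter_upwards [h₁.bound, h₂.bound, h₃.bound, h₄.bound, h₅.bound, hnr, hns,
      eventually_gt_atTop (0 : ℝ), eventually_ge_atTop (c₂ * p₀),
      eventually_ge_atTop (c₄ * p₀)] with ξ b₁ b₂ b₃ b₄ b₅ hnr hns hξ hξ₂ hξ₄
    simp only [Real.norm_eq_abs, Nat.abs_cast, abs_of_pos hξ, abs_norm,
      abs_of_pos (Real.rpow_pos_of_pos hξ _)] at b₁ b₂ b₃ b₄ b₅
    have hpp : p₀ ≤ p ξ := by
      have : (p₀ : ℝ) ≤ p ξ := le_of_mul_le_mul_left (hξ₂.trans b₂) hc₂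
      exact_mod_cast this
    have hnn : p₀ ≤ nt ξ := by
      have : (p₀ : ℝ) ≤ nt ξ := le_of_mul_le_mul_left (hξ₄.trans b₄) hc₄
      exact_mod_cast this
    have hp0 : (0 : ℝ) < p ξ := by exact_mod_cast hp₀.trans_le hpp
    have k₁ : (p ξ : ℝ) ≤ max (c₁ * c₄) (c₃ * c₂) * nt ξ := by
      calc (p ξ : ℝ) ≤ c₁ * (c₄ * nt ξ) := b₁.trans (by gcongr)
        _ = c₁ * c₄ * nt ξ := by ring
        _ ≤ _ := by gcongr; exact le_max_left _ _
    have k₂ : (nt ξ : ℝ) ≤ max (c₁ * c₄) (c₃ * c₂) * p ξ := by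
      calc (nt ξ : ℝ) ≤ c₃ * (c₂ * p ξ) := b₃.trans (by gcongr)
        _ = c₃ * c₂ * p ξ := by ring
        _ ≤ _ := by gcongr; exact le_max_right _ _
    obtain ⟨i₁, i₂⟩ := hC (nt ξ) (nr ξ) (ns ξ) (p ξ) hpp hnn k₁ k₂ hnr hns (w₀ ξ) (ω₀ ξ)
    refine ⟨i₁, i₂.trans ?_⟩
    have hh := MAML.hCoef_nonneg αr (p ξ) (nr ξ)
    rw [Real.norm_of_nonneg (by positivity)]
    have d₁ : ‖ω₀ ξ - w₀ ξ‖ ^ 2 ≤ c₅ ^ 2 * ξ ^ (-(1 / 2) : ℝ) := by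
      calc ‖ω₀ ξ - w₀ ξ‖ ^ 2 ≤ (c₅ * ξ ^ (-(1 / 4) : ℝ)) ^ 2 := by gcongr
        _ = _ := by
          rw [mul_pow, ← Real.rpow_natCast (ξ ^ (-(1 / 4) : ℝ)), ← Real.rpow_mul hξ.le]
          norm_num
    have d₂ : (√(p ξ : ℝ))⁻¹ ≤ √c₂ * ξ ^ (-(1 / 2) : ℝ) := by
      rw [Real.rpow_neg hξ.le, ← Real.sqrt_eq_rpow, ← div_eq_mul_inv, inv_eq_one_div,
        div_le_div_iff₀ (by positivity) (by positivity), one_mul, ← Real.sqrt_mul hc₂.le]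
      exact Real.sqrt_le_sqrt b₂
    have d₃ : (p ξ : ℝ)⁻¹ ≤ c₂ * ξ ^ (-1 : ℝ) := by
      rw [Real.rpow_neg_one, ← div_eq_mul_inv, inv_eq_one_div, div_le_div_iff₀ hp0 hξ]
      linarith
    -- The rate `ξ^(-1/4)` for the initial distance is what makes its square match the fluctuation
    -- scale `p^(-1/2)`; division by `p` gives the exponent `-3/2`.
    have d₄ : (‖ω₀ ξ - w₀ ξ‖ ^ 2 + (√(p ξ : ℝ))⁻¹) / p ξ ≤
        (c₅ ^ 2 + √c₂) * c₂ * ξ ^ (-(3 / 2) : ℝ) := by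
      calc (‖ω₀ ξ - w₀ ξ‖ ^ 2 + (√(p ξ : ℝ))⁻¹) / p ξ
          ≤ (c₅ ^ 2 * ξ ^ (-(1 / 2) : ℝ) + √c₂ * ξ ^ (-(1 / 2) : ℝ)) * (c₂ * ξ ^ (-1 : ℝ)) := by
            rw [div_eq_mul_inv]
            gcongr
        _ = (c₅ ^ 2 + √c₂) * c₂ * (ξ ^ (-(1 / 2) : ℝ) * ξ ^ (-1 : ℝ)) := by ring
        _ = _ := by
            rw [← Real.rpow_add hξ]
            norm_num
    calc C * (MAML.hCoef αr (p ξ) (nr ξ) *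
          ((‖ω₀ ξ - w₀ ξ‖ ^ 2 + (√(p ξ : ℝ))⁻¹) / p ξ))
        ≤ C * (MAML.hCoef αr (p ξ) (nr ξ) * ((c₅ ^ 2 + √c₂) * c₂ * ξ ^ (-(3 / 2) : ℝ))) := by
          gcongr
      _ = _ := by ring
  have hO := IsBigO.of_bound _ (main.mono fun ξ h ↦ h.2)
  refine ⟨main.mono fun ξ h ↦ h.1, hO, fun hb ↦ hO.trans ?_⟩
  simpa using hb.mul (isBigO_refl (fun ξ : ℝ ↦ ξ ^ (-(3 / 2) : ℝ)) atTop)
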